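/- All spaces $\Omega$ are locally compact Hausdorff with countable base. A biharmonic space is such an $\Omega$ with a sheaf $\mathcal H$ of vector spaces of pairs of continuous real functions such that: if $(u,v)\in\mathcal H(U)$ and $u=0$ on an open $\omega\subset U$, then $v=0$ on $\omega$; the relatively compact open sets $\omega$ that are regular form a base, regular meaning that the Riquier problem ($u\to f$, $v\to g$ at $\partial\omega$, $(u,v)\in\mathcal H(\omega)$) has a unique solution for all continuous $f,g$ on $\partial\omega$, nonnegative if $f,g\ge 0$, so that at $x\in\omega$ the solution is $\left(\int f\,d\mu^\omega_x+\int g\,d\nu^\omega_x,\ \int g\,d\lambda^\omega_x\right)$ for nonnegative measures on $\partial\omega$; and the two associated sheaves $\mathcal H_1,\mathcal H_2$ below define Bauer harmonic spaces. A pair $(u,v)$ of l.s.c. functions $U\to(-\infty,+\infty]$ is hyperharmonic, $(u,v)\in\mathcal H^*(U)$, if $\int^* u\,d\mu^\omega_x+\int^* v\,d\nu^\omega_x\le u(x)$ and $\int^* v\,d\lambda^\omega_x\le v(x)$ for all regular $\omega$ with $\overline\omega\subset U$ and all $x\in\omega$; it is superharmonic if moreover $u$ is finite on a dense set. Here $\mathcal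 H_1(U)=\{h:(\pm h,0)\in\mathcal H^*(U)\}$ and $\mathcal H_2(U)=\{k:(+\infty,\pm k)\in\mathcal H^*(U)\}$. An $\mathcal H$-potential is a nonnegative superharmonic pair on $\Omega$ whose only nonnegative biharmonic minorant is $(0,0)$. The space is strong if there is an $\mathcal H$-potential $(p,q)$ with $p,q>0$, and Green if both associated harmonic spaces are Brelot spaces in which any two potentials with the same one-point harmonic support are proportional. Let $N\ge 5$ and, for $U\subset\mathbb R^N$ open, let $$\mathcal H(U)=\{(h,k)\in\mathcal C^2(U)\times\mathcal C^2(U):\ \Delta h=-k,\ \Delta k=0\}.$$ Then: 1. $(\mathbb R^N,\mathcal H)$ is a biharmonic space, and there is no $(h,k)\in\mathcal H(\mathbb R^N)$ with $h>0$ and $k>0$ on $\mathbb R^N$. 2. There is a finite continuous $\mathcal H$-potential $(p,q)$ on $\mathbb R^N$ with $p>0$ and $q>0$. 3. For every finite continuous $\mathcal H$-potential $(p,q)$ with $p,q>0$, put $\mathcal H'(U)=\{(h,k)\in\mathcal C(U)\times\mathcal C(U):(ph,qk)\in\mathcal H(U)\}$ for $U\subset\mathbb R^N$ open. Then $(\mathbb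 R^N,\mathcal H')$ is a strong Green biharmonic space, $(1,1)\in\mathcal H'^*(\mathbb R^N)$, and there is no $(u,v)\in\mathcal H'(\mathbb R^N)$ with $u>0$ and $v>0$ on $\mathbb R^N$. Consequently the following assertion (claimed by Smyrnelis) is false: on every strong Green biharmonic space $(\Omega,\mathcal H)$ with $(1,1)\in\mathcal H^*(\Omega)$ there is a biharmonic pair $(h,k)$ with $h>0$ and $k>0$ on $\Omega$. -/

import Mathlib

open Set Filter Topology MeasureTheory

open scoped Laplacian

noncomputable section

/-! Functions on an open set `U` are represented by total functions of which only the values on `U`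
matter: every sheaf below is required to be insensitive to changes outside `U`. -/

/-- The integral over `s` of an extended real function, as positive part minus negative part.
It is used only for lower semicontinuous functions with values in `(-∞, +∞]` on a compact set
`s` and for finite measures; the negative part is then finite, and the value is the upper
integral. -/
def extIntegral {X : Type*} [MeasurableSpace X] (μ : Measure X) (s : Set X) (u : X → EReal) :
    EReal :=
  ((∫⁻ y in s, (u y).toENNReal ∂μ : ENNReal) : EReal) -
    ((∫⁻ y in s, (-u y).toENNReal ∂μ : ENNReal) : EReal)

/-! ### Harmonic spaces -/

/-- `u` solves the Dirichlet problem in `ω` with boundary data `f`, for the sheaf `K`. -/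
def IsDirichletSolution {X : Type*} [TopologicalSpace X] (K : Set X → (X → ℝ) → Prop)
    (ω : Set X) (f u : X → ℝ) : Prop :=
  K ω u ∧ ∀ y ∈ frontier ω, Tendsto u (𝓝[ω] y) (𝓝 (f y))

/-- Relatively compact open sets in which the Dirichlet problem is uniquely solvable, with
nonnegative solutions for nonnegative data. -/
structure IsHarmonicRegular {X : Type*} [TopologicalSpace X] (K : Set X → (X → ℝ) → Prop)
    (ω : Set X) : Prop where
  isOpen : IsOpen ω
  isCompact_closure : IsCompact (closure ω)
  exists_solution : ∀ f : X → ℝ, ContinuousOn f (frontier ω) → ∃ u, IsDirichletSolution K ω f u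
  unique : ∀ f : X → ℝ, ContinuousOn f (frontier ω) → ∀ u u' : X → ℝ,
    IsDirichletSolution K ω f u → IsDirichletSolution K ω f u' → EqOn u u' ω
  nonneg : ∀ f : X → ℝ, ContinuousOn f (frontier ω) → (∀ y ∈ frontier ω, 0 ≤ f y) →
    ∀ u : X → ℝ, IsDirichletSolution K ω f u → ∀ x ∈ ω, 0 ≤ u x

/-- `μ` is the harmonic measure of the regular set `ω` at the point `x`. -/
structure IsHarmonicMeasure {X : Type*} [TopologicalSpace X] [MeasurableSpace X]
    (K : Set X → (X → ℝ) → Prop) (ω : Set X) (x : X) (μ : Measure X) : Prop where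
  finite : IsFiniteMeasure μ
  concentrated : μ (frontier ω)ᶜ = 0
  repr : ∀ f u : X → ℝ, ContinuousOn f (frontier ω) → IsDirichletSolution K ω f u →
    u x = ∫ y in frontier ω, f y ∂μ

/-- Hyperharmonic functions on `U` with respect to the sheaf `K`. -/
structure IsHyperharmonic {X : Type*} [TopologicalSpace X] [MeasurableSpace X]
    (K : Set X → (X → ℝ) → Prop) (U : Set X) (u : X → EReal) : Prop where
  lsc : LowerSemicontinuousOn u U
  ne_bot : ∀ x ∈ U, u x ≠ ⊥
  le : ∀ ω : Set X, IsHarmonicRegular K ω → closure ω ⊆ U → ∀ x ∈ ω, ∀ μ : Measure X,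
    IsHarmonicMeasure K ω x μ → extIntegral μ (frontier ω) u ≤ u x

/-- `K` is a sheaf of real vector spaces of continuous real functions. -/
structure IsHarmonicSheaf {X : Type*} [TopologicalSpace X]
    (K : Set X → (X → ℝ) → Prop) : Prop where
  congr : ∀ U, IsOpen U → ∀ u u' : X → ℝ, EqOn u u' U → K U u → K U u'
  continuousOn : ∀ U, IsOpen U → ∀ u, K U u → ContinuousOn u U
  zero : ∀ U, IsOpen U → K U 0
  add : ∀ U, IsOpen U → ∀ u u', K U u → K U u' → K U (u + u')
  smul : ∀ U, IsOpen U → ∀ (c : ℝ) (u), K U u → K U (c • u)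
  restrict : ∀ U V, IsOpen U → IsOpen V → U ⊆ V → ∀ u, K V u → K U u
  glue : ∀ S : Set (Set X), (∀ U ∈ S, IsOpen U) → ∀ u, (∀ U ∈ S, K U u) → K (⋃₀ S) u

/-- Bauer harmonic spaces: a sheaf of vector spaces of continuous functions with the positivity
axiom, a base of regular sets, the convergence property of Bauer, and local linear separation of
points by nonnegative hyperharmonic functions. -/
structure IsBauerHarmonicSpace {X : Type*} [TopologicalSpace X] [MeasurableSpace X]
    (K : Set X → (X → ℝ) → Prop) : Prop where
  sheaf : IsHarmonicSheaf K
  positivity : ∀ x : X, ∃ U, IsOpen U ∧ x ∈ U ∧ ∃ h, K U h ∧ h x ≠ 0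
  base_regular : ∀ (x : X) (U : Set X), IsOpen U → x ∈ U →
    ∃ ω, IsHarmonicRegular K ω ∧ x ∈ ω ∧ ω ⊆ U
  convergence : ∀ U, IsOpen U → ∀ (h : ℕ → X → ℝ) (g : X → ℝ), (∀ n, K U (h n)) →
    (∀ n, ∀ x ∈ U, h n x ≤ h (n + 1) x) →
    (∀ x ∈ U, ∃ M : ℝ, ∀ᶠ y in 𝓝 x, ∀ n, h n y ≤ M) →
    (∀ x ∈ U, Tendsto (fun n => h n x) atTop (𝓝 (g x))) → K U g
  separation : ∀ x : X, ∃ U, IsOpen U ∧ x ∈ U ∧ ∀ y ∈ U, ∀ z ∈ U, y ≠ z → ∀ c : ℝ, 0 ≤ c →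
    ∃ u : X → EReal, IsHyperharmonic K U u ∧ (∀ a ∈ U, 0 ≤ u a) ∧ u y ≠ (c : EReal) * u z

/-- Brelot harmonic spaces: a base of regular domains, and an increasing sequence of harmonic
functions on a domain tends either to `+∞` everywhere or to a harmonic function. -/
structure IsBrelotHarmonicSpace {X : Type*} [TopologicalSpace X]
    (K : Set X → (X → ℝ) → Prop) : Prop where
  connected : ConnectedSpace X
  locallyConnected : LocallyConnectedSpace X
  noncompact : NoncompactSpace X
  sheaf : IsHarmonicSheaf K
  base_regular : ∀ (x : X) (U : Set X), IsOpen U → x ∈ U →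
    ∃ ω, IsHarmonicRegular K ω ∧ IsConnected ω ∧ x ∈ ω ∧ ω ⊆ U
  convergence : ∀ U, IsOpen U → IsConnected U → ∀ h : ℕ → X → ℝ, (∀ n, K U (h n)) →
    (∀ n, ∀ x ∈ U, h n x ≤ h (n + 1) x) →
    (∀ x ∈ U, Tendsto (fun n => h n x) atTop atTop) ∨
      ∃ g, K U g ∧ ∀ x ∈ U, Tendsto (fun n => h n x) atTop (𝓝 (g x))

/-- Potentials of a harmonic space: nonnegative superharmonic functions on the whole space whose
only nonnegative harmonic minorant is `0`. -/
structure IsHarmonicPotential {X : Type*} [TopologicalSpace X] [MeasurableSpace X]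
    (K : Set X → (X → ℝ) → Prop) (p : X → EReal) : Prop where
  hyperharmonic : IsHyperharmonic K univ p
  dense_finite : Dense {x | p x ≠ ⊤}
  nonneg : ∀ x, 0 ≤ p x
  minorant : ∀ h : X → ℝ, K univ h → (∀ x, 0 ≤ h x) → (∀ x, (h x : EReal) ≤ p x) → ∀ x, h x = 0

/-- The harmonic support: the complement of the greatest open set on which `p` is harmonic. -/
def harmonicSupport {X : Type*} [TopologicalSpace X] (K : Set X → (X → ℝ) → Prop)
    (p : X → EReal) : Set X :=
  {x | ¬ ∃ U, IsOpen U ∧ x ∈ U ∧ ∃ h : X → ℝ, K U h ∧ ∀ y ∈ U, p y = (h y : EReal)}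

/-- Green harmonic spaces: Brelot spaces in which two potentials with the same one-point harmonic
support are proportional. -/
structure IsGreenHarmonicSpace {X : Type*} [TopologicalSpace X] [MeasurableSpace X]
    (K : Set X → (X → ℝ) → Prop) : Prop where
  brelot : IsBrelotHarmonicSpace K
  proportional : ∀ (y : X) (p p' : X → EReal), IsHarmonicPotential K p →
    IsHarmonicPotential K p' → harmonicSupport K p = {y} → harmonicSupport K p' = {y} →
    ∃ c : ℝ, 0 < c ∧ ∀ x, p x = (c : EReal) * p' x

/-! ### Biharmonic spaces -/

/-- `(u, v)` solves the Riquier problem in `ω` with boundary data `(f, g)`. -/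
def IsRiquierSolution {X : Type*} [TopologicalSpace X] (H : Set X → (X → ℝ) → (X → ℝ) → Prop)
    (ω : Set X) (f g u v : X → ℝ) : Prop :=
  H ω u v ∧ ∀ y ∈ frontier ω, Tendsto u (𝓝[ω] y) (𝓝 (f y)) ∧ Tendsto v (𝓝[ω] y) (𝓝 (g y))

/-- Relatively compact open sets in which the Riquier problem is uniquely solvable, with
nonnegative solutions for nonnegative data. -/
structure IsBiharmonicRegular {X : Type*} [TopologicalSpace X]
    (H : Set X → (X → ℝ) → (X → ℝ) → Prop) (ω : Set X) : Prop where
  isOpen : IsOpen ω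
  isCompact_closure : IsCompact (closure ω)
  exists_solution : ∀ f g : X → ℝ, ContinuousOn f (frontier ω) → ContinuousOn g (frontier ω) →
    ∃ u v, IsRiquierSolution H ω f g u v
  unique : ∀ f g : X → ℝ, ContinuousOn f (frontier ω) → ContinuousOn g (frontier ω) →
    ∀ u v u' v' : X → ℝ, IsRiquierSolution H ω f g u v → IsRiquierSolution H ω f g u' v' →
    EqOn u u' ω ∧ EqOn v v' ω
  nonneg : ∀ f g : X → ℝ, ContinuousOn f (frontier ω) → ContinuousOn g (frontier ω) →
    (∀ y ∈ frontier ω, 0 ≤ f y ∧ 0 ≤ g y) →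
    ∀ u v : X → ℝ, IsRiquierSolution H ω f g u v → ∀ x ∈ ω, 0 ≤ u x ∧ 0 ≤ v x

/-- `(μ, ν, τ)` is the triple of biharmonic measures of the regular set `ω` at `x`. -/
structure IsBiharmonicMeasures {X : Type*} [TopologicalSpace X] [MeasurableSpace X]
    (H : Set X → (X → ℝ) → (X → ℝ) → Prop) (ω : Set X) (x : X) (μ ν τ : Measure X) : Prop where
  finite : IsFiniteMeasure μ ∧ IsFiniteMeasure ν ∧ IsFiniteMeasure τ
  concentrated : μ (frontier ω)ᶜ = 0 ∧ ν (frontier ω)ᶜ = 0 ∧ τ (frontier ω)ᶜ = 0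
  repr : ∀ f g u v : X → ℝ, ContinuousOn f (frontier ω) → ContinuousOn g (frontier ω) →
    IsRiquierSolution H ω f g u v →
    u x = (∫ y in frontier ω, f y ∂μ) + (∫ y in frontier ω, g y ∂ν) ∧
      v x = ∫ y in frontier ω, g y ∂τ

/-- Hyperharmonic pairs on `U`. -/
structure IsHyperharmonicPair {X : Type*} [TopologicalSpace X] [MeasurableSpace X]
    (H : Set X → (X → ℝ) → (X → ℝ) → Prop) (U : Set X) (u v : X → EReal) : Prop where
  lsc : LowerSemicontinuousOn u U ∧ LowerSemicontinuousOn v U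
  ne_bot : ∀ x ∈ U, u x ≠ ⊥ ∧ v x ≠ ⊥
  le : ∀ ω : Set X, IsBiharmonicRegular H ω → closure ω ⊆ U → ∀ x ∈ ω, ∀ μ ν τ : Measure X,
    IsBiharmonicMeasures H ω x μ ν τ →
    extIntegral μ (frontier ω) u + extIntegral ν (frontier ω) v ≤ u x ∧
      extIntegral τ (frontier ω) v ≤ v x

/-- The first associated harmonic sheaf: `h` and `-h` are such that `(h, 0)` and `(-h, 0)` are
hyperharmonic pairs. -/
def firstSheaf {X : Type*} [TopologicalSpace X] [MeasurableSpace X]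
    (H : Set X → (X → ℝ) → (X → ℝ) → Prop) : Set X → (X → ℝ) → Prop :=
  fun U h => IsHyperharmonicPair H U (fun x => ((h x : ℝ) : EReal)) (fun _ => 0) ∧
    IsHyperharmonicPair H U (fun x => ((-h x : ℝ) : EReal)) (fun _ => 0)

/-- The second associated harmonic sheaf: `k` and `-k` are such that `(+∞, k)` and `(+∞, -k)` are
hyperharmonic pairs. -/
def secondSheaf {X : Type*} [TopologicalSpace X] [MeasurableSpace X]
    (H : Set X → (X → ℝ) → (X → ℝ) → Prop) : Set X → (X → ℝ) → Prop :=
  fun U k => IsHyperharmonicPair H U (fun _ => ⊤) (fun x => ((k x : ℝ) : EReal)) ∧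
    IsHyperharmonicPair H U (fun _ => ⊤) (fun x => ((-k x : ℝ) : EReal))

/-- Biharmonic spaces. -/
structure IsBiharmonicSpace {X : Type*} [TopologicalSpace X] [MeasurableSpace X]
    (H : Set X → (X → ℝ) → (X → ℝ) → Prop) : Prop where
  t2 : T2Space X
  locallyCompact : LocallyCompactSpace X
  secondCountable : SecondCountableTopology X
  congr : ∀ U, IsOpen U → ∀ u v u' v' : X → ℝ, EqOn u u' U → EqOn v v' U → H U u v → H U u' v'
  continuousOn : ∀ U, IsOpen U → ∀ u v, H U u v → ContinuousOn u U ∧ ContinuousOn v U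
  zero : ∀ U, IsOpen U → H U 0 0
  add : ∀ U, IsOpen U → ∀ u v u' v', H U u v → H U u' v' → H U (u + u') (v + v')
  smul : ∀ U, IsOpen U → ∀ (c : ℝ) (u v), H U u v → H U (c • u) (c • v)
  compatible : ∀ U, IsOpen U → ∀ u v, H U u v → ∀ W, IsOpen W → W ⊆ U →
    (∀ x ∈ W, u x = 0) → ∀ x ∈ W, v x = 0
  restrict : ∀ U V, IsOpen U → IsOpen V → U ⊆ V → ∀ u v, H V u v → H U u v
  glue : ∀ S : Set (Set X), (∀ U ∈ S, IsOpen U) → ∀ u v, (∀ U ∈ S, H U u v) → H (⋃₀ S) u v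
  base_regular : ∀ (x : X) (U : Set X), IsOpen U → x ∈ U →
    ∃ ω, IsBiharmonicRegular H ω ∧ x ∈ ω ∧ ω ⊆ U
  bauer_first : IsBauerHarmonicSpace (firstSheaf H)
  bauer_second : IsBauerHarmonicSpace (secondSheaf H)

/-- Green biharmonic spaces: both associated harmonic spaces are Green harmonic spaces. -/
structure IsGreenBiharmonicSpace {X : Type*} [TopologicalSpace X] [MeasurableSpace X]
    (H : Set X → (X → ℝ) → (X → ℝ) → Prop) : Prop where
  biharmonic : IsBiharmonicSpace H
  green_first : IsGreenHarmonicSpace (firstSheaf H)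
  green_second : IsGreenHarmonicSpace (secondSheaf H)

/-- Potentials of a biharmonic space: nonnegative superharmonic pairs on the whole space whose only
nonnegative biharmonic minorant is `(0, 0)`. -/
structure IsPotentialPair {X : Type*} [TopologicalSpace X] [MeasurableSpace X]
    (H : Set X → (X → ℝ) → (X → ℝ) → Prop) (p q : X → EReal) : Prop where
  hyperharmonic : IsHyperharmonicPair H univ p q
  dense_finite : Dense {x | p x ≠ ⊤}
  nonneg : ∀ x, 0 ≤ p x ∧ 0 ≤ q x
  minorant : ∀ h k : X → ℝ, H univ h k → (∀ x, 0 ≤ h x ∧ 0 ≤ k x) →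
    (∀ x, (h x : EReal) ≤ p x ∧ (k x : EReal) ≤ q x) → ∀ x, h x = 0 ∧ k x = 0

/-- There is a strictly positive potential. -/
def IsStrong {X : Type*} [TopologicalSpace X] [MeasurableSpace X]
    (H : Set X → (X → ℝ) → (X → ℝ) → Prop) : Prop :=
  ∃ p q : X → EReal, IsPotentialPair H p q ∧ ∀ x, 0 < p x ∧ 0 < q x

/-- There is a strictly positive biharmonic pair on the whole space. -/
def HasPositivePair {X : Type*} (H : Set X → (X → ℝ) → (X → ℝ) → Prop) : Prop :=
  ∃ h k : X → ℝ, H univ h k ∧ ∀ x, 0 < h x ∧ 0 < k x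

/-- A finite continuous strictly positive potential `(p, q)`. -/
def IsPositiveContinuousPotential {X : Type*} [TopologicalSpace X] [MeasurableSpace X]
    (H : Set X → (X → ℝ) → (X → ℝ) → Prop) (p q : X → ℝ) : Prop :=
  Continuous p ∧ Continuous q ∧ (∀ x, 0 < p x ∧ 0 < q x) ∧
    IsPotentialPair H (fun x => (p x : EReal)) (fun x => (q x : EReal))

/-- The sheaf renormalized by `(p, q)`: continuous pairs `(h, k)` such that `(p h, q k)` belongs to
the original sheaf. -/
def renormalized {X : Type*} [TopologicalSpace X] (H : Set X → (X → ℝ) → (X → ℝ) → Prop)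
    (p q : X → ℝ) : Set X → (X → ℝ) → (X → ℝ) → Prop :=
  fun U h k => ContinuousOn h U ∧ ContinuousOn k U ∧ H U (fun x => p x * h x) (fun x => q x * k x)

/-- The classical biharmonic sheaf of `ℝ^N`: `C²` pairs with `Δ h = -k` and `Δ k = 0`. -/
def classicalBiharmonic (N : ℕ) : Set (EuclideanSpace ℝ (Fin N)) →
    (EuclideanSpace ℝ (Fin N) → ℝ) → (EuclideanSpace ℝ (Fin N) → ℝ) → Prop :=
  fun U h k => ContDiffOn ℝ 2 h U ∧ ContDiffOn ℝ 2 k U ∧ ∀ x ∈ U, (Δ h) x = -k x ∧ (Δ k) x = 0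

/-- The assertion that every strong Green biharmonic space in which `(1, 1)` is hyperharmonic
carries a strictly positive biharmonic pair. -/
def PositivePairClaim : Prop :=
  ∀ (X : Type) [TopologicalSpace X] [MeasurableSpace X] [BorelSpace X]
    (H : Set X → (X → ℝ) → (X → ℝ) → Prop), IsGreenBiharmonicSpace H → IsStrong H →
    IsHyperharmonicPair H univ (fun _ => 1) (fun _ => 1) → HasPositivePair H

end

/-! The counterexample combines a Liouville theorem with a change of normalization. On all of `ℝ^N`
a pair with `Δ h = -k`, `Δ k = 0` and `h, k ≥ 0` is trivial: `k` is a nonnegative entire harmonic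
function, hence constant; then `h + k ‖x‖² / (2N)` is also nonnegative and harmonic, hence constant,
and `h ≥ 0` forces `k = 0` (`biharmonicSheaf.eq_const_of_nonneg`). So there is no positive pair, and
a nonnegative biharmonic minorant is always of the form `(constant, 0)`.

A potential nevertheless exists. With `p = (1 + ‖x‖²)^(-1/2)` and `q = (1 + ‖x‖²)^(-3/2)` one has `Δ
p ≤ -q` and `Δ q ≤ 0` when `N ≥ 5`, and `p` takes arbitrarily small values, which kills the constant
minorants (`exists_isPositiveContinuousPotential`).

Dividing first components by `p` and second components by `q` turns the potential `(p, q)` into `(1,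
1)`. Regular sets stay regular, the biharmonic measures only acquire densities, and hyperharmonic
pairs correspond (`isHyperharmonicPair_renormalized_iff`). The new space is therefore strong with
`(1, 1)` hyperharmonic, while a positive pair in it would give a positive pair in the old one.

Most of the work is to check the axioms. The two associated sheaves of the renormalized space
consist of the functions whose product with `p`, respectively `q`, is harmonic, so the Bauer, Brelot
and Green properties are proved once for `IsWeightedHarmonic`. The analysis behind them is the
Poisson integral on balls, Harnack's inequality, an explicit solution of the Riquier problem on
balls, and Bôcher's theorem on the punctured space, which identifies the potentials with one-point
support. Since hyperharmonicity is tested on measures, these measures must also be shown to exist,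
by Riesz representation (`exists_measure_of_positive`). -/

noncomputable section

set_option linter.unusedSectionVars false

/-! ### Laplacian calculus -/

section Calculus

open InnerProductSpace Module

variable {E : Type*} [NormedAddCommGroup E] [InnerProductSpace ℝ E] [FiniteDimensional ℝ E]

/-- The Laplacian as the sum of the pure second derivatives along an orthonormal basis. -/
theorem laplacian_eq_sum_fderiv (f : E → ℝ) (x : E) :
    (Δ f) x = ∑ i, fderiv ℝ (fderiv ℝ f) x (stdOrthonormalBasis ℝ E i)
      (stdOrthonormalBasis ℝ E i) := by
  rw [laplacian_eq_iteratedFDeriv_stdOrthonormalBasis]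
  simp [iteratedFDeriv_two_apply]

/-- `V` is the gradient of `f` near `x`, and `A` is the Hessian of `f` at `x`. -/
structure HasHessianAt (f : E → ℝ) (V : E → E) (A : E →L[ℝ] E) (x : E) : Prop where
  gradient : ∀ᶠ y in 𝓝 x, HasFDerivAt f (innerSL ℝ (V y)) y
  hessian : HasFDerivAt V A x

/-- The trace of an endomorphism in the standard orthonormal basis. -/
def basisTrace (A : E →L[ℝ] E) : ℝ :=
  ∑ i, inner ℝ (A (stdOrthonormalBasis ℝ E i)) (stdOrthonormalBasis ℝ E i)

theorem basisTrace_add (A B : E →L[ℝ] E) : basisTrace (A + B) = basisTrace A + basisTrace B := by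
  simp [basisTrace, inner_add_left, Finset.sum_add_distrib]

theorem basisTrace_smul (c : ℝ) (A : E →L[ℝ] E) : basisTrace (c • A) = c * basisTrace A := by
  simp [basisTrace, inner_smul_left, Finset.mul_sum]

theorem basisTrace_id : basisTrace (ContinuousLinearMap.id ℝ E) = finrank ℝ E := by
  simp [basisTrace]

theorem basisTrace_smulRight (v w : E) :
    basisTrace ((innerSL ℝ v).smulRight w) = inner ℝ v w := by
  rw [← (stdOrthonormalBasis ℝ E).sum_inner_mul_inner v w]
  simp [basisTrace, inner_smul_left, real_inner_comm]

theorem HasHessianAt.laplacian_eq {f : E → ℝ} {V : E → E} {A : E →L[ℝ] E} {x : E}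
    (h : HasHessianAt f V A x) : (Δ f) x = basisTrace A := by
  have h1 : fderiv ℝ f =ᶠ[𝓝 x] fun y => innerSL ℝ (V y) :=
    h.gradient.mono fun y hy => hy.fderiv
  have h2 : HasFDerivAt (fun y => innerSL ℝ (V y)) ((innerSL ℝ).comp A) x :=
    (innerSL ℝ (E := E)).hasFDerivAt.comp x h.hessian
  rw [laplacian_eq_sum_fderiv, h1.fderiv_eq, h2.fderiv]
  rfl

theorem HasHessianAt.mul {f g : E → ℝ} {V W : E → E} {A B : E →L[ℝ] E} {x : E}
    (hf : HasHessianAt f V A x) (hg : HasHessianAt g W B x) :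
    HasHessianAt (fun y => f y * g y) (fun y => f y • W y + g y • V y)
      (f x • B + (innerSL ℝ (V x)).smulRight (W x) +
        (g x • A + (innerSL ℝ (W x)).smulRight (V x))) x where
  gradient := by
    filter_upwards [hf.gradient, hg.gradient] with y h1 h2
    exact (h1.fun_mul h2).congr_fderiv (by simp)
  hessian := (hf.gradient.self_of_nhds.smul hg.hessian).add
    (hg.gradient.self_of_nhds.smul hf.hessian)

theorem HasHessianAt.laplacian_mul {f g : E → ℝ} {V W : E → E} {A B : E →L[ℝ] E} {x : E}
    (hf : HasHessianAt f V A x) (hg : HasHessianAt g W B x) :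
    (Δ (fun y => f y * g y)) x = f x * (Δ g) x + 2 * inner ℝ (V x) (W x) + g x * (Δ f) x := by
  rw [(hf.mul hg).laplacian_eq, hf.laplacian_eq, hg.laplacian_eq]
  simp only [basisTrace_add, basisTrace_smul, basisTrace_smulRight]
  rw [real_inner_comm (V x) (W x)]
  ring

/-- The profile is a function of the squared distance, which is smooth at the centre too, so `x = a`
needs no separate treatment. -/
theorem hasHessianAt_radial {φ φ' : ℝ → ℝ} {c : ℝ} {a x : E}
    (h1 : ∀ᶠ t in 𝓝 (‖x - a‖ ^ 2), HasDerivAt φ (φ' t) t) (h2 : HasDerivAt φ' c (‖x - a‖ ^ 2)) :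
    HasHessianAt (fun y => φ (‖y - a‖ ^ 2)) (fun y => (2 * φ' (‖y - a‖ ^ 2)) • (y - a))
      ((2 * φ' (‖x - a‖ ^ 2)) • ContinuousLinearMap.id ℝ E +
        (innerSL ℝ ((4 * c) • (x - a))).smulRight (x - a)) x := by
  have hn : ∀ y, HasFDerivAt (fun y => ‖y - a‖ ^ 2) (innerSL ℝ ((2 : ℝ) • (y - a))) y := by
    intro y
    refine ((hasFDerivAt_id (𝕜 := ℝ) y).sub_const a).norm_sq.congr_fderiv ?_
    ext v
    simp
  constructor
  · have : Tendsto (fun y => ‖y - a‖ ^ 2) (𝓝 x) (𝓝 (‖x - a‖ ^ 2)) :=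
      (hn x).continuousAt.tendsto
    filter_upwards [this.eventually h1] with y hy
    refine (hy.comp_hasFDerivAt y (hn y)).congr_fderiv ?_
    ext v
    simp
    ring
  · refine (((h2.comp_hasFDerivAt x (hn x)).const_mul 2).smul
      ((hasFDerivAt_id (𝕜 := ℝ) x).sub_const a)).congr_fderiv ?_
    ext v
    simp
    congr 1
    ring

theorem laplacian_radial {φ φ' : ℝ → ℝ} {c : ℝ} {a x : E}
    (h1 : ∀ᶠ t in 𝓝 (‖x - a‖ ^ 2), HasDerivAt φ (φ' t) t) (h2 : HasDerivAt φ' c (‖x - a‖ ^ 2)) :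
    (Δ (fun y => φ (‖y - a‖ ^ 2))) x =
      2 * finrank ℝ E * φ' (‖x - a‖ ^ 2) + 4 * c * ‖x - a‖ ^ 2 := by
  rw [(hasHessianAt_radial h1 h2).laplacian_eq]
  simp only [basisTrace_add, basisTrace_smul, basisTrace_smulRight, basisTrace_id,
    inner_smul_left, real_inner_self_eq_norm_sq]
  simp
  ring

theorem laplacian_comp_affine {f : E → ℝ} {a x : E} {s : ℝ} (hf : ContDiffAt ℝ 2 f (a + s • x)) :
    (Δ (fun y => f (a + s • y))) x = s ^ 2 * (Δ f) (a + s • x) := by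
  have hL : ∀ y, HasFDerivAt (fun y : E => a + s • y) (s • ContinuousLinearMap.id ℝ E) y :=
    fun y => ((hasFDerivAt_id (𝕜 := ℝ) y).const_smul s).const_add a
  have h1 : fderiv ℝ (fun y => f (a + s • y)) =ᶠ[𝓝 x] fun y => s • fderiv ℝ f (a + s • y) := by
    have h0 : ∀ᶠ z in 𝓝 (a + s • x), ContDiffAt ℝ 2 f z := hf.eventually (by simp)
    filter_upwards [(hL x).continuousAt.tendsto.eventually h0] with y hy
    have := (hy.differentiableAt (by norm_num)).hasFDerivAt.comp y (hL y)
    refine (HasFDerivAt.fderiv this).trans ?_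
    ext v
    simp
  have h2 : DifferentiableAt ℝ (fderiv ℝ f) (a + s • x) :=
    (hf.fderiv_right (m := 1) (by norm_num)).differentiableAt (by norm_num)
  have h3 := (h2.hasFDerivAt.comp x (hL x)).const_smul s
  rw [laplacian_eq_sum_fderiv, h1.fderiv_eq, laplacian_eq_sum_fderiv]
  rw [show (fun y => s • fderiv ℝ f (a + s • y)) = s • (fderiv ℝ f ∘ fun y => a + s • y) from rfl,
    h3.fderiv, Finset.mul_sum]
  refine Finset.sum_congr rfl fun i _ => ?_
  simp
  ring

theorem InnerProductSpace.HarmonicAt.comp_affine {f : E → ℝ} {a x : E} {s : ℝ} (hf : HarmonicAt f (a + s • x)) :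
    HarmonicAt (fun y => f (a + s • y)) x := by
  have hc : ContDiff ℝ 2 (fun y : E => a + s • y) := by fun_prop
  refine ⟨ContDiffAt.comp x hf.1 hc.contDiffAt, ?_⟩
  filter_upwards [hc.continuous.continuousAt.tendsto.eventually hf.eventually] with y hy
  rw [laplacian_comp_affine hy.1, hy.2.self_of_nhds]
  simp

theorem harmonicOnNhd_iff {f : E → ℝ} {U : Set E} (hU : IsOpen U) :
    HarmonicOnNhd f U ↔ ContDiffOn ℝ 2 f U ∧ ∀ x ∈ U, (Δ f) x = 0 := by
  refine ⟨fun h => ⟨h.contDiffOn, fun x hx => (h x hx).2.self_of_nhds⟩, fun h x hx => ⟨?_, ?_⟩⟩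
  · exact h.1.contDiffAt (hU.mem_nhds hx)
  · filter_upwards [hU.mem_nhds hx] with y hy using h.2 y hy

theorem InnerProductSpace.HarmonicOnNhd.congr {f g : E → ℝ} {U : Set E} (hU : IsOpen U) (hf : HarmonicOnNhd f U)
    (h : EqOn f g U) : HarmonicOnNhd g U := fun x hx =>
  (harmonicAt_congr_nhds (h.eventuallyEq_of_mem (hU.mem_nhds hx))).1 (hf x hx)

/-! ### The minimum principle -/

/-- Along the line through `x` in direction `v`, a negative second derivative would make the minimum
a local maximum as well. The restriction would then be locally constant and its second derivative
zero. -/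
theorem fderiv_fderiv_nonneg_of_isLocalMin {u : E → ℝ} {x : E} (hu : ContDiffAt ℝ 2 u x)
    (hmin : IsLocalMin u x) (v : E) : 0 ≤ fderiv ℝ (fderiv ℝ u) x v v := by
  by_contra! hneg
  have hL : ∀ t : ℝ, HasDerivAt (fun t : ℝ => x + t • v) v t := fun t => by
    simpa using ((hasDerivAt_id t).smul_const v).const_add x
  have hx0 : x + (0 : ℝ) • v = x := by simp
  have hlim : Tendsto (fun t : ℝ => x + t • v) (𝓝 0) (𝓝 x) := by
    simpa only [hx0] using (hL 0).continuousAt.tendsto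
  have h1 : ∀ᶠ t : ℝ in 𝓝 0,
      HasDerivAt (fun t : ℝ => u (x + t • v)) (fderiv ℝ u (x + t • v) v) t := by
    filter_upwards [hlim.eventually (hu.eventually (by simp))] with t ht
    exact (ht.differentiableAt (by norm_num)).hasFDerivAt.comp_hasDerivAt t (hL t)
  have h2 : DifferentiableAt ℝ (fderiv ℝ u) x :=
    (hu.fderiv_right (m := 1) (by norm_num)).differentiableAt (by norm_num)
  have h3 : HasDerivAt (fun t : ℝ => fderiv ℝ u (x + t • v) v) (fderiv ℝ (fderiv ℝ u) x v v) 0 := by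
    have h4 : HasDerivAt (fun t : ℝ => fderiv ℝ u (x + t • v)) (fderiv ℝ (fderiv ℝ u) x v) 0 :=
      HasFDerivAt.comp_hasDerivAt_of_eq (0 : ℝ) h2.hasFDerivAt (hL 0) hx0.symm
    exact ((ContinuousLinearMap.apply ℝ ℝ v).hasFDerivAt.comp_hasDerivAt (0 : ℝ) h4)
  have hd : deriv (fun t : ℝ => u (x + t • v)) =ᶠ[𝓝 0] fun t => fderiv ℝ u (x + t • v) v :=
    h1.mono fun t ht => ht.deriv
  have hdd : deriv (deriv fun t : ℝ => u (x + t • v)) 0 = fderiv ℝ (fderiv ℝ u) x v v := by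
    rw [hd.deriv_eq, h3.deriv]
  have hmin' : IsLocalMin (fun t : ℝ => u (x + t • v)) 0 := by
    have := hlim.eventually hmin
    simpa only [IsLocalMin, IsMinFilter, hx0] using this
  have hmax := isLocalMax_of_deriv_deriv_neg (hdd ▸ hneg) hmin'.deriv_eq_zero
    h1.self_of_nhds.continuousAt
  have hc : (fun t : ℝ => u (x + t • v)) =ᶠ[𝓝 0] fun _ => u (x + (0 : ℝ) • v) := by
    filter_upwards [hmin', hmax] with t h4 h5 using le_antisymm h5 h4
  rw [hc.deriv.deriv_eq] at hdd
  simp at hdd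
  linarith

theorem laplacian_nonneg_of_isLocalMin {u : E → ℝ} {x : E} (hu : ContDiffAt ℝ 2 u x)
    (hmin : IsLocalMin u x) : 0 ≤ (Δ u) x := by
  rw [laplacian_eq_sum_fderiv]
  exact Finset.sum_nonneg fun i _ => fderiv_fderiv_nonneg_of_isLocalMin hu hmin _

theorem laplacian_norm_sub_sq (a x : E) : (Δ (fun y : E => ‖y - a‖ ^ 2)) x = 2 * (finrank ℝ E : ℝ) := by
  have := laplacian_radial (E := E) (φ := fun t => t) (φ' := fun _ => 1) (c := 0) (a := a) (x := x)
    (Eventually.of_forall fun t => hasDerivAt_id t) (hasDerivAt_const _ _)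
  simpa using this

variable [Nontrivial E]

/-- The weak minimum principle. -/
theorem nonneg_of_laplacian_nonpos {ω : Set E} (ho : IsOpen ω) (hb : Bornology.IsBounded ω)
    {u : E → ℝ} (hu : ContDiffOn ℝ 2 u ω) (hΔ : ∀ x ∈ ω, (Δ u) x ≤ 0)
    (hf : ∀ y ∈ frontier ω, ∀ ε > 0, ∀ᶠ x in 𝓝[ω] y, -ε < u x) : ∀ x ∈ ω, 0 ≤ u x := by
  intro x0 hx0
  by_contra! hneg
  obtain ⟨R, hR⟩ := hb.subset_ball (0 : E)
  have hR0 : 0 < R := by simpa using (norm_nonneg x0).trans_lt (by simpa using hR hx0)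
  have hnorm : ∀ x ∈ ω, ‖x‖ ^ 2 ≤ R ^ 2 := fun x hx => by
    have : ‖x‖ < R := by simpa using hR hx
    gcongr
  -- Subtracting `δ ‖x‖²` makes the Laplacian strictly negative, while `δ` is small enough to change
  -- `u` on `ω` by at most a quarter of `|u x0|`.
  obtain ⟨δ, hδ, hδR⟩ : ∃ δ > 0, δ * R ^ 2 = -u x0 / 4 :=
    ⟨-u x0 / 4 / R ^ 2, by have : 0 < -u x0 := by linarith
                           positivity, by field_simp⟩
  set v : E → ℝ := fun x => u x - δ * ‖x‖ ^ 2 with hv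
  have hvc : ContDiffOn ℝ 2 v ω := hu.sub (contDiffOn_const.mul (contDiff_norm_sq ℝ).contDiffOn)
  have hv0 : v x0 ≤ u x0 := by simp only [hv]; nlinarith [sq_nonneg ‖x0‖]
  -- The sublevel set stays away from the frontier: there `u > u x0 / 4` eventually, so `v > u x0 /
  -- 2 > v x0`. Hence `v` attains an interior minimum, where its Laplacian cannot be negative.
  have hS : IsCompact {x ∈ ω | v x ≤ v x0} := by
    refine Metric.isCompact_of_isClosed_isBounded ?_ (hb.subset fun x hx => hx.1)
    refine isClosed_of_closure_subset fun y hy => ?_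
    have hyc : y ∈ closure ω := closure_mono (fun x hx => hx.1) hy
    by_cases hyω : y ∈ ω
    · refine ⟨hyω, ?_⟩
      have : ContinuousAt v y := hvc.continuousOn.continuousAt (ho.mem_nhds hyω)
      by_contra! hlt
      have h1 := this.eventually (lt_mem_nhds hlt)
      obtain ⟨z, hz1, hz2⟩ := mem_closure_iff_frequently.1 hy |>.and_eventually h1 |>.exists
      exact absurd hz1.2 (not_le.2 hz2)
    · exfalso
      have hyf : y ∈ frontier ω := ⟨hyc, fun h => hyω (interior_subset h)⟩
      have h1 := hf y hyf (-u x0 / 4) (by linarith)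
      rw [eventually_nhdsWithin_iff] at h1
      obtain ⟨z, hz1, hz2⟩ := mem_closure_iff_frequently.1 hy |>.and_eventually h1 |>.exists
      have h2 := hz2 hz1.1
      have h3 := hz1.2
      have h4 := hnorm z hz1.1
      have h5 : δ * ‖z‖ ^ 2 ≤ δ * R ^ 2 := by gcongr
      have h6 : v z = u z - δ * ‖z‖ ^ 2 := rfl
      linarith
  obtain ⟨x1, hx1, hmin⟩ := hS.exists_isMinOn ⟨x0, hx0, le_rfl⟩
    (hvc.continuousOn.mono fun x hx => hx.1)
  have hloc : IsLocalMin v x1 := by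
    filter_upwards [ho.mem_nhds hx1.1] with x hx
    by_cases h : v x ≤ v x0
    · exact hmin ⟨hx, h⟩
    · exact hx1.2.trans (not_le.1 h).le
  have h1 := laplacian_nonneg_of_isLocalMin (hvc.contDiffAt (ho.mem_nhds hx1.1)) hloc
  have hq : ContDiffAt ℝ 2 (fun x : E => ‖x - 0‖ ^ 2) x1 := by
    simpa using (contDiff_norm_sq ℝ).contDiffAt
  have h2 : (Δ v) x1 = (Δ u) x1 - δ * (2 * finrank ℝ E) := by
    have h3 : v = u - δ • fun x : E => ‖x - 0‖ ^ 2 := by ext x; simp [hv]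
    have hq' : ContDiffAt ℝ 2 (δ • fun x : E => ‖x - 0‖ ^ 2) x1 := hq.const_smul δ
    rw [h3, ContDiffAt.laplacian_sub (hu.contDiffAt (ho.mem_nhds hx1.1)) hq',
      laplacian_smul δ hq, laplacian_norm_sub_sq, smul_eq_mul]
  have h3 : (0 : ℝ) < finrank ℝ E := by exact_mod_cast finrank_pos
  have h4 : 0 < δ * (2 * finrank ℝ E) := by positivity
  linarith [hΔ x1 hx1.1]

/-- Comparison for functions with boundary limits. -/
theorem le_of_laplacian_le {ω : Set E} (ho : IsOpen ω) (hb : Bornology.IsBounded ω)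
    {u v : E → ℝ} (hu : ContDiffOn ℝ 2 u ω) (hv : ContDiffOn ℝ 2 v ω)
    (hΔ : ∀ x ∈ ω, (Δ v) x ≤ (Δ u) x) {f g : E → ℝ}
    (hf : ∀ y ∈ frontier ω, Tendsto u (𝓝[ω] y) (𝓝 (f y)))
    (hg : ∀ y ∈ frontier ω, Tendsto v (𝓝[ω] y) (𝓝 (g y)))
    (hfg : ∀ y ∈ frontier ω, f y ≤ g y) : ∀ x ∈ ω, u x ≤ v x := by
  intro x hx
  have := nonneg_of_laplacian_nonpos ho hb (hv.sub hu) (fun x hx => ?_) (fun y hy ε hε => ?_) x hx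
  · linarith [this]
  · rw [show (fun x => v x - u x) = v - u from rfl, ContDiffAt.laplacian_sub
      (hv.contDiffAt (ho.mem_nhds hx)) (hu.contDiffAt (ho.mem_nhds hx))]
    linarith [hΔ x hx]
  · exact ((hg y hy).sub (hf y hy)).eventually (lt_mem_nhds (by linarith [hfg y hy]))

end Calculus

/-! ### Differentiation under the integral sign -/

section Parametric

variable {E F G : Type*} [NormedAddCommGroup E] [NormedSpace ℝ E] [ProperSpace E]
  [NormedAddCommGroup F] [NormedSpace ℝ F] [MeasurableSpace F] [BorelSpace F]
  [SecondCountableTopology F] [NormedAddCommGroup G] [NormedSpace ℝ G]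
  {W : Set (E × F)} {K : E × F → G} {S : Set F} {U : Set E} {m : Measure F} {f : F → ℝ}

/-- The derivative of `K` with respect to its first variable. -/
def fderivLeft (K : E × F → G) (p : E × F) : E →L[ℝ] G :=
  (fderiv ℝ K p).comp (ContinuousLinearMap.inl ℝ E F)

theorem ContDiffOn.fderivLeft {n k : WithTop ℕ∞} (hW : IsOpen W) (hK : ContDiffOn ℝ n K W)
    (hk : k + 1 ≤ n) : ContDiffOn ℝ k (fderivLeft K) W :=
  (hK.fderiv_of_isOpen hW hk).clm_comp contDiffOn_const

theorem continuousOn_slice (hK : ContinuousOn K W) (hUS : U ×ˢ S ⊆ W) {x : E} (hx : x ∈ U) :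
    ContinuousOn (fun z => K (x, z)) S :=
  hK.comp (by fun_prop) fun _ hz => hUS ⟨hx, hz⟩

/-- Compactness of ball times `S` gives one bound for all parameters near `x₀`; times `‖f‖` it is
the dominating function in the continuity and differentiation arguments below. -/
theorem exists_closedBall_norm_le (hK : ContinuousOn K W) (hS : IsCompact S) (hU : IsOpen U)
    (hUS : U ×ˢ S ⊆ W) {x₀ : E} (hx₀ : x₀ ∈ U) :
    ∃ r > 0, Metric.closedBall x₀ r ⊆ U ∧
      ∃ C, ∀ x ∈ Metric.closedBall x₀ r, ∀ z ∈ S, ‖K (x, z)‖ ≤ C := by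
  obtain ⟨r, hr, hrU⟩ := Metric.nhds_basis_closedBall.mem_iff.1 (hU.mem_nhds hx₀)
  obtain ⟨C, hC⟩ := ((isCompact_closedBall x₀ r).prod hS).exists_bound_of_continuousOn
    (hK.mono ((prod_mono_left hrU).trans hUS))
  exact ⟨r, hr, hrU, C, fun x hx z hz => hC (x, z) ⟨hx, hz⟩⟩

theorem aestronglyMeasurable_smul_slice (hK : ContinuousOn K W) (hS : IsCompact S)
    (hUS : U ×ˢ S ⊆ W) (hf : IntegrableOn f S m) {x : E} (hx : x ∈ U) :
    AEStronglyMeasurable (fun z => f z • K (x, z)) (m.restrict S) :=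
  hf.aestronglyMeasurable.smul
    ((continuousOn_slice hK hUS hx).aestronglyMeasurable hS.measurableSet)

theorem integrableOn_smul_slice (hK : ContinuousOn K W) (hS : IsCompact S)
    (hUS : U ×ˢ S ⊆ W) (hf : IntegrableOn f S m) {x : E} (hx : x ∈ U) :
    IntegrableOn (fun z => f z • K (x, z)) S m := by
  obtain ⟨C, hC⟩ := hS.exists_bound_of_continuousOn (continuousOn_slice hK hUS hx)
  refine (hf.norm.mul_const C).mono' (aestronglyMeasurable_smul_slice hK hS hUS hf hx) ?_
  filter_upwards [ae_restrict_mem hS.measurableSet] with z hz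
  rw [norm_smul]
  exact mul_le_mul_of_nonneg_left (hC z hz) (norm_nonneg _)

theorem continuousOn_setIntegral_smul (hK : ContinuousOn K W) (hS : IsCompact S) (hU : IsOpen U)
    (hUS : U ×ˢ S ⊆ W) (hf : IntegrableOn f S m) :
    ContinuousOn (fun x => ∫ z in S, f z • K (x, z) ∂m) U := by
  intro x₀ hx₀
  obtain ⟨r, hr, hrU, C, hC⟩ := exists_closedBall_norm_le hK hS hU hUS hx₀
  refine (continuousAt_of_dominated (bound := fun z => ‖f z‖ * C) ?_ ?_
    (hf.norm.mul_const C) ?_).continuousWithinAt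
  · filter_upwards [hU.mem_nhds hx₀] with x hx
    exact aestronglyMeasurable_smul_slice hK hS hUS hf hx
  · filter_upwards [Metric.closedBall_mem_nhds x₀ hr] with x hx
    filter_upwards [ae_restrict_mem hS.measurableSet] with z hz
    rw [norm_smul]
    exact mul_le_mul_of_nonneg_left (hC x hx z hz) (norm_nonneg _)
  · filter_upwards [ae_restrict_mem hS.measurableSet] with z hz
    refine ContinuousAt.const_smul (ContinuousOn.continuousAt (s := U) ?_ (hU.mem_nhds hx₀)) _
    exact hK.comp (by fun_prop) fun x hx => hUS ⟨hx, hz⟩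

theorem hasFDerivAt_setIntegral_smul (hW : IsOpen W) (hK : ContDiffOn ℝ 1 K W) (hS : IsCompact S)
    (hU : IsOpen U) (hUS : U ×ˢ S ⊆ W) (hf : IntegrableOn f S m) {x₀ : E} (hx₀ : x₀ ∈ U) :
    HasFDerivAt (fun x => ∫ z in S, f z • K (x, z) ∂m)
      (∫ z in S, f z • fderivLeft K (x₀, z) ∂m) x₀ := by
  have hK' : ContinuousOn (fderivLeft K) W :=
    (hK.fderivLeft (k := 0) hW (by norm_num)).continuousOn
  obtain ⟨r, hr, hrU, C, hC⟩ := exists_closedBall_norm_le hK' hS hU hUS hx₀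
  refine hasFDerivAt_integral_of_dominated_of_fderiv_le (Metric.closedBall_mem_nhds x₀ hr)
    (F' := fun x z => f z • fderivLeft K (x, z)) (bound := fun z => ‖f z‖ * C) ?_ ?_ ?_ ?_
    (hf.norm.mul_const C) ?_
  · filter_upwards [hU.mem_nhds hx₀] with x hx
    exact aestronglyMeasurable_smul_slice hK.continuousOn hS hUS hf hx
  · exact integrableOn_smul_slice hK.continuousOn hS hUS hf hx₀
  · exact aestronglyMeasurable_smul_slice hK' hS hUS hf hx₀
  · filter_upwards [ae_restrict_mem hS.measurableSet] with z hz x hx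
    rw [norm_smul]
    exact mul_le_mul_of_nonneg_left (hC x hx z hz) (norm_nonneg _)
  · filter_upwards [ae_restrict_mem hS.measurableSet] with z hz x hx
    refine HasFDerivAt.const_smul ?_ _
    have h1 : DifferentiableAt ℝ K (x, z) :=
      (hK.contDiffAt (hW.mem_nhds (hUS ⟨hrU hx, hz⟩))).differentiableAt (by norm_num)
    exact h1.hasFDerivAt.comp x (hasFDerivAt_prodMk_left x z)

theorem contDiffOn_one_setIntegral_smul (hW : IsOpen W) (hK : ContDiffOn ℝ 1 K W)
    (hS : IsCompact S) (hU : IsOpen U) (hUS : U ×ˢ S ⊆ W) (hf : IntegrableOn f S m) :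
    ContDiffOn ℝ 1 (fun x => ∫ z in S, f z • K (x, z) ∂m) U := by
  rw [show (1 : WithTop ℕ∞) = 0 + 1 by norm_num, contDiffOn_succ_iff_fderiv_of_isOpen hU]
  refine ⟨fun x hx => (hasFDerivAt_setIntegral_smul hW hK hS hU hUS hf
    hx).differentiableAt.differentiableWithinAt, by simp, ?_⟩
  rw [contDiffOn_zero]
  refine (continuousOn_setIntegral_smul (hK.fderivLeft (k := 0) hW (by norm_num)).continuousOn
    hS hU hUS hf).congr fun x hx => ?_
  exact (hasFDerivAt_setIntegral_smul hW hK hS hU hUS hf hx).fderiv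

/-- The derivative is again an integral of the same type, with kernel `fderivLeft K`, so the `C¹`
statement applies to it. This is why kernels take values in a general normed space. -/
theorem contDiffOn_two_setIntegral_smul (hW : IsOpen W) (hK : ContDiffOn ℝ 2 K W)
    (hS : IsCompact S) (hU : IsOpen U) (hUS : U ×ˢ S ⊆ W) (hf : IntegrableOn f S m) :
    ContDiffOn ℝ 2 (fun x => ∫ z in S, f z • K (x, z) ∂m) U := by
  rw [show (2 : WithTop ℕ∞) = 1 + 1 by norm_num, contDiffOn_succ_iff_fderiv_of_isOpen hU]
  have hK1 : ContDiffOn ℝ 1 K W := hK.of_le (by norm_num)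
  refine ⟨fun x hx => (hasFDerivAt_setIntegral_smul hW hK1 hS hU hUS hf
    hx).differentiableAt.differentiableWithinAt, by simp, ?_⟩
  refine (contDiffOn_one_setIntegral_smul hW (hK.fderivLeft (k := 1) hW (by norm_num))
    hS hU hUS hf).congr fun x hx => ?_
  exact (hasFDerivAt_setIntegral_smul hW hK1 hS hU hUS hf hx).fderiv

end Parametric

/-! ### Laplacians of integrals depending on a parameter -/

section ParametricLaplacian

variable {E F : Type*} [NormedAddCommGroup E] [InnerProductSpace ℝ E] [FiniteDimensional ℝ E]
  [NormedAddCommGroup F] [NormedSpace ℝ F] [MeasurableSpace F] [BorelSpace F]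
  [SecondCountableTopology F]
  {W : Set (E × F)} {K : E × F → ℝ} {S : Set F} {U : Set E} {m : Measure F} {f : F → ℝ}

theorem fderiv_fderiv_slice (hW : IsOpen W) (hK : ContDiffOn ℝ 2 K W) {x : E} {z : F}
    (hxz : (x, z) ∈ W) :
    fderiv ℝ (fderiv ℝ fun y => K (y, z)) x = fderivLeft (fderivLeft K) (x, z) := by
  have h0 : ∀ᶠ y in 𝓝 x, (y, z) ∈ W :=
    (by fun_prop : Continuous fun y : E => (y, z)).continuousAt.tendsto.eventually
      (hW.mem_nhds hxz)
  have h1 : fderiv ℝ (fun y => K (y, z)) =ᶠ[𝓝 x] fun y => fderivLeft K (y, z) := by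
    filter_upwards [h0] with y hy
    have h2 : DifferentiableAt ℝ K (y, z) :=
      (hK.contDiffAt (hW.mem_nhds hy)).differentiableAt (by norm_num)
    exact (h2.hasFDerivAt.comp y (hasFDerivAt_prodMk_left y z)).fderiv
  have h3 : DifferentiableAt ℝ (fderivLeft K) (x, z) :=
    ((hK.fderivLeft (k := 1) hW (by norm_num)).contDiffAt
      (hW.mem_nhds hxz)).differentiableAt (by norm_num)
  have h4 : HasFDerivAt (fun y => fderivLeft K (y, z)) (fderivLeft (fderivLeft K) (x, z)) x :=
    HasFDerivAt.comp x (g := fderivLeft K) h3.hasFDerivAt (hasFDerivAt_prodMk_left x z)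
  rw [h1.fderiv_eq, h4.fderiv]

theorem laplacian_setIntegral_smul (hW : IsOpen W) (hK : ContDiffOn ℝ 2 K W) (hS : IsCompact S)
    (hU : IsOpen U) (hUS : U ×ˢ S ⊆ W) (hf : IntegrableOn f S m) {x : E} (hx : x ∈ U) :
    (Δ (fun x => ∫ z in S, f z • K (x, z) ∂m)) x =
      ∫ z in S, f z * (Δ (fun y => K (y, z))) x ∂m := by
  have hK1 : ContDiffOn ℝ 1 K W := hK.of_le (by norm_num)
  have hK' := hK.fderivLeft (k := 1) hW (by norm_num)
  have hK'' := (hK'.fderivLeft (k := 0) hW (by norm_num)).continuousOn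
  have h1 : fderiv ℝ (fun x => ∫ z in S, f z • K (x, z) ∂m) =ᶠ[𝓝 x]
      fun x => ∫ z in S, f z • fderivLeft K (x, z) ∂m := by
    filter_upwards [hU.mem_nhds hx] with y hy
    exact (hasFDerivAt_setIntegral_smul hW hK1 hS hU hUS hf hy).fderiv
  have hint := integrableOn_smul_slice hK'' hS hUS hf hx
  rw [laplacian_eq_sum_fderiv, h1.fderiv_eq,
    (hasFDerivAt_setIntegral_smul hW hK' hS hU hUS hf hx).fderiv]
  have h2 : ∀ v : E, (∫ z in S, f z • fderivLeft (fderivLeft K) (x, z) ∂m) v v =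
      ∫ z in S, f z * fderivLeft (fderivLeft K) (x, z) v v ∂m := fun v => by
    have hint' : IntegrableOn (fun z => (f z • fderivLeft (fderivLeft K) (x, z)) v) S m :=
      Integrable.apply_continuousLinearMap hint v
    rw [ContinuousLinearMap.integral_apply hint v, ContinuousLinearMap.integral_apply hint' v]
    simp
  simp_rw [h2]
  rw [← integral_finsetSum]
  · refine setIntegral_congr_fun hS.measurableSet fun z hz => ?_
    rw [laplacian_eq_sum_fderiv, Finset.mul_sum, fderiv_fderiv_slice hW hK (hUS ⟨hx, hz⟩)]
  · intro i _
    have h3 : IntegrableOn (fun z => (f z • fderivLeft (fderivLeft K) (x, z))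
        (stdOrthonormalBasis ℝ E i)) S m :=
      Integrable.apply_continuousLinearMap hint _
    simpa using Integrable.apply_continuousLinearMap h3 (stdOrthonormalBasis ℝ E i)

/-- Serves both for Poisson integrals over the unit sphere and for the radial means over `[0, 1]` in
the Riquier problem. -/
theorem harmonicOnNhd_setIntegral_smul (hW : IsOpen W) (hK : ContDiffOn ℝ 2 K W)
    (hS : IsCompact S) (hU : IsOpen U) (hUS : U ×ˢ S ⊆ W) (hf : IntegrableOn f S m)
    (hΔ : ∀ x ∈ U, ∀ z ∈ S, (Δ (fun y => K (y, z))) x = 0) :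
    InnerProductSpace.HarmonicOnNhd (fun x => ∫ z in S, f z • K (x, z) ∂m) U := by
  refine (harmonicOnNhd_iff hU).2 ⟨contDiffOn_two_setIntegral_smul hW hK hS hU hUS hf, ?_⟩
  intro x hx
  rw [laplacian_setIntegral_smul hW hK hS hU hUS hf hx]
  refine (setIntegral_congr_fun hS.measurableSet (g := fun _ => 0) fun z hz => ?_).trans (by simp)
  simp [hΔ x hx z hz]

end ParametricLaplacian

/-! ### The normalized surface measure of the unit sphere -/

section Poisson

open InnerProductSpace Module Metric

variable {E : Type*} [NormedAddCommGroup E] [InnerProductSpace ℝ E] [FiniteDimensional ℝ E]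
  [MeasurableSpace E] [BorelSpace E] [Nontrivial E]

variable (E) in
/-- The rotation invariant probability measure on the unit sphere, obtained by projecting the
normalized volume of the unit ball radially. -/
def sphereMeasure : Measure E :=
  (ProbabilityTheory.cond volume (ball (0 : E) 1)).map fun x => ‖x‖⁻¹ • x

theorem measurable_normalize : Measurable fun x : E => ‖x‖⁻¹ • x :=
  measurable_norm.inv.smul measurable_id

instance : IsProbabilityMeasure (ProbabilityTheory.cond volume (ball (0 : E) 1)) :=
  ProbabilityTheory.cond_isProbabilityMeasure_of_finite
    (measure_ball_pos volume _ one_pos).ne' measure_ball_lt_top.ne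

instance : IsProbabilityMeasure (sphereMeasure E) :=
  Measure.isProbabilityMeasure_map measurable_normalize.aemeasurable

theorem sphereMeasure_compl : sphereMeasure E (sphere 0 1)ᶜ = 0 := by
  rw [sphereMeasure, Measure.map_apply measurable_normalize isClosed_sphere.measurableSet.compl]
  refine measure_mono_null (t := {0}) (fun x hx => ?_) ?_
  · by_contra h
    have h' : ‖x‖ ≠ 0 := norm_ne_zero_iff.2 h
    exact hx (by simp [norm_smul, h'])
  · simp [ProbabilityTheory.cond]

theorem sphereMeasure_sphere : sphereMeasure E (sphere 0 1) = 1 := by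
  have := prob_compl_eq_zero_iff (μ := sphereMeasure E)
    (isClosed_sphere (x := (0 : E)) (ε := 1)).measurableSet
  exact this.1 sphereMeasure_compl

/-- A linear isometry preserves the volume and the unit ball, and commutes with `x ↦ ‖x‖⁻¹ • x`. -/
theorem measurePreserving_sphereMeasure (T : E ≃ₗᵢ[ℝ] E) :
    MeasurePreserving T (sphereMeasure E) (sphereMeasure E) := by
  refine ⟨T.continuous.measurable, ?_⟩
  have h1 : (ProbabilityTheory.cond volume (ball (0 : E) 1)).map T =
      ProbabilityTheory.cond volume (ball (0 : E) 1) := by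
    have h2 := (T.measurePreserving.restrict_preimage
      (isOpen_ball (x := (0 : E)) (ε := 1)).measurableSet).map_eq
    have h3 : T ⁻¹' ball (0 : E) 1 = ball 0 1 := by ext x; simp
    rw [h3] at h2
    rw [ProbabilityTheory.cond, Measure.map_smul, h2]
  conv_rhs => rw [sphereMeasure, ← h1]
  rw [sphereMeasure, Measure.map_map T.continuous.measurable measurable_normalize,
    Measure.map_map measurable_normalize T.continuous.measurable]
  congr 1
  ext x
  simp

/-! ### The Poisson kernel -/

/-- The Poisson kernel of the unit ball. -/
def ballPoissonKernel (p : E × E) : ℝ :=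
  (1 - ‖p.1‖ ^ 2) * (‖p.1 - p.2‖ ^ 2) ^ (-(finrank ℝ E : ℝ) / 2)

/-- The Poisson integral of a function on the unit sphere. -/
def ballPoissonIntegral (f : E → ℝ) (x : E) : ℝ :=
  ∫ z in sphere 0 1, f z • ballPoissonKernel (x, z) ∂sphereMeasure E

theorem isOpen_ne_fst_snd : IsOpen {p : E × E | p.1 ≠ p.2} :=
  isOpen_ne_fun continuous_fst continuous_snd

theorem contDiffOn_ballPoissonKernel :
    ContDiffOn ℝ 2 (ballPoissonKernel (E := E)) {p : E × E | p.1 ≠ p.2} := by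
  refine ContDiffOn.mul ?_ (ContDiffOn.rpow_const_of_ne ?_ fun p hp => ?_)
  · exact (contDiff_const.sub ((contDiff_norm_sq ℝ).comp contDiff_fst)).contDiffOn
  · exact ((contDiff_norm_sq ℝ).comp (contDiff_fst.sub contDiff_snd)).contDiffOn
  · simpa [sub_eq_zero] using hp

theorem hasDerivAt_rpow_neg {s t : ℝ} (ht : 0 < t) :
    HasDerivAt (fun t : ℝ => t ^ s) (s * t ^ (s - 1)) t :=
  Real.hasDerivAt_rpow_const (Or.inl ht.ne')

theorem laplacian_ballPoissonKernel {x z : E} (hxz : x ≠ z) (hz : ‖z‖ = 1) :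
    (Δ (fun y => ballPoissonKernel (y, z))) x = 0 := by
  have ht : 0 < ‖x - z‖ ^ 2 := by
    have := norm_pos_iff.2 (sub_ne_zero.2 hxz)
    positivity
  set d : ℝ := (finrank ℝ E : ℝ) with hd
  have h1 : HasHessianAt (fun y : E => 1 - ‖y - 0‖ ^ 2) _ _ x :=
    hasHessianAt_radial (φ := fun t => 1 - t) (φ' := fun _ => -1) (c := 0)
      (Eventually.of_forall fun t => (hasDerivAt_id t).const_sub 1) (hasDerivAt_const _ _)
  have h1' := laplacian_radial (φ := fun t => 1 - t) (φ' := fun _ => -1) (c := 0) (a := 0) (x := x)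
      (Eventually.of_forall fun t => (hasDerivAt_id t).const_sub 1) (hasDerivAt_const _ _)
  have h2e : ∀ᶠ t in 𝓝 (‖x - z‖ ^ 2),
      HasDerivAt (fun t : ℝ => t ^ (-d / 2)) (-d / 2 * t ^ (-d / 2 - 1)) t :=
    (lt_mem_nhds ht).mono fun t ht => hasDerivAt_rpow_neg ht
  have h2d := (hasDerivAt_rpow_neg (s := -d / 2 - 1) ht).const_mul (-d / 2)
  have h2 := hasHessianAt_radial h2e h2d
  have h2' := laplacian_radial h2e h2d
  have h3 := h1.laplacian_mul h2
  rw [h1', h2'] at h3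
  simp only [sub_zero] at h3
  have h4 : (fun y => ballPoissonKernel (y, z)) =
      fun y => (1 - ‖y‖ ^ 2) * (‖y - z‖ ^ 2) ^ (-d / 2) := rfl
  rw [h4, h3]
  have h5 : (‖x - z‖ ^ 2) ^ (-d / 2) = (‖x - z‖ ^ 2) ^ (-d / 2 - 1) * ‖x - z‖ ^ 2 := by
    rw [← Real.rpow_add_one ht.ne']; congr 1; ring
  have h6 : (‖x - z‖ ^ 2) ^ (-d / 2 - 1) = (‖x - z‖ ^ 2) ^ (-d / 2 - 1 - 1) * ‖x - z‖ ^ 2 := by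
    rw [← Real.rpow_add_one ht.ne']; congr 1; ring
  -- This is `‖x - (x - z)‖² = ‖z‖² = 1`, the only place where `z` on the unit sphere is used. It
  -- eliminates the inner product from the product rule, after which all terms are multiples of one
  -- power of `‖x - z‖²`.
  have h7 : ‖x‖ ^ 2 - 2 * inner ℝ x (x - z) + ‖x - z‖ ^ 2 = 1 := by
    rw [← norm_sub_sq_real]; simp [hz]
  rw [h5, h6]
  simp only [inner_smul_left, inner_smul_right]
  simp
  rw [← hd]
  have h8 : inner ℝ x (x - z) = (‖x‖ ^ 2 + ‖x - z‖ ^ 2 - 1) / 2 := by linarith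
  rw [h8]
  ring

theorem ballPoissonKernel_nonneg {x z : E} (hx : ‖x‖ ≤ 1) : 0 ≤ ballPoissonKernel (x, z) := by
  have : ‖x‖ ^ 2 ≤ 1 := pow_le_one₀ (norm_nonneg _) hx
  exact mul_nonneg (by simpa using this) (by positivity)

theorem ballPoissonKernel_zero {z : E} (hz : ‖z‖ = 1) : ballPoissonKernel ((0 : E), z) = 1 := by
  simp [ballPoissonKernel, hz]

theorem ball_prod_sphere_subset : ball (0 : E) 1 ×ˢ sphere (0 : E) 1 ⊆ {p : E × E | p.1 ≠ p.2} := by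
  rintro ⟨x, z⟩ ⟨hx, hz⟩ h
  simp only [mem_ball_zero_iff, mem_sphere_zero_iff_norm] at hx hz h
  rw [h, hz] at hx
  exact lt_irrefl _ hx

theorem integrableOn_mul_ballPoissonKernel {f : E → ℝ}
    (hf : IntegrableOn f (sphere 0 1) (sphereMeasure E)) {x : E} (hx : x ∈ ball (0 : E) 1) :
    IntegrableOn (fun z => f z • ballPoissonKernel (x, z)) (sphere 0 1) (sphereMeasure E) :=
  integrableOn_smul_slice contDiffOn_ballPoissonKernel.continuousOn (isCompact_sphere 0 1)
    ball_prod_sphere_subset hf hx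

theorem harmonicOnNhd_ballPoissonIntegral {f : E → ℝ}
    (hf : IntegrableOn f (sphere 0 1) (sphereMeasure E)) :
    HarmonicOnNhd (ballPoissonIntegral f) (ball 0 1) := by
  refine harmonicOnNhd_setIntegral_smul isOpen_ne_fst_snd contDiffOn_ballPoissonKernel
    (isCompact_sphere 0 1) isOpen_ball ball_prod_sphere_subset hf fun x hx z hz => ?_
  exact laplacian_ballPoissonKernel
    (show (x, z) ∈ {p : E × E | p.1 ≠ p.2} from ball_prod_sphere_subset ⟨hx, hz⟩)
    (by simpa using hz)

theorem ballPoissonIntegral_zero (f : E → ℝ) :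
    ballPoissonIntegral f 0 = ∫ z in sphere 0 1, f z ∂sphereMeasure E := by
  refine setIntegral_congr_fun isClosed_sphere.measurableSet fun z hz => ?_
  simp [ballPoissonKernel_zero (by simpa using hz : ‖z‖ = 1)]

theorem ballPoissonIntegral_one_comp (T : E ≃ₗᵢ[ℝ] E) (x : E) :
    ballPoissonIntegral (fun _ => 1) (T x) = ballPoissonIntegral (fun _ => 1) x := by
  have h := (measurePreserving_sphereMeasure T).setIntegral_preimage_emb
    T.toHomeomorph.measurableEmbedding (fun z => (1 : ℝ) • ballPoissonKernel (T x, z)) (sphere 0 1)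
  have h3 : T ⁻¹' sphere (0 : E) 1 = sphere 0 1 := by ext x; simp
  rw [h3] at h
  rw [ballPoissonIntegral, ← h, ballPoissonIntegral]
  simp [ballPoissonKernel, ← map_sub]

theorem tendsto_nhdsWithin_of_continuousOn {X Y : Type*} [TopologicalSpace X] [TopologicalSpace Y]
    {f : X → Y} {s t : Set X} (hf : ContinuousOn f t) (hst : s ⊆ t) {y : X} (hy : y ∈ t) :
    Tendsto f (𝓝[s] y) (𝓝 (f y)) :=
  (hf y hy).mono_left (nhdsWithin_mono _ hst)

/-- By rotation invariance the integral is constant on the sphere of radius `‖x‖`. Being harmonic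
inside, it takes that constant value also at the origin, where the kernel is `1`. -/
theorem ballPoissonIntegral_one {x : E} (hx : x ∈ ball (0 : E) 1) :
    ballPoissonIntegral (fun _ => 1) x = 1 := by
  have h0 : ballPoissonIntegral (fun _ => 1) (0 : E) = 1 := by
    simp [ballPoissonIntegral_zero, measureReal_def, sphereMeasure_sphere]
  rcases eq_or_ne x 0 with rfl | hx0
  · exact h0
  have hr : 0 < ‖x‖ := norm_pos_iff.2 hx0
  have hsub : closedBall (0 : E) ‖x‖ ⊆ ball 0 1 := closedBall_subset_ball (by simpa using hx)
  have hh : HarmonicOnNhd (ballPoissonIntegral fun _ : E => (1 : ℝ)) (ball 0 1) :=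
    harmonicOnNhd_ballPoissonIntegral (integrable_const _)
  have hh' := (harmonicOnNhd_iff isOpen_ball).1 (hh.mono (ball_subset_closedBall.trans hsub))
  have hfr : frontier (ball (0 : E) ‖x‖) = sphere 0 ‖x‖ := frontier_ball _ hr.ne'
  have hlim : ∀ y ∈ frontier (ball (0 : E) ‖x‖), Tendsto (ballPoissonIntegral fun _ : E => (1 : ℝ))
      (𝓝[ball 0 ‖x‖] y) (𝓝 (ballPoissonIntegral (fun _ => 1) x)) := by
    intro y hy
    rw [hfr, mem_sphere_zero_iff_norm] at hy
    have := tendsto_nhdsWithin_of_continuousOn (hh.continuousOn.mono hsub) ball_subset_closedBall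
      (by simp [hy] : y ∈ closedBall (0 : E) ‖x‖)
    -- The reflection in the hyperplane orthogonal to `y - x` sends `y` to `x`, because they have
    -- equal norms.
    rwa [← ballPoissonIntegral_one_comp (ℝ ∙ (y - x))ᗮ.reflection y, Submodule.reflection_sub hy] at this
  have hc : ∀ z ∈ ball (0 : E) ‖x‖, (Δ fun _ : E => ballPoissonIntegral (fun _ : E => (1 : ℝ)) x) z = 0 :=
    fun z _ => by simp
  have h1 := le_of_laplacian_le isOpen_ball isBounded_ball hh'.1 contDiffOn_const
    (fun z hz => by rw [hc z hz, hh'.2 z hz]) hlim (fun y _ => tendsto_const_nhds)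
    (fun _ _ => le_rfl) 0 (by simpa using hr)
  have h2 := le_of_laplacian_le isOpen_ball isBounded_ball contDiffOn_const hh'.1
    (fun z hz => by rw [hc z hz, hh'.2 z hz]) (fun y _ => tendsto_const_nhds) hlim
    (fun _ _ => le_rfl) 0 (by simpa using hr)
  exact (le_antisymm h2 h1).trans h0

theorem integrableOn_sphere {f : E → ℝ} (hf : ContinuousOn f (sphere 0 1)) :
    IntegrableOn f (sphere 0 1) (sphereMeasure E) :=
  hf.integrableOn_compact (isCompact_sphere 0 1)

theorem ballPoissonKernel_le_of_le_norm {x z : E} (hx : ‖x‖ ≤ 1) {δ : ℝ} (hδ : 0 < δ)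
    (h : δ ≤ ‖x - z‖) :
    ballPoissonKernel (x, z) ≤ (1 - ‖x‖ ^ 2) * (δ ^ 2) ^ (-(finrank ℝ E : ℝ) / 2) := by
  have : ‖x‖ ^ 2 ≤ 1 := pow_le_one₀ (norm_nonneg _) hx
  refine mul_le_mul_of_nonneg_left ?_ (by linarith)
  refine Real.rpow_le_rpow_of_nonpos (by positivity) (by gcongr) ?_
  have : (0 : ℝ) ≤ finrank ℝ E := by positivity
  linarith

/-- The Poisson integral of a continuous function attains its boundary values. -/
theorem tendsto_ballPoissonIntegral {f : E → ℝ} (hf : ContinuousOn f (sphere 0 1)) {y : E}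
    (hy : y ∈ sphere (0 : E) 1) :
    Tendsto (ballPoissonIntegral f) (𝓝[ball 0 1] y) (𝓝 (f y)) := by
  rw [Metric.tendsto_nhds]
  intro ε hε
  obtain ⟨M, hM⟩ := (isCompact_sphere (0 : E) 1).exists_bound_of_continuousOn hf
  have hM0 : 0 ≤ M := (norm_nonneg _).trans (hM y hy)
  obtain ⟨δ, hδ, hδf⟩ := Metric.continuousOn_iff.1 hf y hy (ε / 2) (by positivity)
  set D := ((δ / 2) ^ 2) ^ (-(finrank ℝ E : ℝ) / 2) with hD
  have hD0 : 0 ≤ D := by positivity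
  have hlim : Tendsto (fun x : E => 2 * M * ((1 - ‖x‖ ^ 2) * D)) (𝓝[ball 0 1] y) (𝓝 0) := by
    have : Continuous fun x : E => 2 * M * ((1 - ‖x‖ ^ 2) * D) := by fun_prop
    have h := this.tendsto y
    rw [mem_sphere_zero_iff_norm] at hy
    simp only [hy] at h
    simpa using h.mono_left nhdsWithin_le_nhds
  filter_upwards [hlim.eventually (gt_mem_nhds (by positivity : (0 : ℝ) < ε / 2)),
    self_mem_nhdsWithin, nhdsWithin_le_nhds (ball_mem_nhds y (by positivity : 0 < δ / 2))]
    with x hx1 hx2 hx3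
  have hxn : ‖x‖ ≤ 1 := by simpa using (mem_ball.1 hx2).le
  -- If `z` is within `δ` of `y`, continuity of `f` gives the first term. Otherwise `‖x - z‖ ≥ δ /
  -- 2` because `x` is within `δ / 2` of `y`, and the kernel is at most `(1 - ‖x‖²) D`. The total
  -- mass `1` of the kernel then makes the first term integrate to `ε / 2`.
  have hpt : ∀ z ∈ sphere (0 : E) 1, ‖(f z - f y) • ballPoissonKernel (x, z)‖ ≤
      (1 : ℝ) • ballPoissonKernel (x, z) * (ε / 2) + 2 * M * ((1 - ‖x‖ ^ 2) * D) := by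
    intro z hz
    have hK := ballPoissonKernel_nonneg (z := z) hxn
    have hx4 : 0 ≤ 1 - ‖x‖ ^ 2 := by
      have := pow_le_one₀ (n := 2) (norm_nonneg _) hxn
      linarith
    rw [norm_smul, Real.norm_of_nonneg hK, one_smul]
    by_cases hzy : dist z y < δ
    · have h1 := (hδf z hz hzy).le
      rw [Real.dist_eq] at h1
      have : 0 ≤ 2 * M * ((1 - ‖x‖ ^ 2) * D) := by positivity
      rw [Real.norm_eq_abs]
      nlinarith
    · have h1 : δ / 2 ≤ ‖x - z‖ := by
        have h2 := dist_triangle z x y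
        have h3 := mem_ball.1 hx3
        rw [← dist_eq_norm, dist_comm]
        linarith
      have h2 := ballPoissonKernel_le_of_le_norm hxn (by positivity) h1
      have h3 : ‖f z - f y‖ ≤ 2 * M := (norm_sub_le _ _).trans (by linarith [hM z hz, hM y hy])
      have h4 : ‖f z - f y‖ * ballPoissonKernel (x, z) ≤ 2 * M * ((1 - ‖x‖ ^ 2) * D) :=
        mul_le_mul h3 h2 hK (by positivity)
      have : 0 ≤ ballPoissonKernel (x, z) * (ε / 2) := by positivity
      linarith
  have hi1 := integrableOn_mul_ballPoissonKernel (integrableOn_sphere hf) hx2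
  have hi2 := integrableOn_mul_ballPoissonKernel
    (integrableOn_sphere (f := fun _ : E => (1 : ℝ)) continuousOn_const) hx2
  have h1 : ballPoissonIntegral f x - f y =
      ∫ z in sphere 0 1, (f z - f y) • ballPoissonKernel (x, z) ∂sphereMeasure E := by
    have h2 : f y = ∫ z in sphere 0 1, f y * (1 : ℝ) • ballPoissonKernel (x, z) ∂sphereMeasure E := by
      rw [integral_const_mul]
      change f y = f y * ballPoissonIntegral (fun _ => 1) x
      rw [ballPoissonIntegral_one hx2, mul_one]
    conv_lhs => rw [h2]
    rw [ballPoissonIntegral, ← integral_sub hi1 (hi2.const_mul _)]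
    refine integral_congr_ae (Eventually.of_forall fun z => ?_)
    simp [sub_mul]
  have h5 : ∫ z in sphere 0 1, ((1 : ℝ) • ballPoissonKernel (x, z) * (ε / 2) +
      2 * M * ((1 - ‖x‖ ^ 2) * D)) ∂sphereMeasure E = ε / 2 + 2 * M * ((1 - ‖x‖ ^ 2) * D) := by
    rw [integral_add (hi2.mul_const _) (integrable_const _), integral_mul_const]
    change ballPoissonIntegral (fun _ => 1) x * (ε / 2) + _ = _
    rw [ballPoissonIntegral_one hx2]
    simp [measureReal_def, sphereMeasure_sphere]
  rw [Real.dist_eq, h1, ← Real.norm_eq_abs]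
  have h6 := norm_integral_le_of_norm_le
    (μ := (sphereMeasure E).restrict (sphere 0 1))
    ((hi2.mul_const (ε / 2)).add (integrable_const (2 * M * ((1 - ‖x‖ ^ 2) * D))))
    ((ae_restrict_mem isClosed_sphere.measurableSet).mono hpt)
  refine h6.trans_lt ?_
  have h7 := h5
  simp only [Pi.add_apply] at h7 ⊢
  rw [h7]
  linarith

/-! ### Poisson integrals on arbitrary balls -/

/-- The Poisson integral of `f` on the ball of centre `a` and radius `R`. -/
def poissonOn (a : E) (R : ℝ) (f : E → ℝ) (x : E) : ℝ :=
  ballPoissonIntegral (fun z => f (a + R • z)) (R⁻¹ • (x - a))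

theorem inv_smul_sub_mem_ball {a x : E} {R : ℝ} (hR : 0 < R) (hx : x ∈ ball a R) :
    R⁻¹ • (x - a) ∈ ball (0 : E) 1 := by
  rw [mem_ball_zero_iff, norm_smul, norm_inv, Real.norm_of_nonneg hR.le, inv_mul_lt_one₀ hR]
  exact mem_ball_iff_norm.1 hx

theorem inv_smul_sub_mem_sphere {a x : E} {R : ℝ} (hR : 0 < R) (hx : x ∈ sphere a R) :
    R⁻¹ • (x - a) ∈ sphere (0 : E) 1 := by
  rw [mem_sphere_zero_iff_norm, norm_smul, norm_inv, Real.norm_of_nonneg hR.le,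
    mem_sphere_iff_norm.1 hx, inv_mul_cancel₀ hR.ne']

theorem add_smul_mem_sphere {a z : E} {R : ℝ} (hR : 0 < R) (hz : z ∈ sphere (0 : E) 1) :
    a + R • z ∈ sphere a R := by
  rw [mem_sphere_zero_iff_norm] at hz
  simp [norm_smul, hz, hR.le]

theorem InnerProductSpace.HarmonicOnNhd.comp_inv_smul_sub {f : E → ℝ} {a : E} {R : ℝ} (hR : 0 < R)
    (hf : HarmonicOnNhd f (ball 0 1)) : HarmonicOnNhd (fun x => f (R⁻¹ • (x - a))) (ball a R) := by
  intro x hx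
  have h : ∀ x, R⁻¹ • (x - a) = -(R⁻¹ • a) + R⁻¹ • x := fun x => by rw [smul_sub]; abel
  simp_rw [h]
  exact HarmonicAt.comp_affine (by rw [← h]; exact hf _ (inv_smul_sub_mem_ball hR hx))

theorem tendsto_comp_inv_smul_sub {f : E → ℝ} {a y : E} {R : ℝ} (hR : 0 < R) {l : Filter ℝ}
    (hf : Tendsto f (𝓝[ball 0 1] (R⁻¹ • (y - a))) l) :
    Tendsto (fun x => f (R⁻¹ • (x - a))) (𝓝[ball a R] y) l := by
  refine hf.comp (tendsto_nhdsWithin_iff.2 ⟨?_, ?_⟩)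
  · exact ((by fun_prop : Continuous fun x : E => R⁻¹ • (x - a)).tendsto y).mono_left
      nhdsWithin_le_nhds
  · filter_upwards [self_mem_nhdsWithin] with x hx using inv_smul_sub_mem_ball hR hx

theorem harmonicOnNhd_poissonOn {a : E} {R : ℝ} (hR : 0 < R) {f : E → ℝ}
    (hf : IntegrableOn (fun z => f (a + R • z)) (sphere 0 1) (sphereMeasure E)) :
    HarmonicOnNhd (poissonOn a R f) (ball a R) :=
  (harmonicOnNhd_ballPoissonIntegral hf).comp_inv_smul_sub hR

theorem continuousOn_comp_add_smul {a : E} {R : ℝ} (hR : 0 < R) {f : E → ℝ}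
    (hf : ContinuousOn f (sphere a R)) :
    ContinuousOn (fun z => f (a + R • z)) (sphere (0 : E) 1) :=
  hf.comp (by fun_prop) fun _ hz => add_smul_mem_sphere hR hz

theorem tendsto_poissonOn {a : E} {R : ℝ} (hR : 0 < R) {f : E → ℝ}
    (hf : ContinuousOn f (sphere a R)) {y : E} (hy : y ∈ sphere a R) :
    Tendsto (poissonOn a R f) (𝓝[ball a R] y) (𝓝 (f y)) := by
  have := tendsto_ballPoissonIntegral (continuousOn_comp_add_smul hR hf)
    (inv_smul_sub_mem_sphere hR hy)
  rw [smul_inv_smul₀ hR.ne', add_sub_cancel] at this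
  exact tendsto_comp_inv_smul_sub hR this

theorem eqOn_of_harmonic_of_tendsto {ω : Set E} (ho : IsOpen ω) (hb : Bornology.IsBounded ω)
    {u v : E → ℝ} (hu : HarmonicOnNhd u ω) (hv : HarmonicOnNhd v ω) {f : E → ℝ}
    (hf : ∀ y ∈ frontier ω, Tendsto u (𝓝[ω] y) (𝓝 (f y)))
    (hg : ∀ y ∈ frontier ω, Tendsto v (𝓝[ω] y) (𝓝 (f y))) : EqOn u v ω := by
  rw [harmonicOnNhd_iff ho] at hu hv
  intro x hx
  refine le_antisymm ?_ ?_
  · exact le_of_laplacian_le ho hb hu.1 hv.1 (fun x hx => by rw [hu.2 x hx, hv.2 x hx]) hf hg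
      (fun _ _ => le_rfl) x hx
  · exact le_of_laplacian_le ho hb hv.1 hu.1 (fun x hx => by rw [hu.2 x hx, hv.2 x hx]) hg hf
      (fun _ _ => le_rfl) x hx

/-- The Poisson representation. -/
theorem eqOn_poissonOn {a : E} {R : ℝ} (hR : 0 < R) {u : E → ℝ}
    (hu : HarmonicOnNhd u (ball a R)) (hc : ContinuousOn u (closedBall a R)) :
    EqOn u (poissonOn a R u) (ball a R) := by
  have hcs := hc.mono sphere_subset_closedBall
  refine eqOn_of_harmonic_of_tendsto isOpen_ball isBounded_ball hu (harmonicOnNhd_poissonOn hR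
    (integrableOn_sphere (continuousOn_comp_add_smul hR hcs))) (f := u) (fun y hy => ?_)
    fun y hy => ?_ <;> rw [frontier_ball _ hR.ne'] at hy
  · exact tendsto_nhdsWithin_of_continuousOn hc ball_subset_closedBall (sphere_subset_closedBall hy)
  · exact tendsto_poissonOn hR hcs hy

/-! ### Harnack inequalities -/

variable (E) in
/-- The lower Harnack constant for points at relative distance `ρ` from the centre of a ball. -/
def harnackLower (ρ : ℝ) : ℝ := (1 - ρ ^ 2) * ((1 + ρ) ^ 2) ^ (-(finrank ℝ E : ℝ) / 2)

variable (E) in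
/-- The upper Harnack constant for points at relative distance `ρ` from the centre of a ball. -/
def harnackUpper (ρ : ℝ) : ℝ := (1 - ρ ^ 2) * ((1 - ρ) ^ 2) ^ (-(finrank ℝ E : ℝ) / 2)

theorem harnackLower_pos {ρ : ℝ} (h0 : 0 ≤ ρ) (h1 : ρ < 1) : 0 < harnackLower E ρ :=
  mul_pos (by nlinarith) (by positivity)

theorem harnackLower_le {x z : E} (hx : ‖x‖ < 1) (hz : ‖z‖ = 1) :
    harnackLower E ‖x‖ ≤ ballPoissonKernel (x, z) := by
  have hxz : 1 - ‖x‖ ≤ ‖x - z‖ := by rw [← hz, norm_sub_rev]; exact norm_sub_norm_le _ _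
  have h2 : ‖x - z‖ ≤ 1 + ‖x‖ := by rw [← hz, add_comm]; exact norm_sub_le _ _
  have h3 : 0 < ‖x - z‖ := by linarith
  have h4 : (0 : ℝ) ≤ finrank ℝ E := Nat.cast_nonneg _
  refine mul_le_mul_of_nonneg_left (Real.rpow_le_rpow_of_nonpos (by positivity) ?_ (by linarith))
    (by nlinarith [norm_nonneg x])
  change ‖x - z‖ ^ 2 ≤ _
  gcongr

theorem le_harnackUpper {x z : E} (hx : ‖x‖ < 1) (hz : ‖z‖ = 1) :
    ballPoissonKernel (x, z) ≤ harnackUpper E ‖x‖ := by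
  have hxz : 1 - ‖x‖ ≤ ‖x - z‖ := by rw [← hz, norm_sub_rev]; exact norm_sub_norm_le _ _
  exact ballPoissonKernel_le_of_le_norm hx.le (by linarith) hxz

/-- That both Harnack constants tend to `1` at the centre gives Liouville's theorem on balls of
growing radius, and a constant such as `2` on small neighbourhoods. -/
theorem tendsto_harnackLower : Tendsto (harnackLower E) (𝓝 0) (𝓝 1) := by
  have h : ContinuousAt (harnackLower E) 0 := by
    refine ContinuousAt.mul (by fun_prop) (ContinuousAt.rpow_const (by fun_prop) (Or.inl ?_))
    norm_num
  simpa [ContinuousAt, harnackLower] using h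

theorem tendsto_harnackUpper : Tendsto (harnackUpper E) (𝓝 0) (𝓝 1) := by
  have h : ContinuousAt (harnackUpper E) 0 := by
    refine ContinuousAt.mul (by fun_prop) (ContinuousAt.rpow_const (by fun_prop) (Or.inl ?_))
    norm_num
  simpa [ContinuousAt, harnackUpper] using h

theorem harnack_ballPoissonIntegral {f : E → ℝ}
    (hf : IntegrableOn f (sphere 0 1) (sphereMeasure E)) (h0 : ∀ z ∈ sphere (0 : E) 1, 0 ≤ f z)
    {x : E} (hx : x ∈ ball (0 : E) 1) :
    harnackLower E ‖x‖ * ballPoissonIntegral f 0 ≤ ballPoissonIntegral f x ∧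
      ballPoissonIntegral f x ≤ harnackUpper E ‖x‖ * ballPoissonIntegral f 0 := by
  have hi := integrableOn_mul_ballPoissonKernel hf hx
  have hx' : ‖x‖ < 1 := by simpa using hx
  rw [ballPoissonIntegral_zero, ← integral_const_mul, ← integral_const_mul]
  constructor
  · refine setIntegral_mono_on (hf.const_mul _) hi isClosed_sphere.measurableSet fun z hz => ?_
    rw [smul_eq_mul, mul_comm]
    exact mul_le_mul_of_nonneg_left (harnackLower_le hx' (by simpa using hz)) (h0 z hz)
  · refine setIntegral_mono_on hi (hf.const_mul _) isClosed_sphere.measurableSet fun z hz => ?_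
    rw [smul_eq_mul, mul_comm (harnackUpper E _)]
    exact mul_le_mul_of_nonneg_left (le_harnackUpper hx' (by simpa using hz)) (h0 z hz)

/-- The Harnack inequality on a ball. -/
theorem InnerProductSpace.HarmonicOnNhd.harnack {a : E} {R : ℝ} (hR : 0 < R) {u : E → ℝ}
    (hu : HarmonicOnNhd u (ball a R)) (hc : ContinuousOn u (closedBall a R))
    (h0 : ∀ z ∈ sphere a R, 0 ≤ u z) {x : E} (hx : x ∈ ball a R) :
    harnackLower E (‖x - a‖ / R) * u a ≤ u x ∧ u x ≤ harnackUpper E (‖x - a‖ / R) * u a := by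
  have hcs := hc.mono sphere_subset_closedBall
  have h := harnack_ballPoissonIntegral
    (integrableOn_sphere (continuousOn_comp_add_smul hR hcs))
    (fun z hz => h0 _ (add_smul_mem_sphere hR hz)) (inv_smul_sub_mem_ball hR hx)
  have ha := eqOn_poissonOn hR hu hc (mem_ball_self hR)
  have h1 : ‖R⁻¹ • (x - a)‖ = ‖x - a‖ / R := by
    rw [norm_smul, norm_inv, Real.norm_of_nonneg hR.le, div_eq_inv_mul]
  rw [poissonOn, sub_self, smul_zero] at ha
  rw [← ha, h1, show ballPoissonIntegral (fun z => u (a + R • z)) (R⁻¹ • (x - a)) = u x from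
    (eqOn_poissonOn hR hu hc hx).symm] at h
  exact h

/-- The Liouville theorem for nonnegative harmonic functions. -/
theorem InnerProductSpace.HarmonicOnNhd.eq_of_nonneg {u : E → ℝ} (hu : HarmonicOnNhd u univ)
    (h0 : ∀ x, 0 ≤ u x) (x : E) : u x = u 0 := by
  have hc : Continuous u := continuousOn_univ.1 hu.continuousOn
  have hlim : Tendsto (fun R : ℝ => ‖x - 0‖ / R) atTop (𝓝 0) :=
    tendsto_const_nhds.div_atTop tendsto_id
  have h : ∀ᶠ R : ℝ in atTop, harnackLower E (‖x - 0‖ / R) * u 0 ≤ u x ∧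
      u x ≤ harnackUpper E (‖x - 0‖ / R) * u 0 := by
    filter_upwards [eventually_gt_atTop 0, eventually_gt_atTop ‖x‖] with R hR hx
    exact HarmonicOnNhd.harnack hR (hu.mono (subset_univ _)) hc.continuousOn (fun z _ => h0 z)
      (by simpa using hx)
  refine le_antisymm ?_ ?_
  · have h1 := ((tendsto_harnackUpper (E := E)).comp hlim).mul_const (u 0)
    rw [one_mul] at h1
    exact ge_of_tendsto h1 (h.mono fun R hR => hR.2)
  · have h1 := ((tendsto_harnackLower (E := E)).comp hlim).mul_const (u 0)
    rw [one_mul] at h1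
    exact le_of_tendsto h1 (h.mono fun R hR => hR.1)

end Poisson

/-! ### The Riquier problem on balls -/

section Riquier

open InnerProductSpace Module Metric

variable {E : Type*} [NormedAddCommGroup E] [InnerProductSpace ℝ E] [FiniteDimensional ℝ E]

theorem ContDiffAt.hasHessianAt {f : E → ℝ} {x : E} (hf : ContDiffAt ℝ 2 f x) :
    ∃ A, HasHessianAt f (gradient f) A x := by
  refine ⟨_, ?_, (((toDual ℝ E).symm.toContinuousLinearEquiv.differentiable).differentiableAt.comp x
    ((hf.fderiv_right (m := 1) (by norm_num)).differentiableAt (by norm_num))).hasFDerivAt⟩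
  filter_upwards [hf.eventually (by simp)] with y hy
  refine ((hy.differentiableAt (by norm_num)).hasFDerivAt).congr_fderiv ?_
  ext v
  simp [gradient]

theorem inner_gradient (f : E → ℝ) (x v : E) : inner ℝ (gradient f x) v = fderiv ℝ f x v := by
  simp [gradient]

/-- The weighted radial mean of `v`, which inverts the operator `h ↦ ⟨x, ∇ h⟩ + (β + 1) h`. -/
def radialMean (β : ℝ) (v : E → ℝ) (x : E) : ℝ := ∫ s in Icc (0 : ℝ) 1, s ^ β • v (s • x)

/-! ### Radial means of harmonic functions -/

section RadialMean

variable {β : ℝ} {v : E → ℝ}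

theorem isOpen_smul_mem_ball : IsOpen {p : E × ℝ | p.2 • p.1 ∈ ball (0 : E) 1} :=
  isOpen_ball.preimage (by fun_prop)

theorem smul_mem_ball_of_mem {x : E} {s : ℝ} (hx : x ∈ ball (0 : E) 1) (hs : s ∈ Icc (0 : ℝ) 1) :
    s • x ∈ ball (0 : E) 1 := by
  rw [mem_ball_zero_iff] at hx ⊢
  rw [norm_smul, Real.norm_of_nonneg hs.1]
  nlinarith [norm_nonneg x, hs.2]

theorem ball_prod_Icc_subset :
    ball (0 : E) 1 ×ˢ Icc (0 : ℝ) 1 ⊆ {p : E × ℝ | p.2 • p.1 ∈ ball (0 : E) 1} :=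
  fun _ hp => smul_mem_ball_of_mem hp.1 hp.2

theorem contDiffOn_comp_smul (hv : ContDiffOn ℝ 2 v (ball 0 1)) :
    ContDiffOn ℝ 2 (fun p : E × ℝ => v (p.2 • p.1)) {p : E × ℝ | p.2 • p.1 ∈ ball (0 : E) 1} :=
  hv.comp (contDiff_snd.smul contDiff_fst).contDiffOn fun _ hp => hp

theorem integrableOn_rpow_Icc (hβ : 0 ≤ β) : IntegrableOn (fun s : ℝ => s ^ β) (Icc 0 1) :=
  (Real.continuous_rpow_const hβ).continuousOn.integrableOn_compact isCompact_Icc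

theorem harmonicOnNhd_radialMean (hβ : 0 ≤ β) (hv : HarmonicOnNhd v (ball 0 1)) :
    HarmonicOnNhd (radialMean β v) (ball 0 1) := by
  refine harmonicOnNhd_setIntegral_smul isOpen_smul_mem_ball (contDiffOn_comp_smul hv.contDiffOn)
    isCompact_Icc isOpen_ball ball_prod_Icc_subset (integrableOn_rpow_Icc hβ) fun x hx s hs => ?_
  have h := hv (s • x) (smul_mem_ball_of_mem hx hs)
  have h1 := laplacian_comp_affine (f := v) (a := 0) (x := x) (s := s) (by simpa using h.1)
  simp only [zero_add] at h1
  rw [h1, h.2.self_of_nhds]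
  simp

theorem abs_radialMean_le (hβ : 0 ≤ β) {M : ℝ} (hM : ∀ x ∈ ball (0 : E) 1, |v x| ≤ M) {x : E}
    (hx : x ∈ ball (0 : E) 1) : |radialMean β v x| ≤ M := by
  have h := norm_setIntegral_le_of_norm_le_const (μ := volume) (s := Icc (0 : ℝ) 1)
    (f := fun s : ℝ => s ^ β • v (s • x)) (C := M) (by simp) fun s hs => ?_
  · simpa [radialMean] using h
  · rw [norm_smul, Real.norm_of_nonneg (Real.rpow_nonneg hs.1 _)]
    have h1 := hM _ (smul_mem_ball_of_mem hx hs)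
    have h2 : s ^ β ≤ 1 := Real.rpow_le_one hs.1 hs.2 hβ
    have h3 : 0 ≤ s ^ β := Real.rpow_nonneg hs.1 _
    rw [Real.norm_eq_abs]
    nlinarith [abs_nonneg (v (s • x))]

/-- The substitution `τ = s t` moves `t` from the integrand to the upper limit, where the
fundamental theorem of calculus can differentiate it. -/
theorem radialMean_smul_mul (x : E) {t : ℝ} (ht : 0 < t) :
    radialMean β v (t • x) * t ^ (β + 1) = ∫ τ in (0 : ℝ)..t, τ ^ β * v (τ • x) := by
  have h := intervalIntegral.integral_comp_mul_right (a := 0) (b := 1)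
    (fun τ => τ ^ β * v (τ • x)) ht.ne'
  rw [zero_mul, one_mul, intervalIntegral.integral_of_le zero_le_one,
    ← integral_Icc_eq_integral_Ioc] at h
  have h1 : ∫ s in Icc (0 : ℝ) 1, (s * t) ^ β * v ((s * t) • x) =
      t ^ β * radialMean β v (t • x) := by
    rw [radialMean, ← integral_const_mul]
    refine setIntegral_congr_fun measurableSet_Icc fun s hs => ?_
    simp only [smul_eq_mul]
    rw [Real.mul_rpow hs.1 ht.le, smul_smul]
    ring
  rw [h1, smul_eq_mul] at h
  rw [Real.rpow_add_one ht.ne', ← mul_assoc, mul_comm _ (t ^ β), h, mul_comm, mul_inv_cancel_left₀ ht.ne']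

/-- Both sides of `radialMean_smul_mul` are differentiated at `t = 1`: the product rule on the left,
the integrand at the endpoint on the right. -/
theorem fderiv_radialMean_apply (hβ : 0 ≤ β) (hv : HarmonicOnNhd v (ball 0 1)) {x : E}
    (hx : x ∈ ball (0 : E) 1) :
    fderiv ℝ (radialMean β v) x x = v x - (β + 1) * radialMean β v x := by
  have hL : HasDerivAt (fun t : ℝ => t • x) x 1 := by
    simpa using (hasDerivAt_id (1 : ℝ)).smul_const x
  have hφ := ((harmonicOnNhd_radialMean hβ hv) x hx).1.differentiableAt (by norm_num)
  have h1 : HasDerivAt (fun t : ℝ => radialMean β v (t • x)) (fderiv ℝ (radialMean β v) x x) 1 :=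
    HasFDerivAt.comp_hasDerivAt_of_eq (1 : ℝ) hφ.hasFDerivAt hL (by simp)
  have h2 := h1.mul (Real.hasDerivAt_rpow_const (x := (1 : ℝ)) (p := β + 1) (Or.inl one_ne_zero))
  have hO : IsOpen {τ : ℝ | τ • x ∈ ball (0 : E) 1} := isOpen_ball.preimage (by fun_prop)
  have hf : ContinuousOn (fun τ : ℝ => τ ^ β * v (τ • x)) {τ : ℝ | τ • x ∈ ball (0 : E) 1} :=
    (Real.continuous_rpow_const hβ).continuousOn.mul
      (hv.continuousOn.comp (by fun_prop) fun τ hτ => hτ)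
  have h1O : (1 : ℝ) ∈ {τ : ℝ | τ • x ∈ ball (0 : E) 1} := by
    simpa only [mem_ofPred_eq, one_smul] using hx
  have h3 := intervalIntegral.integral_hasDerivAt_right (a := 0) (b := 1)
    (ContinuousOn.intervalIntegrable (hf.mono fun τ hτ => ?_))
    (hf.stronglyMeasurableAtFilter hO 1 h1O) (hf.continuousAt (hO.mem_nhds h1O))
  · have h4 : (fun t : ℝ => radialMean β v (t • x) * t ^ (β + 1)) =ᶠ[𝓝 1]
        fun t => ∫ τ in (0 : ℝ)..t, τ ^ β * v (τ • x) := by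
      filter_upwards [lt_mem_nhds one_pos] with t ht using radialMean_smul_mul x ht
    have h5 := h2.unique (h3.congr_of_eventuallyEq h4)
    simp at h5
    linarith
  · rw [uIcc_of_le zero_le_one] at hτ
    exact smul_mem_ball_of_mem hx hτ

end RadialMean

variable [Nontrivial E]

/-- The solution of `Δ w = -v` in the unit ball with zero boundary values, for `v` harmonic and
bounded. -/
theorem exists_laplacian_eq_neg (hd : 2 ≤ finrank ℝ E) {v : E → ℝ}
    (hv : HarmonicOnNhd v (ball 0 1)) {M : ℝ} (hM : ∀ x ∈ ball (0 : E) 1, |v x| ≤ M) :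
    ∃ w : E → ℝ, ContDiffOn ℝ 2 w (ball 0 1) ∧ (∀ x ∈ ball (0 : E) 1, (Δ w) x = -v x) ∧
      ∀ y ∈ sphere (0 : E) 1, Tendsto w (𝓝[ball 0 1] y) (𝓝 0) := by
  have hd' : (2 : ℝ) ≤ (finrank ℝ E : ℝ) := by exact_mod_cast hd
  set β : ℝ := (finrank ℝ E : ℝ) / 2 - 1 with hβ
  have hβ0 : 0 ≤ β := by linarith
  have hφ := harmonicOnNhd_radialMean hβ0 hv
  -- For `w = (1 - ‖x‖²) φ / 4` with `φ` harmonic, `Δ w = -(d / 2) φ - ⟨x, ∇ φ⟩`. This equals `-v`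
  -- exactly when `⟨x, ∇ φ⟩ + (d / 2) φ = v`, which the radial mean with `β + 1 = d / 2` solves. The
  -- factor `1 - ‖x‖²` and the boundedness of `φ` give zero boundary values.
  refine ⟨fun x => (1 / 4 - 1 / 4 * ‖x - 0‖ ^ 2) * radialMean β v x, ?_, fun x hx => ?_,
    fun y hy => ?_⟩
  · refine ContDiffOn.mul ?_ hφ.contDiffOn
    simp only [sub_zero]
    exact (contDiff_const.sub (contDiff_const.mul (contDiff_norm_sq ℝ))).contDiffOn
  · obtain ⟨A, hA⟩ := (hφ x hx).1.hasHessianAt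
    have he : ∀ᶠ t in 𝓝 (‖x - 0‖ ^ 2),
        HasDerivAt (fun t : ℝ => 1 / 4 - 1 / 4 * t) (-(1 / 4 * 1)) t :=
      Eventually.of_forall fun t => ((hasDerivAt_id t).const_mul (1 / 4)).const_sub (1 / 4)
    have h1 := (hasHessianAt_radial he (hasDerivAt_const _ _)).laplacian_mul hA
    rw [laplacian_radial he (hasDerivAt_const _ _), (hφ x hx).2.self_of_nhds, inner_smul_left,
      real_inner_comm, inner_gradient, sub_zero, fderiv_radialMean_apply hβ0 hv hx] at h1
    rw [h1]
    simp [hβ]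
    ring
  · have h1 : Tendsto (fun x : E => (1 / 4 - 1 / 4 * ‖x - 0‖ ^ 2)) (𝓝[ball 0 1] y) (𝓝 0) := by
      have : Continuous fun x : E => (1 / 4 - 1 / 4 * ‖x - 0‖ ^ 2) := by fun_prop
      have h := (this.tendsto y).mono_left (nhdsWithin_le_nhds (s := ball 0 1))
      rw [mem_sphere_zero_iff_norm] at hy
      simpa [hy] using h
    refine h1.zero_mul_isBoundedUnder_le ⟨M, ?_⟩
    rw [eventually_map]
    filter_upwards [self_mem_nhdsWithin] with x hx using abs_radialMean_le hβ0 hM hx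

/-- The biharmonic sheaf of a finite-dimensional inner product space. -/
def biharmonicSheaf (U : Set E) (h k : E → ℝ) : Prop :=
  ContDiffOn ℝ 2 h U ∧ ContDiffOn ℝ 2 k U ∧ ∀ x ∈ U, (Δ h) x = -k x ∧ (Δ k) x = 0

theorem biharmonicSheaf.harmonic {U : Set E} (hU : IsOpen U) {h k : E → ℝ}
    (H : biharmonicSheaf U h k) : HarmonicOnNhd k U :=
  (harmonicOnNhd_iff hU).2 ⟨H.2.1, fun x hx => (H.2.2 x hx).2⟩

theorem biharmonicSheaf_of_harmonic {U : Set E} (hU : IsOpen U) {h : E → ℝ}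
    (hh : HarmonicOnNhd h U) : biharmonicSheaf U h 0 := by
  rw [harmonicOnNhd_iff hU] at hh
  exact ⟨hh.1, contDiffOn_const, fun x hx => ⟨by simp [hh.2 x hx], by
    rw [show (0 : E → ℝ) = fun _ => 0 from rfl, laplacian_const]; rfl⟩⟩

variable [MeasurableSpace E] [BorelSpace E]

theorem abs_poissonOn_le {a : E} {R : ℝ} (hR : 0 < R) {f : E → ℝ}
    (hf : ContinuousOn f (sphere a R)) {M : ℝ} (hM : ∀ x ∈ sphere a R, |f x| ≤ M) {x : E}
    (hx : x ∈ ball a R) : |poissonOn a R f x| ≤ M := by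
  have hh := harmonicOnNhd_poissonOn hR
    (integrableOn_sphere (continuousOn_comp_add_smul hR hf))
  have hh' := (harmonicOnNhd_iff isOpen_ball).1 hh
  have hfr : frontier (ball a R) = sphere a R := frontier_ball _ hR.ne'
  have hlim : ∀ y ∈ frontier (ball a R), Tendsto (poissonOn a R f) (𝓝[ball a R] y) (𝓝 (f y)) :=
    fun y hy => tendsto_poissonOn hR hf (hfr ▸ hy)
  rw [abs_le]
  constructor
  · exact le_of_laplacian_le isOpen_ball isBounded_ball contDiffOn_const hh'.1
      (fun z hz => by rw [hh'.2 z hz, laplacian_const]; rfl) (fun y _ => tendsto_const_nhds) hlim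
      (fun y hy => (abs_le.1 (hM y (hfr ▸ hy))).1) x hx
  · exact le_of_laplacian_le isOpen_ball isBounded_ball hh'.1 contDiffOn_const
      (fun z hz => by rw [hh'.2 z hz, laplacian_const]; rfl) hlim (fun y _ => tendsto_const_nhds)
      (fun y hy => (abs_le.1 (hM y (hfr ▸ hy))).2) x hx

/-- The system is triangular: `v` is the Poisson integral of `g`, and `u` is the Poisson integral of
`f` plus a corrector vanishing on the boundary. The factor `R ^ 2` compensates the scaling of the
Laplacian when the corrector is transported from the unit ball. -/
theorem exists_isRiquierSolution_ball (hd : 2 ≤ finrank ℝ E) {a : E} {R : ℝ} (hR : 0 < R)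
    {f g : E → ℝ} (hf : ContinuousOn f (sphere a R)) (hg : ContinuousOn g (sphere a R)) :
    ∃ u v, IsRiquierSolution biharmonicSheaf (ball a R) f g u v := by
  have hfr : frontier (ball a R) = sphere a R := frontier_ball _ hR.ne'
  have hg' := continuousOn_comp_add_smul hR hg
  have hif := integrableOn_sphere (continuousOn_comp_add_smul hR hf)
  have hig := integrableOn_sphere hg'
  obtain ⟨M, hM⟩ := (isCompact_sphere (0 : E) 1).exists_bound_of_continuousOn hg'
  set v₀ := ballPoissonIntegral fun z => g (a + R • z) with hv₀
  have hv₀h : HarmonicOnNhd v₀ (ball 0 1) := harmonicOnNhd_ballPoissonIntegral hig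
  have hv₀M : ∀ x ∈ ball (0 : E) 1, |v₀ x| ≤ M := fun x hx => by
    have := abs_poissonOn_le (a := (0 : E)) one_pos hg' hM hx
    simpa [poissonOn] using this
  obtain ⟨w, hw1, hw2, hw3⟩ := exists_laplacian_eq_neg hd hv₀h hv₀M
  have haff : ∀ x, R⁻¹ • (x - a) = -(R⁻¹ • a) + R⁻¹ • x := fun x => by rw [smul_sub]; abel
  have hc : ContDiffOn ℝ 2 (fun x => w (R⁻¹ • (x - a))) (ball a R) :=
    hw1.comp (by fun_prop) fun x hx => inv_smul_sub_mem_ball hR hx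
  have hc' : ContDiffOn ℝ 2 (R ^ 2 • fun x => w (R⁻¹ • (x - a))) (ball a R) :=
    contDiffOn_const.smul hc
  have hPf := (harmonicOnNhd_iff isOpen_ball).1 (harmonicOnNhd_poissonOn hR hif)
  have hPg := (harmonicOnNhd_iff isOpen_ball).1 (harmonicOnNhd_poissonOn hR hig)
  refine ⟨poissonOn a R f + R ^ 2 • fun x => w (R⁻¹ • (x - a)), poissonOn a R g,
    ⟨hPf.1.add hc', hPg.1, fun x hx => ⟨?_, hPg.2 x hx⟩⟩, fun y hy => ⟨?_, ?_⟩⟩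
  · have hn := isOpen_ball.mem_nhds hx
    rw [(hPf.1.contDiffAt hn).laplacian_add (hc'.contDiffAt hn), hPf.2 x hx, zero_add,
      laplacian_smul _ (hc.contDiffAt hn)]
    have hx' := inv_smul_sub_mem_ball hR hx
    have h1 := laplacian_comp_affine (f := w) (a := -(R⁻¹ • a)) (x := x) (s := R⁻¹)
      (by rw [← haff]; exact hw1.contDiffAt (isOpen_ball.mem_nhds hx'))
    simp_rw [← haff] at h1
    rw [h1, hw2 _ hx', smul_eq_mul, ← mul_assoc, ← mul_pow, mul_inv_cancel₀ hR.ne', one_pow, one_mul]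
    rfl
  · rw [hfr] at hy
    have h1 := (tendsto_comp_inv_smul_sub hR (hw3 _ (inv_smul_sub_mem_sphere hR hy))).const_smul
      (R ^ 2)
    have h2 := (tendsto_poissonOn hR hf hy).add h1
    rw [smul_zero, add_zero] at h2
    exact h2
  · exact tendsto_poissonOn hR hg (hfr ▸ hy)

/-- The minimum principle is used twice: first for the harmonic second components, whose order `v ≤
v'` then gives `Δ u' ≤ Δ u`. Uniqueness and positivity of Riquier solutions both follow. -/
theorem IsRiquierSolution.mono {ω : Set E} (ho : IsOpen ω) (hb : Bornology.IsBounded ω)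
    {f g f' g' u v u' v' : E → ℝ} (h : IsRiquierSolution biharmonicSheaf ω f g u v)
    (h' : IsRiquierSolution biharmonicSheaf ω f' g' u' v')
    (hle : ∀ y ∈ frontier ω, f y ≤ f' y ∧ g y ≤ g' y) : ∀ x ∈ ω, u x ≤ u' x ∧ v x ≤ v' x := by
  have hv : ∀ x ∈ ω, v x ≤ v' x := le_of_laplacian_le ho hb h.1.2.1 h'.1.2.1
    (fun x hx => by rw [(h.1.2.2 x hx).2, (h'.1.2.2 x hx).2]) (fun y hy => (h.2 y hy).2)
    (fun y hy => (h'.2 y hy).2) fun y hy => (hle y hy).2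
  refine fun x hx => ⟨?_, hv x hx⟩
  exact le_of_laplacian_le ho hb h.1.1 h'.1.1
    (fun x hx => by rw [(h.1.2.2 x hx).1, (h'.1.2.2 x hx).1]; linarith [hv x hx])
    (fun y hy => (h.2 y hy).1) (fun y hy => (h'.2 y hy).1) (fun y hy => (hle y hy).1) x hx

theorem isRiquierSolution_zero {ω : Set E} (ho : IsOpen ω) :
    IsRiquierSolution (biharmonicSheaf (E := E)) ω 0 0 0 0 :=
  ⟨biharmonicSheaf_of_harmonic ho (harmonicOnNhd_const 0), fun _ _ =>
    ⟨tendsto_const_nhds, tendsto_const_nhds⟩⟩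

theorem isBiharmonicRegular_ball (hd : 2 ≤ finrank ℝ E) (a : E) {R : ℝ} (hR : 0 < R) :
    IsBiharmonicRegular biharmonicSheaf (ball a R) where
  isOpen := isOpen_ball
  isCompact_closure := isBounded_ball.isCompact_closure
  exists_solution f g hf hg := by
    rw [frontier_ball _ hR.ne'] at hf hg
    exact exists_isRiquierSolution_ball hd hR hf hg
  unique f g _ _ u v u' v' h h' := by
    have h1 := h.mono isOpen_ball isBounded_ball h' fun _ _ => ⟨le_rfl, le_rfl⟩
    have h2 := h'.mono isOpen_ball isBounded_ball h fun _ _ => ⟨le_rfl, le_rfl⟩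
    exact ⟨fun x hx => le_antisymm (h1 x hx).1 (h2 x hx).1,
      fun x hx => le_antisymm (h1 x hx).2 (h2 x hx).2⟩
  nonneg f g _ _ h0 u v h := (isRiquierSolution_zero isOpen_ball).mono isOpen_ball isBounded_ball h h0

end Riquier

/-! ### Positive functionals and measures -/

section Measures

variable {X : Type*} [TopologicalSpace X] [MeasurableSpace X] [BorelSpace X]

/-- The Riesz representation theorem for functionals on the functions continuous on a compact
set. -/
theorem exists_measure_of_positive [T2Space X] {S : Set X} (hS : IsCompact S)
    (Λ : (X → ℝ) → ℝ)
    (hadd : ∀ f g, ContinuousOn f S → ContinuousOn g S → Λ (f + g) = Λ f + Λ g)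
    (hsmul : ∀ (c : ℝ) f, ContinuousOn f S → Λ (c • f) = c * Λ f)
    (hpos : ∀ f, ContinuousOn f S → (∀ y ∈ S, 0 ≤ f y) → 0 ≤ Λ f) :
    ∃ μ : Measure X, IsFiniteMeasure μ ∧ μ Sᶜ = 0 ∧
      ∀ f, ContinuousOn f S → Λ f = ∫ y in S, f y ∂μ := by
  -- Positivity applied to `f - g` and `g - f`, both zero on `S`, shows that `Λ` sees only values on
  -- `S`. It therefore descends to functions on the subtype, extended by zero.
  have hcongr : ∀ f g, ContinuousOn f S → ContinuousOn g S → EqOn f g S → Λ f = Λ g := by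
    intro f g hf hg hfg
    have h1 := hpos (f + (-1 : ℝ) • g) (hf.add (hg.const_smul (-1 : ℝ)))
      fun y hy => by simp [hfg hy]
    have h2 := hpos (g + (-1 : ℝ) • f) (hg.add (hf.const_smul (-1 : ℝ)))
      fun y hy => by simp [hfg hy]
    rw [hadd _ _ hf (hg.const_smul (-1 : ℝ)), hsmul _ _ hg] at h1
    rw [hadd _ _ hg (hf.const_smul (-1 : ℝ)), hsmul _ _ hf] at h2
    linarith
  have : CompactSpace S := isCompact_iff_compactSpace.1 hS
  let e : CompactlySupportedContinuousMap S ℝ → X → ℝ := fun g => Function.extend Subtype.val g 0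
  have he : ∀ g (y : S), e g y = g y := fun g y => Subtype.val_injective.extend_apply _ _ _
  have hec : ∀ g, ContinuousOn (e g) S := fun g => by
    rw [continuousOn_iff_continuous_domRestrict]
    convert g.continuous using 1
    ext y
    exact he g y
  let L : CompactlySupportedContinuousMap S ℝ →ₗ[ℝ] ℝ :=
    { toFun := fun g => Λ (e g)
      map_add' := fun f g => by
        rw [← hadd _ _ (hec f) (hec g)]
        refine hcongr _ _ (hec _) ((hec f).add (hec g)) fun y hy => ?_
        simp [he _ ⟨y, hy⟩]
      map_smul' := fun c f => by
        rw [RingHom.id_apply, smul_eq_mul, ← hsmul _ _ (hec f)]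
        refine hcongr _ _ (hec _) ((hec f).const_smul c) fun y hy => ?_
        simp [he _ ⟨y, hy⟩] }
  let P : CompactlySupportedContinuousMap S ℝ →ₚ[ℝ] ℝ := PositiveLinearMap.mk₀ L fun f hf =>
    hpos _ (hec f) fun y hy => by
      rw [he f ⟨y, hy⟩]
      exact hf ⟨y, hy⟩
  have hemb : MeasurableEmbedding (Subtype.val : S → X) := .subtype_coe hS.measurableSet
  have h0 : (RealRMK.rieszMeasure P).map Subtype.val Sᶜ = 0 := by
    rw [hemb.map_apply, show (Subtype.val : S → X) ⁻¹' Sᶜ = ∅ by ext y; simp]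
    simp
  refine ⟨(RealRMK.rieszMeasure P).map Subtype.val, inferInstance, h0, fun f hf => ?_⟩
  rw [Measure.restrict_eq_self_of_ae_mem (mem_ae_iff.2 h0),
    hemb.integral_map]
  let g : CompactlySupportedContinuousMap S ℝ :=
    ⟨⟨fun y => f y, continuousOn_iff_continuous_domRestrict.1 hf⟩, HasCompactSupport.of_compactSpace _⟩
  have h1 : P g = ∫ y, g y ∂ RealRMK.rieszMeasure P := (RealRMK.integral_rieszMeasure P g).symm
  rw [show (∫ y : S, f y ∂ RealRMK.rieszMeasure P) = ∫ y, g y ∂ RealRMK.rieszMeasure P from rfl, ← h1]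
  exact hcongr _ _ hf (hec g) fun y hy => (he g ⟨y, hy⟩).symm

/-! ### Extended integrals -/

theorem extIntegral_coe {μ : Measure X} {S : Set X} (hS : MeasurableSet S) {f : X → ℝ}
    (hf : IntegrableOn f S μ) {u : X → EReal} (hu : ∀ y ∈ S, u y = (f y : EReal)) :
    extIntegral μ S u = ((∫ y in S, f y ∂μ : ℝ) : EReal) := by
  have h1 : ∫⁻ y in S, (u y).toENNReal ∂μ = ∫⁻ y in S, ENNReal.ofReal (f y) ∂μ :=
    setLIntegral_congr_fun hS fun y hy => by
      show (u y).toENNReal = _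
      rw [hu y hy, EReal.real_coe_toENNReal]
  have h2 : ∫⁻ y in S, (-u y).toENNReal ∂μ = ∫⁻ y in S, ENNReal.ofReal (-f y) ∂μ :=
    setLIntegral_congr_fun hS fun y hy => by
      show (-u y).toENNReal = _
      rw [hu y hy, ← EReal.coe_neg, EReal.real_coe_toENNReal]
  rw [extIntegral, h1, h2, integral_eq_lintegral_pos_part_sub_lintegral_neg_part hf,
    EReal.coe_sub, EReal.coe_ennreal_toReal hf.lintegral_lt_top.ne,
    EReal.coe_ennreal_toReal (x := ∫⁻ y in S, ENNReal.ofReal (-f y) ∂μ)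
      hf.neg.lintegral_lt_top.ne]

/-- The measure `μ` with density `w / c`. -/
def scaledMeasure (μ : Measure X) (w : X → ℝ) (c : ℝ) : Measure X :=
  μ.withDensity fun y => ENNReal.ofReal (w y / c)

/-! ### Measures with a continuous density -/

section Scaled

variable {μ : Measure X} {w : X → ℝ} {c : ℝ} {S : Set X}

theorem measurable_density (hw : Continuous w) :
    Measurable fun y => ENNReal.ofReal (w y / c) :=
  (hw.div_const c).measurable.ennreal_ofReal

theorem isFiniteMeasure_scaledMeasure [IsFiniteMeasure μ] (hw : Continuous w)
    (hS : IsCompact S) (hSm : MeasurableSet S) (h0 : μ Sᶜ = 0) :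
    IsFiniteMeasure (scaledMeasure μ w c) := by
  refine isFiniteMeasure_withDensity_ofReal ?_
  rw [← Measure.restrict_eq_self_of_ae_mem (mem_ae_iff.2 h0)]
  exact ((hw.div_const c).continuousOn.integrableOn_compact' hS hSm).hasFiniteIntegral

theorem scaledMeasure_compl (h0 : μ Sᶜ = 0) : scaledMeasure μ w c Sᶜ = 0 :=
  withDensity_absolutelyContinuous μ _ h0

theorem setIntegral_scaledMeasure (hw : Continuous w) (hw0 : ∀ y, 0 ≤ w y) (hc : 0 < c)
    (hS : MeasurableSet S) (f : X → ℝ) :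
    ∫ y in S, f y ∂scaledMeasure μ w c = (∫ y in S, w y * f y ∂μ) / c := by
  rw [scaledMeasure, restrict_withDensity hS, integral_withDensity_eq_integral_toReal_smul
    (measurable_density hw) (Eventually.of_forall fun y => ENNReal.ofReal_lt_top), ← integral_div]
  congr 1
  ext y
  rw [ENNReal.toReal_ofReal (div_nonneg (hw0 y) hc.le), smul_eq_mul]
  ring

/-- No measurability of `u` is required: the density is measurable and finite, which suffices to
pull it out of the lower integrals of the positive and negative parts. -/
theorem extIntegral_scaledMeasure (hw : Continuous w) (hw0 : ∀ y, 0 ≤ w y) (hc : 0 < c)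
    (hS : MeasurableSet S) (u : X → EReal) :
    (c : EReal) * extIntegral (scaledMeasure μ w c) S u =
      extIntegral μ S fun y => (w y : EReal) * u y := by
  have h : ∀ v : X → EReal, ENNReal.ofReal c * ∫⁻ y in S, (v y).toENNReal ∂scaledMeasure μ w c =
      ∫⁻ y in S, ((w y : EReal) * v y).toENNReal ∂μ := by
    intro v
    rw [scaledMeasure, restrict_withDensity hS, lintegral_withDensity_eq_lintegral_mul_non_measurable
      _ (measurable_density hw) (Eventually.of_forall fun y => ENNReal.ofReal_lt_top),
      ← lintegral_const_mul' _ _ ENNReal.ofReal_ne_top]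
    congr 1
    ext y
    rw [Pi.mul_apply, EReal.toENNReal_mul (by exact_mod_cast hw0 y), EReal.real_coe_toENNReal,
      ← mul_assoc, ← ENNReal.ofReal_mul hc.le, mul_div_cancel₀ _ hc.ne']
  have hc' : ((ENNReal.ofReal c : ENNReal) : EReal) = (c : EReal) := by
    rw [EReal.coe_ennreal_ofReal, max_eq_left hc.le]
  rw [extIntegral, sub_eq_add_neg, EReal.left_distrib_of_nonneg_of_ne_top
    (by exact_mod_cast hc.le) (EReal.coe_ne_top c), mul_comm _ (-_), EReal.neg_mul,
    mul_comm _ (c : EReal), ← hc', ← EReal.coe_ennreal_mul, ← EReal.coe_ennreal_mul, h,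
    h fun y => -u y, extIntegral, sub_eq_add_neg]
  congr 5
  ext y
  rw [mul_comm, EReal.neg_mul, mul_comm]

end Scaled

theorem lowerSemicontinuousOn_coe_mul {w : X → ℝ} (hw : Continuous w) (hw0 : ∀ y, 0 < w y)
    {U : Set X} {u : X → EReal} (hu : LowerSemicontinuousOn u U) :
    LowerSemicontinuousOn (fun y => (w y : EReal) * u y) U := by
  intro x hx t ht
  -- Truncating `u` at the level `u x` turns lower semicontinuity into convergence, so that
  -- continuity of multiplication at `(w x, u x)` applies; the truncation only lowers the product.
  have h1 : Tendsto (fun y => min (u y) (u x)) (𝓝[U] x) (𝓝 (u x)) := by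
    refine tendsto_order.2 ⟨fun a ha => ?_, fun a ha => ?_⟩
    · filter_upwards [hu x hx a ha] with y hy using lt_min hy ha
    · exact Eventually.of_forall fun y => (min_le_right _ _).trans_lt ha
  have h2 : Tendsto (fun y => ((w y : ℝ) : EReal)) (𝓝[U] x) (𝓝 (w x : EReal)) :=
    ((continuous_coe_real_ereal.comp hw).tendsto x).mono_left nhdsWithin_le_nhds
  have hwx : (w x : EReal) ≠ 0 := by exact_mod_cast (hw0 x).ne'
  have h3 := (EReal.continuousAt_mul (p := ((w x : EReal), u x)) (Or.inl hwx) (Or.inl hwx)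
    (Or.inl (EReal.coe_ne_bot _)) (Or.inl (EReal.coe_ne_top _))).tendsto.comp
    (h2.prodMk_nhds h1)
  filter_upwards [h3.eventually (lt_mem_nhds ht)] with y hy
  refine hy.trans_le ?_
  have hwy : (0 : EReal) ≤ (w y : EReal) := by exact_mod_cast (hw0 y).le
  exact mul_le_mul_of_nonneg_left (min_le_left _ _) hwy

end Measures

/-! ### Renormalization -/

section Renormalized

variable {X : Type*} [TopologicalSpace X] {H : Set X → (X → ℝ) → (X → ℝ) → Prop}
  {p q : X → ℝ}

theorem IsRiquierSolution.of_renormalized (hp : Continuous p) (hq : Continuous q) {ω : Set X}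
    {f g u v : X → ℝ} (h : IsRiquierSolution (renormalized H p q) ω f g u v) :
    IsRiquierSolution H ω (fun x => p x * f x) (fun x => q x * g x) (fun x => p x * u x)
      (fun x => q x * v x) :=
  ⟨h.1.2.2, fun y hy => ⟨((hp.tendsto y).mono_left nhdsWithin_le_nhds).mul (h.2 y hy).1,
    ((hq.tendsto y).mono_left nhdsWithin_le_nhds).mul (h.2 y hy).2⟩⟩

theorem IsBiharmonicRegular.renormalized
    (hH : ∀ U, IsOpen U → ∀ u v, H U u v → ContinuousOn u U ∧ ContinuousOn v U)
    (hp : Continuous p) (hq : Continuous q) (hp0 : ∀ x, 0 < p x) (hq0 : ∀ x, 0 < q x) {ω : Set X}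
    (h : IsBiharmonicRegular H ω) : IsBiharmonicRegular (renormalized H p q) ω where
  isOpen := h.isOpen
  isCompact_closure := h.isCompact_closure
  exists_solution f g hf hg := by
    obtain ⟨u, v, huv⟩ := h.exists_solution _ _ (hp.continuousOn.mul hf) (hq.continuousOn.mul hg)
    have hc := hH ω h.isOpen u v huv.1
    refine ⟨fun x => u x / p x, fun x => v x / q x, ⟨?_, ?_, ?_⟩, fun y hy => ⟨?_, ?_⟩⟩
    · exact hc.1.div hp.continuousOn fun x _ => (hp0 x).ne'
    · exact hc.2.div hq.continuousOn fun x _ => (hq0 x).ne'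
    · simpa only [mul_div_cancel₀ _ (hp0 _).ne', mul_div_cancel₀ _ (hq0 _).ne'] using huv.1
    · have := (huv.2 y hy).1.div ((hp.tendsto y).mono_left nhdsWithin_le_nhds) (hp0 y).ne'
      rwa [Pi.mul_apply, mul_div_cancel_left₀ _ (hp0 y).ne'] at this
    · have := (huv.2 y hy).2.div ((hq.tendsto y).mono_left nhdsWithin_le_nhds) (hq0 y).ne'
      rwa [Pi.mul_apply, mul_div_cancel_left₀ _ (hq0 y).ne'] at this
  unique f g hf hg u v u' v' h1 h2 := by
    have h3 := h.unique _ _ (hp.continuousOn.mul hf) (hq.continuousOn.mul hg) _ _ _ _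
      (h1.of_renormalized hp hq) (h2.of_renormalized hp hq)
    exact ⟨fun x hx => mul_left_cancel₀ (hp0 x).ne' (h3.1 hx),
      fun x hx => mul_left_cancel₀ (hq0 x).ne' (h3.2 hx)⟩
  nonneg f g hf hg h0 u v h1 x hx := by
    have h3 := h.nonneg _ _ (hp.continuousOn.mul hf) (hq.continuousOn.mul hg)
      (fun y hy => ⟨mul_nonneg (hp0 y).le (h0 y hy).1, mul_nonneg (hq0 y).le (h0 y hy).2⟩) _ _
      (h1.of_renormalized hp hq) x hx
    exact ⟨nonneg_of_mul_nonneg_right h3.1 (hp0 x), nonneg_of_mul_nonneg_right h3.2 (hq0 x)⟩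

variable [MeasurableSpace X] [BorelSpace X]

/-- The representation of `p u` and `q v` at `x` is divided by `p x` and `q x`. The mixed measure
`ν` carries data `q g` into the first component, hence its density `q / p x`. -/
theorem IsBiharmonicMeasures.renormalized (hp : Continuous p) (hq : Continuous q)
    (hp0 : ∀ x, 0 < p x) (hq0 : ∀ x, 0 < q x) {ω : Set X} (hω : IsCompact (frontier ω)) {x : X}
    {μ ν τ : Measure X} (h : IsBiharmonicMeasures H ω x μ ν τ) :
    IsBiharmonicMeasures (renormalized H p q) ω x (scaledMeasure μ p (p x))
      (scaledMeasure ν q (p x)) (scaledMeasure τ q (q x)) where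
  finite := by
    obtain ⟨h1, h2, h3⟩ := h.finite
    have hS := isClosed_frontier (s := ω).measurableSet
    exact ⟨isFiniteMeasure_scaledMeasure hp hω hS h.concentrated.1,
      isFiniteMeasure_scaledMeasure hq hω hS h.concentrated.2.1,
      isFiniteMeasure_scaledMeasure hq hω hS h.concentrated.2.2⟩
  concentrated := ⟨scaledMeasure_compl h.concentrated.1, scaledMeasure_compl h.concentrated.2.1,
    scaledMeasure_compl h.concentrated.2.2⟩
  repr f g u v hf hg huv := by
    have h1 := h.repr _ _ _ _ (hp.continuousOn.mul hf) (hq.continuousOn.mul hg)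
      (huv.of_renormalized hp hq)
    have hS := isClosed_frontier (s := ω).measurableSet
    rw [setIntegral_scaledMeasure hp (fun y => (hp0 y).le) (hp0 x) hS,
      setIntegral_scaledMeasure hq (fun y => (hq0 y).le) (hp0 x) hS,
      setIntegral_scaledMeasure hq (fun y => (hq0 y).le) (hq0 x) hS, ← add_div,
      eq_div_iff (hp0 x).ne', eq_div_iff (hq0 x).ne', mul_comm, mul_comm (v x)]
    exact h1

theorem EReal.coe_mul_le_coe_mul_iff {c : ℝ} (hc : 0 < c) {a b : EReal} :
    (c : EReal) * a ≤ (c : EReal) * b ↔ a ≤ b := by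
  refine ⟨fun h => ?_, fun h => mul_le_mul_of_nonneg_left h (by exact_mod_cast hc.le)⟩
  have h1 := mul_le_mul_of_nonneg_left h
    (by exact_mod_cast (inv_pos.2 hc).le : (0 : EReal) ≤ ((c⁻¹ : ℝ) : EReal))
  rwa [← mul_assoc, ← mul_assoc, ← EReal.coe_mul, inv_mul_cancel₀ hc.ne', EReal.coe_one, one_mul,
    one_mul] at h1

/-- Every regular set of `H` with its measures yields one of the renormalized sheaf; multiplying the
inequalities there by `p x` and `q x` gives those for `H`. -/
theorem IsHyperharmonicPair.of_renormalized
    (hH : ∀ U, IsOpen U → ∀ u v, H U u v → ContinuousOn u U ∧ ContinuousOn v U)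
    (hp : Continuous p) (hq : Continuous q) (hp0 : ∀ x, 0 < p x) (hq0 : ∀ x, 0 < q x) {U : Set X}
    {u v : X → EReal} (h : IsHyperharmonicPair (renormalized H p q) U u v) :
    IsHyperharmonicPair H U (fun x => (p x : EReal) * u x) (fun x => (q x : EReal) * v x) where
  lsc := ⟨lowerSemicontinuousOn_coe_mul hp hp0 h.lsc.1, lowerSemicontinuousOn_coe_mul hq hq0 h.lsc.2⟩
  ne_bot x hx := by
    have h1 : ∀ {c : ℝ} {a : EReal}, 0 < c → a ≠ ⊥ → (c : EReal) * a ≠ ⊥ := by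
      intro c a hc ha
      induction a with
      | bot => exact absurd rfl ha
      | coe r => rw [← EReal.coe_mul]; exact EReal.coe_ne_bot _
      | top => rw [EReal.coe_mul_top_of_pos hc]; exact top_ne_bot
    exact ⟨h1 (hp0 x) (h.ne_bot x hx).1, h1 (hq0 x) (h.ne_bot x hx).2⟩
  le ω hω hωU x hx μ ν τ hm := by
    have hS : IsCompact (frontier ω) :=
      hω.isCompact_closure.of_isClosed_subset isClosed_frontier frontier_subset_closure
    have hSm := isClosed_frontier (s := ω).measurableSet
    have h1 := h.le ω (hω.renormalized hH hp hq hp0 hq0) hωU x hx _ _ _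
      (hm.renormalized hp hq hp0 hq0 hS)
    rw [← extIntegral_scaledMeasure hp (fun y => (hp0 y).le) (hp0 x) hSm,
      ← extIntegral_scaledMeasure hq (fun y => (hq0 y).le) (hp0 x) hSm,
      ← extIntegral_scaledMeasure hq (fun y => (hq0 y).le) (hq0 x) hSm,
      ← EReal.left_distrib_of_nonneg_of_ne_top (by exact_mod_cast (hp0 x).le) (EReal.coe_ne_top _),
      EReal.coe_mul_le_coe_mul_iff (hp0 x), EReal.coe_mul_le_coe_mul_iff (hq0 x)]
    exact h1

/-- Since renormalization by the inverse weights undoes the first one, `of_renormalized` also yields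
the converse implication. -/
theorem renormalized_renormalized_inv (hH : ∀ U u v, H U u v → ContinuousOn u U ∧ ContinuousOn v U)
    (hp : Continuous p) (hq : Continuous q) (hp0 : ∀ x, 0 < p x) (hq0 : ∀ x, 0 < q x) :
    renormalized (renormalized H p q) p⁻¹ q⁻¹ = H := by
  funext U u v
  have h1 : (fun x => p x * (p⁻¹ x * u x)) = u := by
    ext x; simp [(hp0 x).ne']
  have h2 : (fun x => q x * (q⁻¹ x * v x)) = v := by
    ext x; simp [(hq0 x).ne']
  refine propext ⟨fun h => ?_, fun h => ⟨(hH U u v h).1, (hH U u v h).2, ?_, ?_, ?_⟩⟩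
  · simpa only [h1, h2] using h.2.2.2.2
  · exact (hp.inv₀ fun x => (hp0 x).ne').continuousOn.mul (hH U u v h).1
  · exact (hq.inv₀ fun x => (hq0 x).ne').continuousOn.mul (hH U u v h).2
  · simpa only [h1, h2] using h

theorem isHyperharmonicPair_renormalized_iff
    (hH : ∀ U u v, H U u v → ContinuousOn u U ∧ ContinuousOn v U)
    (hp : Continuous p) (hq : Continuous q) (hp0 : ∀ x, 0 < p x) (hq0 : ∀ x, 0 < q x) {U : Set X}
    {u v : X → EReal} : IsHyperharmonicPair (renormalized H p q) U u v ↔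
      IsHyperharmonicPair H U (fun x => (p x : EReal) * u x) (fun x => (q x : EReal) * v x) := by
  refine ⟨fun h => h.of_renormalized (fun U _ => hH U) hp hq hp0 hq0, fun h => ?_⟩
  have hinv : ∀ {w : X → ℝ} (_ : ∀ x, 0 < w x) (u : X → EReal),
      (fun x => ((w⁻¹ x : ℝ) : EReal) * ((w x : EReal) * u x)) = u := fun {w} hw0 u => by
    ext x
    rw [← mul_assoc, ← EReal.coe_mul, Pi.inv_apply, inv_mul_cancel₀ (hw0 x).ne', EReal.coe_one,
      one_mul]
  have h1 := IsHyperharmonicPair.of_renormalized (H := renormalized H p q) (p := p⁻¹) (q := q⁻¹)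
    (U := U) (fun U _ u v h => ⟨h.1, h.2.1⟩) (hp.inv₀ fun x => (hp0 x).ne')
    (hq.inv₀ fun x => (hq0 x).ne') (fun x => inv_pos.2 (hp0 x)) (fun x => inv_pos.2 (hq0 x))
    (u := fun x => (p x : EReal) * u x) (v := fun x => (q x : EReal) * v x)
    (by rwa [renormalized_renormalized_inv hH hp hq hp0 hq0])
  rwa [hinv hp0, hinv hq0] at h1

end Renormalized

/-! ### Existence of harmonic and biharmonic measures -/

section Associated

open InnerProductSpace Module Metric

theorem IsCompact.frontier_of_closure {X : Type*} [TopologicalSpace X] {ω : Set X}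
    (h : IsCompact (closure ω)) : IsCompact (frontier ω) :=
  h.of_isClosed_subset isClosed_frontier frontier_subset_closure

/-- Hyperharmonicity is a condition on all harmonic measures, so it has content only once such a
measure exists. -/
theorem IsHarmonicRegular.exists_isHarmonicMeasure {X : Type*} [TopologicalSpace X] [T2Space X]
    [MeasurableSpace X] [BorelSpace X] {K : Set X → (X → ℝ) → Prop} {ω : Set X}
    (h : IsHarmonicRegular K ω) (hadd : ∀ u u', K ω u → K ω u' → K ω (u + u'))
    (hsmul : ∀ (c : ℝ) u, K ω u → K ω (c • u)) {x : X} (hx : x ∈ ω) :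
    ∃ μ, IsHarmonicMeasure K ω x μ := by
  choose! s hs using h.exists_solution
  obtain ⟨μ, h1, h2, h3⟩ := exists_measure_of_positive h.isCompact_closure.frontier_of_closure
    (fun f => s f x)
    (fun f g hf hg => h.unique _ (hf.add hg) _ _ (hs _ (hf.add hg))
      ⟨hadd _ _ (hs f hf).1 (hs g hg).1, fun y hy => ((hs f hf).2 y hy).add ((hs g hg).2 y hy)⟩ hx)
    (fun c f hf => h.unique _ (hf.const_smul c) _ _ (hs _ (hf.const_smul c))
      ⟨hsmul c _ (hs f hf).1, fun y hy => ((hs f hf).2 y hy).const_smul c⟩ hx)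
    (fun f hf h0 => h.nonneg f hf h0 _ (hs f hf) x hx)
  exact ⟨μ, h1, h2, fun f u hf hu => (h.unique f hf _ _ hu (hs f hf) hx).trans (h3 f hf)⟩

variable {E : Type*} [NormedAddCommGroup E] [InnerProductSpace ℝ E] [FiniteDimensional ℝ E]

theorem biharmonicSheaf.continuousOn {U : Set E} {u v : E → ℝ} (h : biharmonicSheaf U u v) :
    ContinuousOn u U ∧ ContinuousOn v U :=
  ⟨h.1.continuousOn, h.2.1.continuousOn⟩

theorem biharmonicSheaf.add {U : Set E} (hU : IsOpen U) {u v u' v' : E → ℝ}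
    (h : biharmonicSheaf U u v) (h' : biharmonicSheaf U u' v') :
    biharmonicSheaf U (u + u') (v + v') := by
  refine ⟨h.1.add h'.1, h.2.1.add h'.2.1, fun x hx => ⟨?_, ?_⟩⟩
  · have hn := hU.mem_nhds hx
    rw [(h.1.contDiffAt hn).laplacian_add (h'.1.contDiffAt hn), (h.2.2 x hx).1, (h'.2.2 x hx).1,
      Pi.add_apply]
    ring
  · have hn := hU.mem_nhds hx
    rw [(h.2.1.contDiffAt hn).laplacian_add (h'.2.1.contDiffAt hn), (h.2.2 x hx).2,
      (h'.2.2 x hx).2, add_zero]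

theorem biharmonicSheaf.smul {U : Set E} (hU : IsOpen U) (c : ℝ) {u v : E → ℝ}
    (h : biharmonicSheaf U u v) : biharmonicSheaf U (c • u) (c • v) := by
  refine ⟨h.1.const_smul c, h.2.1.const_smul c, fun x hx => ⟨?_, ?_⟩⟩
  · rw [laplacian_smul c (h.1.contDiffAt (hU.mem_nhds hx)), (h.2.2 x hx).1]
    simp
  · rw [laplacian_smul c (h.2.1.contDiffAt (hU.mem_nhds hx)), (h.2.2 x hx).2, smul_zero]

variable [Nontrivial E]

theorem IsRiquierSolution.eqOn_snd {ω : Set E} (ho : IsOpen ω) (hb : Bornology.IsBounded ω)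
    {f f' g u v u' v' : E → ℝ} (h : IsRiquierSolution biharmonicSheaf ω f g u v)
    (h' : IsRiquierSolution biharmonicSheaf ω f' g u' v') : EqOn v v' ω := fun x hx => by
  refine le_antisymm ?_ ?_
  · exact le_of_laplacian_le ho hb h.1.2.1 h'.1.2.1
      (fun x hx => by rw [(h.1.2.2 x hx).2, (h'.1.2.2 x hx).2]) (fun y hy => (h.2 y hy).2)
      (fun y hy => (h'.2 y hy).2) (fun y _ => le_rfl) x hx
  · exact le_of_laplacian_le ho hb h'.1.2.1 h.1.2.1
      (fun x hx => by rw [(h.1.2.2 x hx).2, (h'.1.2.2 x hx).2]) (fun y hy => (h'.2 y hy).2)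
      (fun y hy => (h.2 y hy).2) (fun y _ => le_rfl) x hx

variable [MeasurableSpace E] [BorelSpace E]

/-- The data split as `(f, 0) + (0, g)`, and each of the three positive functionals is represented
separately. The second component of a solution does not depend on `f` by `eqOn_snd`, so a single
measure describes it. -/
theorem IsBiharmonicRegular.exists_isBiharmonicMeasures {ω : Set E}
    (h : IsBiharmonicRegular (biharmonicSheaf (E := E)) ω) {x : E} (hx : x ∈ ω) :
    ∃ μ ν τ, IsBiharmonicMeasures (biharmonicSheaf (E := E)) ω x μ ν τ := by
  have hb : Bornology.IsBounded ω := h.isCompact_closure.isBounded.subset subset_closure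
  have ho := h.isOpen
  have hS := h.isCompact_closure.frontier_of_closure
  have h0 : ContinuousOn (0 : E → ℝ) (frontier ω) := continuousOn_const
  have hadd : ∀ {f g u v f' g' u' v' : E → ℝ}, IsRiquierSolution biharmonicSheaf ω f g u v →
      IsRiquierSolution biharmonicSheaf ω f' g' u' v' →
      IsRiquierSolution biharmonicSheaf ω (f + f') (g + g') (u + u') (v + v') := fun h h' =>
    ⟨h.1.add ho h'.1, fun y hy => ⟨(h.2 y hy).1.add (h'.2 y hy).1, (h.2 y hy).2.add (h'.2 y hy).2⟩⟩
  have hsmul : ∀ (c : ℝ) {f g u v : E → ℝ}, IsRiquierSolution biharmonicSheaf ω f g u v →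
      IsRiquierSolution biharmonicSheaf ω (c • f) (c • g) (c • u) (c • v) := fun c _ _ _ _ h =>
    ⟨h.1.smul ho c, fun y hy => ⟨(h.2 y hy).1.const_smul c, (h.2 y hy).2.const_smul c⟩⟩
  choose! s t hst using h.exists_solution
  obtain ⟨μ, hμ1, hμ2, hμ3⟩ := exists_measure_of_positive hS (fun f => s f 0 x)
    (fun f g hf hg => (h.unique _ _ (hf.add hg) h0 _ _ _ _ (hst _ _ (hf.add hg) h0)
      (by simpa using hadd (hst f 0 hf h0) (hst g 0 hg h0))).1 hx)
    (fun c f hf => (h.unique _ _ (hf.const_smul c) h0 _ _ _ _ (hst _ _ (hf.const_smul c) h0)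
      (by simpa using hsmul c (hst f 0 hf h0))).1 hx)
    (fun f hf hf0 => (h.nonneg f 0 hf h0 (fun y hy => ⟨hf0 y hy, le_rfl⟩) _ _
      (hst f 0 hf h0) x hx).1)
  obtain ⟨ν, hν1, hν2, hν3⟩ := exists_measure_of_positive hS (fun f => s 0 f x)
    (fun f g hf hg => (h.unique _ _ h0 (hf.add hg) _ _ _ _ (hst _ _ h0 (hf.add hg))
      (by simpa using hadd (hst 0 f h0 hf) (hst 0 g h0 hg))).1 hx)
    (fun c f hf => (h.unique _ _ h0 (hf.const_smul c) _ _ _ _ (hst _ _ h0 (hf.const_smul c))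
      (by simpa using hsmul c (hst 0 f h0 hf))).1 hx)
    (fun f hf hf0 => (h.nonneg 0 f h0 hf (fun y hy => ⟨le_rfl, hf0 y hy⟩) _ _
      (hst 0 f h0 hf) x hx).1)
  obtain ⟨τ, hτ1, hτ2, hτ3⟩ := exists_measure_of_positive hS (fun f => t 0 f x)
    (fun f g hf hg => (h.unique _ _ h0 (hf.add hg) _ _ _ _ (hst _ _ h0 (hf.add hg))
      (by simpa using hadd (hst 0 f h0 hf) (hst 0 g h0 hg))).2 hx)
    (fun c f hf => (h.unique _ _ h0 (hf.const_smul c) _ _ _ _ (hst _ _ h0 (hf.const_smul c))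
      (by simpa using hsmul c (hst 0 f h0 hf))).2 hx)
    (fun f hf hf0 => (h.nonneg 0 f h0 hf (fun y hy => ⟨le_rfl, hf0 y hy⟩) _ _
      (hst 0 f h0 hf) x hx).2)
  refine ⟨μ, ν, τ, ⟨hμ1, hν1, hτ1⟩, ⟨hμ2, hν2, hτ2⟩, fun f g u v hf hg huv => ⟨?_, ?_⟩⟩
  · rw [← hμ3 f hf, ← hν3 g hg]
    exact (h.unique f g hf hg _ _ _ _ huv
      (by simpa using hadd (hst f 0 hf h0) (hst 0 g h0 hg))).1 hx
  · rw [← hτ3 g hg]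
    exact huv.eqOn_snd ho hb (hst 0 g h0 hg) hx

/-! ### The associated harmonic sheaves -/

theorem extIntegral_zero {X : Type*} [MeasurableSpace X] (μ : Measure X) (S : Set X) :
    extIntegral μ S (fun _ => 0) = 0 := by
  simp [extIntegral]

theorem LowerSemicontinuousOn.coe {U : Set E} {h : E → ℝ} (hc : ContinuousOn h U) :
    LowerSemicontinuousOn (fun x => (h x : EReal)) U :=
  (continuous_coe_real_ereal.comp_continuousOn hc).lowerSemicontinuousOn

theorem continuousOn_of_lowerSemicontinuousOn_coe {U : Set E} {h : E → ℝ}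
    (h1 : LowerSemicontinuousOn (fun x => (h x : EReal)) U)
    (h2 : LowerSemicontinuousOn (fun x => ((-h x : ℝ) : EReal)) U) : ContinuousOn h U := by
  refine fun x hx => tendsto_order.2 ⟨fun a ha => ?_, fun a ha => ?_⟩
  · filter_upwards [h1 x hx (a : EReal) (EReal.coe_lt_coe_iff.2 ha)] with y hy
    exact_mod_cast hy
  · filter_upwards [h2 x hx ((-a : ℝ) : EReal) (EReal.coe_lt_coe_iff.2 (neg_lt_neg ha))] with y hy
    exact neg_lt_neg_iff.1 (by exact_mod_cast hy)

theorem IsRiquierSolution.of_harmonic {ω U : Set E} (ho : IsOpen ω) (hωU : closure ω ⊆ U)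
    {h : E → ℝ} (hh : HarmonicOnNhd h U) : IsRiquierSolution biharmonicSheaf ω h 0 h 0 :=
  ⟨biharmonicSheaf_of_harmonic ho (hh.mono (subset_closure.trans hωU)), fun _ hy =>
    ⟨tendsto_nhdsWithin_of_continuousOn hh.continuousOn (subset_closure.trans hωU)
      (hωU (frontier_subset_closure hy)), tendsto_const_nhds⟩⟩

theorem isHyperharmonicPair_coe_zero {U : Set E} {h : E → ℝ} (hh : HarmonicOnNhd h U) :
    IsHyperharmonicPair (biharmonicSheaf (E := E)) U (fun x => (h x : EReal)) (fun _ => 0) where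
  lsc := ⟨.coe hh.continuousOn, lowerSemicontinuous_const.lowerSemicontinuousOn _⟩
  ne_bot x _ := ⟨EReal.coe_ne_bot _, EReal.zero_ne_bot⟩
  le ω hω hωU x hx μ ν τ hm := by
    have hS := hω.isCompact_closure.frontier_of_closure
    have hc : ContinuousOn h (frontier ω) :=
      hh.continuousOn.mono (frontier_subset_closure.trans hωU)
    have h1 : h x = (∫ y in frontier ω, h y ∂μ) + ∫ _ in frontier ω, (0 : ℝ) ∂ν :=
      (hm.repr _ _ _ _ hc continuousOn_const (.of_harmonic hω.isOpen hωU hh)).1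
    have := hm.finite.1
    rw [extIntegral_zero, extIntegral_zero, extIntegral_coe isClosed_frontier.measurableSet
      (hc.integrableOn_compact hS) fun _ _ => rfl, add_zero]
    rw [integral_zero, add_zero] at h1
    exact ⟨by rw [h1], le_rfl⟩

/-- The value `⊤` makes the first inequality automatic; only the harmonic measure of the second
component is tested. -/
theorem isHyperharmonicPair_top_coe {U : Set E} {k : E → ℝ} (hk : HarmonicOnNhd k U) :
    IsHyperharmonicPair (biharmonicSheaf (E := E)) U (fun _ => ⊤) (fun x => (k x : EReal)) where
  lsc := ⟨lowerSemicontinuous_const.lowerSemicontinuousOn _, .coe hk.continuousOn⟩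
  ne_bot x _ := ⟨top_ne_bot, EReal.coe_ne_bot _⟩
  le ω hω hωU x hx μ ν τ hm := by
    have hS := hω.isCompact_closure.frontier_of_closure
    have hb : Bornology.IsBounded ω := hω.isCompact_closure.isBounded.subset subset_closure
    have hc : ContinuousOn k (frontier ω) :=
      hk.continuousOn.mono (frontier_subset_closure.trans hωU)
    obtain ⟨u, v, huv⟩ := hω.exists_solution 0 k continuousOn_const hc
    have h1 := (hm.repr _ _ _ _ continuousOn_const hc huv).2
    have hvk : EqOn v k ω := eqOn_of_harmonic_of_tendsto hω.isOpen hb (huv.1.harmonic hω.isOpen)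
      (hk.mono (subset_closure.trans hωU)) (f := k) (fun y hy => (huv.2 y hy).2) fun y hy =>
        tendsto_nhdsWithin_of_continuousOn hk.continuousOn (subset_closure.trans hωU)
          (hωU (frontier_subset_closure hy))
    have := hm.finite.2.2
    rw [extIntegral_coe (μ := τ) isClosed_frontier.measurableSet (hc.integrableOn_compact hS)
      fun _ _ => rfl,
      ← h1, hvk hx]
    exact ⟨le_top, le_rfl⟩

/-- A function that is continuous and agrees with Poisson integrals of its values on small spheres
is harmonic. -/
theorem harmonicOnNhd_of_eqOn_poissonOn {U : Set E} (hU : IsOpen U) {h : E → ℝ}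
    (hi : ∀ a R, 0 < R → closedBall a R ⊆ U →
      IntegrableOn (fun z => h (a + R • z)) (sphere 0 1) (sphereMeasure E))
    (hp : ∀ a R, 0 < R → closedBall a R ⊆ U → EqOn h (poissonOn a R h) (ball a R)) :
    HarmonicOnNhd h U := by
  intro a ha
  obtain ⟨R, hR, hRU⟩ := nhds_basis_closedBall.mem_iff.1 (hU.mem_nhds ha)
  exact (harmonicOnNhd_poissonOn hR (hi a R hR hRU)).congr isOpen_ball (hp a R hR hRU).symm a
    (mem_ball_self hR)

theorem integrableOn_sphere_of_continuousOn {U : Set E} {h : E → ℝ} (hc : ContinuousOn h U)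
    (a : E) (R : ℝ) (hR : 0 < R) (hRU : closedBall a R ⊆ U) :
    IntegrableOn (fun z => h (a + R • z)) (sphere 0 1) (sphereMeasure E) :=
  integrableOn_sphere (continuousOn_comp_add_smul hR
    (hc.mono (sphere_subset_closedBall.trans hRU)))

theorem isRiquierSolution_poissonOn {a : E} {R : ℝ} (hR : 0 < R) {f : E → ℝ}
    (hf : ContinuousOn f (sphere a R)) :
    IsRiquierSolution biharmonicSheaf (ball a R) f 0 (poissonOn a R f) 0 :=
  ⟨biharmonicSheaf_of_harmonic isOpen_ball (harmonicOnNhd_poissonOn hR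
    (integrableOn_sphere (continuousOn_comp_add_smul hR hf))), fun _ hy =>
    ⟨tendsto_poissonOn hR hf (frontier_ball a hR.ne' ▸ hy), tendsto_const_nhds⟩⟩

/-- Hyperharmonicity of both signs turns the inequalities on balls into `h x = ∫ h dμ`, which is the
Poisson integral of `h` because the latter with `0` solves the same Riquier problem. -/
theorem firstSheaf_biharmonicSheaf (hd : 2 ≤ finrank ℝ E) {U : Set E} (hU : IsOpen U)
    {h : E → ℝ} : firstSheaf (biharmonicSheaf (E := E)) U h ↔ HarmonicOnNhd h U := by
  refine ⟨fun ⟨h1, h2⟩ => ?_, fun hh => ⟨isHyperharmonicPair_coe_zero hh,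
    isHyperharmonicPair_coe_zero hh.neg⟩⟩
  have hc := continuousOn_of_lowerSemicontinuousOn_coe h1.lsc.1 h2.lsc.1
  refine harmonicOnNhd_of_eqOn_poissonOn hU (integrableOn_sphere_of_continuousOn hc)
    fun a R hR hRU x hx => ?_
  have hω := isBiharmonicRegular_ball hd a hR
  have hcl : closure (ball a R) ⊆ U := closure_ball_subset_closedBall.trans hRU
  have hfr : frontier (ball a R) = sphere a R := frontier_ball _ hR.ne'
  have hcf : ContinuousOn h (frontier (ball a R)) :=
    hc.mono (frontier_subset_closure.trans hcl)
  obtain ⟨μ, ν, τ, hm⟩ := hω.exists_isBiharmonicMeasures hx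
  have := hm.finite.1
  have hi : IntegrableOn h (frontier (ball a R)) μ :=
    hcf.integrableOn_compact hω.isCompact_closure.frontier_of_closure
  have h3 := (h1.le _ hω hcl x hx _ _ _ hm).1
  have h4 := (h2.le _ hω hcl x hx _ _ _ hm).1
  rw [extIntegral_zero, add_zero, extIntegral_coe isClosed_frontier.measurableSet hi fun _ _ => rfl,
    EReal.coe_le_coe_iff] at h3
  rw [extIntegral_zero, add_zero, extIntegral_coe (f := fun y => -h y) isClosed_frontier.measurableSet
    hi.neg fun _ _ => rfl, EReal.coe_le_coe_iff] at h4
  have h5 : poissonOn a R h x = (∫ y in frontier (ball a R), h y ∂μ) +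
      ∫ _ in frontier (ball a R), (0 : ℝ) ∂ν :=
    (hm.repr _ _ _ _ hcf continuousOn_const (isRiquierSolution_poissonOn hR (hfr ▸ hcf))).1
  rw [integral_zero, add_zero] at h5
  rw [integral_neg] at h4
  linarith

/-- As for the first sheaf, with `τ` in place of `μ`; the second component of a Riquier solution is
the Poisson integral of its boundary data. -/
theorem secondSheaf_biharmonicSheaf (hd : 2 ≤ finrank ℝ E) {U : Set E} (hU : IsOpen U)
    {k : E → ℝ} : secondSheaf (biharmonicSheaf (E := E)) U k ↔ HarmonicOnNhd k U := by
  refine ⟨fun ⟨h1, h2⟩ => ?_, fun hk => ⟨isHyperharmonicPair_top_coe hk,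
    isHyperharmonicPair_top_coe hk.neg⟩⟩
  have hc := continuousOn_of_lowerSemicontinuousOn_coe h1.lsc.2 h2.lsc.2
  refine harmonicOnNhd_of_eqOn_poissonOn hU (integrableOn_sphere_of_continuousOn hc)
    fun a R hR hRU x hx => ?_
  have hω := isBiharmonicRegular_ball hd a hR
  have hcl : closure (ball a R) ⊆ U := closure_ball_subset_closedBall.trans hRU
  have hfr : frontier (ball a R) = sphere a R := frontier_ball _ hR.ne'
  have hcf : ContinuousOn k (frontier (ball a R)) :=
    hc.mono (frontier_subset_closure.trans hcl)
  obtain ⟨μ, ν, τ, hm⟩ := hω.exists_isBiharmonicMeasures hx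
  have := hm.finite.2.2
  have hi : IntegrableOn k (frontier (ball a R)) τ :=
    hcf.integrableOn_compact hω.isCompact_closure.frontier_of_closure
  have h3 := (h1.le _ hω hcl x hx _ _ _ hm).2
  have h4 := (h2.le _ hω hcl x hx _ _ _ hm).2
  rw [extIntegral_coe isClosed_frontier.measurableSet hi fun _ _ => rfl,
    EReal.coe_le_coe_iff] at h3
  rw [extIntegral_coe (f := fun y => -k y) isClosed_frontier.measurableSet hi.neg
    fun _ _ => rfl, EReal.coe_le_coe_iff] at h4
  obtain ⟨u, v, huv⟩ := hω.exists_solution 0 k continuousOn_const hcf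
  have h5 := (hm.repr _ _ _ _ continuousOn_const hcf huv).2
  have h6 : EqOn v (poissonOn a R k) (ball a R) :=
    eqOn_of_harmonic_of_tendsto isOpen_ball isBounded_ball (huv.1.harmonic isOpen_ball)
      (harmonicOnNhd_poissonOn hR (integrableOn_sphere_of_continuousOn hc a R hR hRU)) (f := k)
      (fun y hy => (huv.2 y hy).2) fun y hy =>
        tendsto_poissonOn hR (hfr ▸ hcf) (hfr ▸ hy)
  rw [← h6 hx]
  rw [integral_neg] at h4
  linarith

variable {p q : E → ℝ}

theorem firstSheaf_renormalized (hd : 2 ≤ finrank ℝ E) (hp : Continuous p) (hq : Continuous q)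
    (hp0 : ∀ x, 0 < p x) (hq0 : ∀ x, 0 < q x) {U : Set E} (hU : IsOpen U) {h : E → ℝ} :
    firstSheaf (renormalized biharmonicSheaf p q) U h ↔
      HarmonicOnNhd (fun x => p x * h x) U := by
  rw [← firstSheaf_biharmonicSheaf hd hU, firstSheaf, firstSheaf,
    isHyperharmonicPair_renormalized_iff (fun _ _ _ h => h.continuousOn) hp hq hp0 hq0,
    isHyperharmonicPair_renormalized_iff (fun _ _ _ h => h.continuousOn) hp hq hp0 hq0]
  simp only [← EReal.coe_mul, mul_zero, mul_neg]

theorem secondSheaf_renormalized (hd : 2 ≤ finrank ℝ E) (hp : Continuous p) (hq : Continuous q)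
    (hp0 : ∀ x, 0 < p x) (hq0 : ∀ x, 0 < q x) {U : Set E} (hU : IsOpen U) {k : E → ℝ} :
    secondSheaf (renormalized biharmonicSheaf p q) U k ↔
      HarmonicOnNhd (fun x => q x * k x) U := by
  rw [← secondSheaf_biharmonicSheaf hd hU, secondSheaf, secondSheaf,
    isHyperharmonicPair_renormalized_iff (fun _ _ _ h => h.continuousOn) hp hq hp0 hq0,
    isHyperharmonicPair_renormalized_iff (fun _ _ _ h => h.continuousOn) hp hq hp0 hq0]
  simp only [← EReal.coe_mul, mul_neg, EReal.coe_mul_top_of_pos (hp0 _)]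

end Associated

/-! ### Weighted harmonic sheaves -/

section Weighted

open InnerProductSpace Module Metric

variable {E : Type*} [NormedAddCommGroup E] [InnerProductSpace ℝ E] [FiniteDimensional ℝ E]

/-- The sections of `K` over open sets are the functions whose product with the positive continuous
weight `w` is harmonic. -/
structure IsWeightedHarmonic (K : Set E → (E → ℝ) → Prop) (w : E → ℝ) : Prop where
  continuous : Continuous w
  pos : ∀ x, 0 < w x
  iff : ∀ {U : Set E}, IsOpen U → ∀ {h : E → ℝ}, K U h ↔ HarmonicOnNhd (fun x => w x * h x) U

variable {K : Set E → (E → ℝ) → Prop} {w : E → ℝ}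

theorem IsWeightedHarmonic.mul_div (hK : IsWeightedHarmonic K w) (f : E → ℝ) :
    (fun x => w x * (f x / w x)) = f :=
  funext fun x => mul_div_cancel₀ _ (hK.pos x).ne'

theorem IsWeightedHarmonic.div_iff (hK : IsWeightedHarmonic K w) {U : Set E} (hU : IsOpen U)
    {f : E → ℝ} : K U (fun x => f x / w x) ↔ HarmonicOnNhd f U := by
  rw [hK.iff hU, hK.mul_div]

theorem IsWeightedHarmonic.sheaf (hK : IsWeightedHarmonic K w) : IsHarmonicSheaf K where
  congr U hU u u' huu' hu := by
    rw [hK.iff hU] at hu ⊢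
    exact hu.congr hU fun x hx => by simp only [huu' hx]
  continuousOn U hU u hu := by
    rw [hK.iff hU] at hu
    refine (hu.continuousOn.div hK.continuous.continuousOn fun x _ => (hK.pos x).ne').congr
      fun x _ => ?_
    exact (mul_div_cancel_left₀ _ (hK.pos x).ne').symm
  zero U hU := by
    rw [hK.iff hU]
    simp
  add U hU u u' hu hu' := by
    rw [hK.iff hU] at hu hu' ⊢
    refine (hu.add hu').congr hU fun x _ => ?_
    simp only [Pi.add_apply, mul_add]
  smul U hU c u hu := by
    rw [hK.iff hU] at hu ⊢
    refine (hu.const_smul (c := c)).congr hU fun x _ => ?_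
    simp only [Pi.smul_apply, smul_eq_mul]
    ring
  restrict U V hU hV hUV u hu := by
    rw [hK.iff hV] at hu
    exact (hK.iff hU).2 (hu.mono hUV)
  glue S hS u hu := by
    rw [hK.iff (isOpen_sUnion hS)]
    rintro x ⟨U, hU, hxU⟩
    exact (hK.iff (hS U hU)).1 (hu U hU) x hxU

variable [Nontrivial E]

theorem IsWeightedHarmonic.solution_iff (hK : IsWeightedHarmonic K w) {ω : Set E} (hω : IsOpen ω)
    {f u : E → ℝ} : IsDirichletSolution K ω f u ↔
      HarmonicOnNhd (fun x => w x * u x) ω ∧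
        ∀ y ∈ frontier ω, Tendsto (fun x => w x * u x) (𝓝[ω] y) (𝓝 (w y * f y)) := by
  rw [IsDirichletSolution, hK.iff hω]
  have hw : ∀ y, Tendsto w (𝓝[ω] y) (𝓝 (w y)) := fun y =>
    (hK.continuous.tendsto y).mono_left nhdsWithin_le_nhds
  refine and_congr_right fun _ => forall₂_congr fun y _ => ⟨fun h => (hw y).mul h, fun h => ?_⟩
  have := h.div (hw y) (hK.pos y).ne'
  rw [mul_div_cancel_left₀ _ (hK.pos y).ne'] at this
  exact this.congr fun x => mul_div_cancel_left₀ _ (hK.pos x).ne'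

theorem IsWeightedHarmonic.solution_mono (hK : IsWeightedHarmonic K w) {ω : Set E} (hω : IsOpen ω)
    (hb : Bornology.IsBounded ω) {f g u v : E → ℝ} (hu : IsDirichletSolution K ω f u)
    (hv : IsDirichletSolution K ω g v) (hfg : ∀ y ∈ frontier ω, f y ≤ g y) :
    ∀ x ∈ ω, u x ≤ v x := by
  rw [hK.solution_iff hω, harmonicOnNhd_iff hω] at hu hv
  intro x hx
  refine le_of_mul_le_mul_left (le_of_laplacian_le hω hb hu.1.1 hv.1.1
    (fun x hx => by rw [hu.1.2 x hx, hv.1.2 x hx]) hu.2 hv.2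
    (fun y hy => mul_le_mul_of_nonneg_left (hfg y hy) (hK.pos y).le) x hx) (hK.pos x)

theorem harmonicOnNhd_affine (c : ℝ) (d x : E) (U : Set E) :
    HarmonicOnNhd (fun y => c + inner ℝ d (y - x)) U := by
  have hc : ContDiff ℝ 2 fun y => c + inner ℝ d (y - x) :=
    contDiff_const.add (contDiff_const.inner ℝ (contDiff_id.sub contDiff_const))
  intro y _
  refine ⟨hc.contDiffAt, Eventually.of_forall fun z => ?_⟩
  have h : HasHessianAt (fun y => c + inner ℝ d (y - x)) (fun _ => d) 0 z :=
    ⟨Eventually.of_forall fun v => ((innerSL ℝ d).hasFDerivAt.comp v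
      ((hasFDerivAt_id (𝕜 := ℝ) v).sub_const x)).const_add c, hasFDerivAt_const _ _⟩
  rw [h.laplacian_eq]
  simp [basisTrace]

variable [MeasurableSpace E] [BorelSpace E]

theorem IsWeightedHarmonic.regular_ball (hK : IsWeightedHarmonic K w) (a : E) {R : ℝ}
    (hR : 0 < R) : IsHarmonicRegular K (ball a R) where
  isOpen := isOpen_ball
  isCompact_closure := isBounded_ball.isCompact_closure
  exists_solution f hf := by
    rw [frontier_ball _ hR.ne'] at hf
    have hwf := hK.continuous.continuousOn.mul hf
    refine ⟨fun x => poissonOn a R (fun x => w x * f x) x / w x, ?_⟩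
    rw [hK.solution_iff isOpen_ball, frontier_ball _ hR.ne', hK.mul_div]
    exact ⟨harmonicOnNhd_poissonOn hR (integrableOn_sphere (continuousOn_comp_add_smul hR hwf)),
      fun y hy => tendsto_poissonOn hR hwf hy⟩
  unique f _ u u' hu hu' x hx := le_antisymm
    (hK.solution_mono isOpen_ball isBounded_ball hu hu' (fun _ _ => le_rfl) x hx)
    (hK.solution_mono isOpen_ball isBounded_ball hu' hu (fun _ _ => le_rfl) x hx)
  nonneg f _ h0 u hu x hx := by
    refine hK.solution_mono isOpen_ball isBounded_ball (f := 0) (u := 0) ?_ hu h0 x hx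
    exact ⟨hK.sheaf.zero _ isOpen_ball, fun _ _ => tendsto_const_nhds⟩

theorem IsWeightedHarmonic.base_regular (hK : IsWeightedHarmonic K w) (x : E) (U : Set E)
    (hU : IsOpen U) (hx : x ∈ U) :
    ∃ ω, IsHarmonicRegular K ω ∧ IsConnected ω ∧ x ∈ ω ∧ ω ⊆ U := by
  obtain ⟨R, hR, hRU⟩ := nhds_basis_ball.mem_iff.1 (hU.mem_nhds hx)
  exact ⟨ball x R, hK.regular_ball x hR, (convex_ball x R).isConnected ⟨x, mem_ball_self hR⟩,
    mem_ball_self hR, hRU⟩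

theorem IsWeightedHarmonic.isHyperharmonic (hK : IsWeightedHarmonic K w) {U : Set E}
    {f : E → ℝ} (hf : HarmonicOnNhd f U) :
    IsHyperharmonic K U (fun x => ((f x / w x : ℝ) : EReal)) := by
  have hc : ContinuousOn (fun x => f x / w x) U :=
    hf.continuousOn.div hK.continuous.continuousOn fun x _ => (hK.pos x).ne'
  refine ⟨.coe hc, fun _ _ => EReal.coe_ne_bot _, fun ω hω hωU x hx μ hμ => ?_⟩
  have hcf : ContinuousOn (fun x => f x / w x) (frontier ω) :=
    hc.mono (frontier_subset_closure.trans hωU)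
  have := hμ.finite
  rw [extIntegral_coe isClosed_frontier.measurableSet
    (hcf.integrableOn_compact hω.isCompact_closure.frontier_of_closure) fun _ _ => rfl,
    ← hμ.repr _ (fun x => f x / w x) hcf ⟨?_, fun y hy => ?_⟩]
  · exact (hK.div_iff hω.isOpen).2 (hf.mono (subset_closure.trans hωU))
  · exact tendsto_nhdsWithin_of_continuousOn hc (subset_closure.trans hωU)
      (hωU (frontier_subset_closure hy))

/-- Locally bounded increasing limits of harmonic functions are harmonic. -/
theorem harmonicOnNhd_of_monotone_of_tendsto {U : Set E} (hU : IsOpen U) {f : ℕ → E → ℝ}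
    {F : E → ℝ} (hf : ∀ n, HarmonicOnNhd (f n) U) (hmono : ∀ n, ∀ x ∈ U, f n x ≤ f (n + 1) x)
    (hbd : ∀ x ∈ U, ∃ M : ℝ, ∀ᶠ y in 𝓝 x, ∀ n, f n y ≤ M)
    (hlim : ∀ x ∈ U, Tendsto (fun n => f n x) atTop (𝓝 (F x))) : HarmonicOnNhd F U := by
  intro a ha
  obtain ⟨M, hM⟩ := hbd a ha
  obtain ⟨R, hR, hRU⟩ := nhds_basis_closedBall.mem_iff.1 (hM.and (hU.mem_nhds ha))
  have hU' : closedBall a R ⊆ U := fun x hx => (hRU hx).2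
  obtain ⟨C, hC⟩ := (isCompact_closedBall a R).exists_bound_of_continuousOn
    ((hf 0).continuousOn.mono hU')
  set D := max C |M| with hD
  have hbound : ∀ n, ∀ x ∈ closedBall a R, |f n x| ≤ D := fun n x hx => by
    have h0 : f 0 x ≤ f n x :=
      monotone_nat_of_le_succ (f := fun n => f n x) (fun n => hmono n x (hU' hx)) (Nat.zero_le n)
    have h1 := (abs_le.1 (hC x hx)).1
    have h2 := (hRU hx).1 n
    rw [abs_le]
    constructor
    · linarith [le_max_left C |M|]
    · linarith [le_max_right C |M|, le_abs_self M]
  have hsph : ∀ z ∈ sphere (0 : E) 1, a + R • z ∈ closedBall a R := fun z hz =>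
    sphere_subset_closedBall (add_smul_mem_sphere hR hz)
  have hcont : ∀ n, ContinuousOn (fun z => f n (a + R • z)) (sphere (0 : E) 1) := fun n =>
    continuousOn_comp_add_smul hR ((hf n).continuousOn.mono (sphere_subset_closedBall.trans hU'))
  have hlim' : ∀ᵐ z ∂(sphereMeasure E).restrict (sphere 0 1),
      Tendsto (fun n => f n (a + R • z)) atTop (𝓝 (F (a + R • z))) := by
    filter_upwards [ae_restrict_mem isClosed_sphere.measurableSet] with z hz
    exact hlim _ (hU' (hsph z hz))
  -- Continuity of the limit `F` is not yet known. Poisson integrals of merely integrable data are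
  -- harmonic, so bounded measurable boundary values are enough.
  have hFint : IntegrableOn (fun z => F (a + R • z)) (sphere 0 1) (sphereMeasure E) := by
    refine (integrable_const D).mono' (aestronglyMeasurable_of_tendsto_ae atTop
      (fun n => (hcont n).aestronglyMeasurable isClosed_sphere.measurableSet) hlim') ?_
    filter_upwards [hlim', ae_restrict_mem isClosed_sphere.measurableSet] with z hz hz'
    exact le_of_tendsto hz.norm (Eventually.of_forall fun n => hbound n _ (hsph z hz'))
  refine (harmonicOnNhd_poissonOn hR hFint).congr isOpen_ball (fun x hx => ?_) a (mem_ball_self hR)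
  have hx' := inv_smul_sub_mem_ball hR hx
  have hxU := hU' (ball_subset_closedBall hx)
  have h1 : Tendsto (fun n => poissonOn a R (f n) x) atTop (𝓝 (poissonOn a R F x)) := by
    refine tendsto_integral_of_dominated_convergence
      (fun z => D • ballPoissonKernel (R⁻¹ • (x - a), z))
      (fun n => (integrableOn_mul_ballPoissonKernel (integrableOn_sphere (hcont n))
        hx').aestronglyMeasurable)
      (integrableOn_mul_ballPoissonKernel (integrable_const D) hx') (fun n => ?_) ?_
    · filter_upwards [ae_restrict_mem isClosed_sphere.measurableSet] with z hz
      have hP := ballPoissonKernel_nonneg (z := z) (mem_ball_zero_iff.1 hx').le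
      rw [norm_smul, Real.norm_of_nonneg hP]
      exact mul_le_mul_of_nonneg_right (hbound n _ (hsph z hz)) hP
    · filter_upwards [hlim'] with z hz using hz.smul_const _
  refine tendsto_nhds_unique (h1.congr fun n => ?_) (hlim x hxU)
  exact (eqOn_poissonOn hR ((hf n).mono (ball_subset_closedBall.trans hU'))
    ((hf n).continuousOn.mono hU') hx).symm

theorem IsWeightedHarmonic.isBauerHarmonicSpace (hK : IsWeightedHarmonic K w) :
    IsBauerHarmonicSpace K where
  sheaf := hK.sheaf
  positivity x := ⟨univ, isOpen_univ, mem_univ x, fun x => 1 / w x,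
    (hK.div_iff isOpen_univ).2 (harmonicOnNhd_const 1), (one_div_pos.2 (hK.pos x)).ne'⟩
  base_regular x U hU hx := by
    obtain ⟨ω, h1, -, h2⟩ := hK.base_regular x U hU hx
    exact ⟨ω, h1, h2⟩
  convergence U hU h g hh hmono hbd hlim := by
    rw [hK.iff hU]
    refine harmonicOnNhd_of_monotone_of_tendsto hU (f := fun n x => w x * h n x)
      (fun n => (hK.iff hU).1 (hh n))
      (fun n x hx => mul_le_mul_of_nonneg_left (hmono n x hx) (hK.pos x).le) (fun x hx => ?_)
      fun x hx => (hlim x hx).const_mul _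
    obtain ⟨M, hM⟩ := hbd x hx
    refine ⟨(w x + 1) * |M|, ?_⟩
    filter_upwards [hM, hK.continuous.continuousAt.eventually
      (gt_mem_nhds (lt_add_one (w x)))] with y h1 h2 n
    calc w y * h n y ≤ w y * |M| :=
          mul_le_mul_of_nonneg_left ((h1 n).trans (le_abs_self M)) (hK.pos y).le
      _ ≤ _ := mul_le_mul_of_nonneg_right h2.le (abs_nonneg M)
  separation x := by
    refine ⟨ball x 1, isOpen_ball, mem_ball_self one_pos, fun y hy z hz hyz c hc => ?_⟩
    by_contra! hcon
    -- If `y` and `z` were not separated, every nonnegative harmonic `f` would satisfy this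
    -- proportionality. Taking `f = 1` and an affine `f` of gradient `y - z`, lifted by `‖y - z‖` to
    -- be nonnegative on the ball, forces `⟨y - z, y - z⟩ = 0`.
    have key : ∀ f : E → ℝ, HarmonicOnNhd f (ball x 1) → (∀ a ∈ ball x 1, 0 ≤ f a) →
        f y / w y = c * (f z / w z) := fun f hf h0 => by
      have := hcon _ (hK.isHyperharmonic hf) fun a ha => by
        exact_mod_cast div_nonneg (h0 a ha) (hK.pos a).le
      exact_mod_cast this
    have h1 := key (fun _ => 1) (harmonicOnNhd_const 1) fun _ _ => zero_le_one
    have h2 := key (fun a => ‖y - z‖ + inner ℝ (y - z) (a - x)) (harmonicOnNhd_affine _ _ _ _)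
      fun a ha => by
        have h3 := (abs_le.1 (abs_real_inner_le_norm (y - z) (a - x))).1
        have h4 : ‖a - x‖ < 1 := mem_ball_iff_norm.1 ha
        nlinarith [norm_nonneg (y - z)]
    have hwy := hK.pos y
    have hwz := hK.pos z
    have h5 : w z = c * w y := by field_simp at h1; linarith
    have h6 : ‖y - z‖ + inner ℝ (y - z) (y - x) = ‖y - z‖ + inner ℝ (y - z) (z - x) := by
      rw [h5] at h2
      have hc0 : c ≠ 0 := fun h => by rw [h, zero_mul] at h5; exact hwz.ne' h5
      field_simp at h2
      linarith
    have h7 : inner ℝ (y - z) (y - z) = (0 : ℝ) := by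
      have : y - z = (y - x) - (z - x) := by abel
      nth_rewrite 2 [this]
      rw [inner_sub_right]
      linarith
    exact hyz (sub_eq_zero.1 (inner_self_eq_zero.1 h7))

/-- The values of an increasing sequence of harmonic functions at the centre and at another point of
a ball are bounded simultaneously. -/
theorem bounded_iff_of_mem_ball {a x : E} {R : ℝ} (hR : 0 < R) {f : ℕ → E → ℝ} {U : Set E}
    (hRU : closedBall a R ⊆ U) (hf : ∀ n, HarmonicOnNhd (f n) U)
    (h0 : ∀ n, ∀ x ∈ U, f 0 x ≤ f n x) (hx : x ∈ ball a R) :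
    (∃ M, ∀ n, f n x ≤ M) ↔ ∃ M, ∀ n, f n a ≤ M := by
  have h : ∀ n, _ := fun n => InnerProductSpace.HarmonicOnNhd.harnack (u := f n - f 0) hR
    (((hf n).sub (hf 0)).mono (ball_subset_closedBall.trans hRU))
    (((hf n).sub (hf 0)).continuousOn.mono hRU)
    (fun z hz => sub_nonneg.2 (h0 n z (hRU (sphere_subset_closedBall hz)))) hx
  simp only [Pi.sub_apply] at h
  have hρ : ‖x - a‖ / R < 1 := (div_lt_one hR).2 (mem_ball_iff_norm.1 hx)
  have hL : 0 < harnackLower E (‖x - a‖ / R) := harnackLower_pos (by positivity) hρ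
  constructor
  · rintro ⟨M, hM⟩
    refine ⟨f 0 a + (M - f 0 x) / harnackLower E (‖x - a‖ / R), fun n => ?_⟩
    rw [← sub_le_iff_le_add', le_div_iff₀ hL]
    linarith [(h n).1, hM n]
  · rintro ⟨M, hM⟩
    refine ⟨f 0 x + harnackUpper E (‖x - a‖ / R) * (M - f 0 a), fun n => ?_⟩
    have hU0 : 0 ≤ harnackUpper E (‖x - a‖ / R) := by
      have h1 : 0 ≤ ‖x - a‖ / R := by positivity
      exact mul_nonneg (by nlinarith) (by positivity)
    nlinarith [(h n).2, hM n]

theorem IsWeightedHarmonic.isBrelotHarmonicSpace (hK : IsWeightedHarmonic K w) :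
    IsBrelotHarmonicSpace K where
  connected := inferInstance
  locallyConnected := inferInstance
  noncompact := NormedSpace.noncompactSpace ℝ E
  sheaf := hK.sheaf
  base_regular := hK.base_regular
  convergence U hU hUc h hh hmono := by
    have hm : ∀ x ∈ U, Monotone fun n => h n x := fun x hx =>
      monotone_nat_of_le_succ fun n => hmono n x hx
    set f : ℕ → E → ℝ := fun n x => w x * h n x with hfdef
    have hf : ∀ n, HarmonicOnNhd (f n) U := fun n => (hK.iff hU).1 (hh n)
    have h0 : ∀ n, ∀ x ∈ U, f 0 x ≤ f n x := fun n x hx =>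
      mul_le_mul_of_nonneg_left (hm x hx (Nat.zero_le n)) (hK.pos x).le
    have hfh : ∀ x, (∃ M, ∀ n, f n x ≤ M) ↔ ∃ M, ∀ n, h n x ≤ M := fun x => by
      refine ⟨fun ⟨M, hM⟩ => ⟨M / w x, fun n => ?_⟩, fun ⟨M, hM⟩ => ⟨w x * M, fun n => ?_⟩⟩
      · rw [le_div_iff₀' (hK.pos x)]
        exact hM n
      · exact mul_le_mul_of_nonneg_left (hM n) (hK.pos x).le
    -- By Harnack, boundedness at a point and at nearby points are equivalent, so the bounded points
    -- (`b = True`) and the unbounded ones (`b = False`) are both open; connectedness leaves one of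
    -- them.
    have hopen : ∀ b : Prop, IsOpen {x ∈ U | (∃ M, ∀ n, f n x ≤ M) ↔ b} := fun b => by
      refine isOpen_iff_mem_nhds.2 fun a ha => ?_
      obtain ⟨R, hR, hRU⟩ := nhds_basis_closedBall.mem_iff.1 (hU.mem_nhds ha.1)
      filter_upwards [ball_mem_nhds a hR] with x hx
      exact ⟨hRU (ball_subset_closedBall hx),
        (bounded_iff_of_mem_ball hR hRU hf h0 hx).trans ha.2⟩
    by_cases hne : (U ∩ {x ∈ U | (∃ M, ∀ n, f n x ≤ M) ↔ True}).Nonempty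
    · right
      have hsub := hUc.isPreconnected.subset_left_of_subset_union (hopen True) (hopen False)
        (disjoint_left.2 fun x h1 h2 => h2.2.1 (h1.2.2 trivial)) (fun x hx => by
          by_cases hb : ∃ M, ∀ n, f n x ≤ M
          · exact Or.inl ⟨hx, iff_true_intro hb⟩
          · exact Or.inr ⟨hx, iff_false_intro hb⟩) hne
      have hlim : ∀ x ∈ U, Tendsto (fun n => h n x) atTop (𝓝 (⨆ n, h n x)) := fun x hx => by
        obtain ⟨M, hM⟩ := (hfh x).1 ((hsub hx).2.2 trivial)
        exact tendsto_atTop_ciSup (hm x hx) ⟨M, forall_mem_range.2 hM⟩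
      refine ⟨fun x => ⨆ n, h n x, (hK.iff hU).2 ?_, hlim⟩
      refine harmonicOnNhd_of_monotone_of_tendsto hU (f := f) hf
        (fun n x hx => mul_le_mul_of_nonneg_left (hmono n x hx) (hK.pos x).le) (fun a ha => ?_)
        fun x hx => (hlim x hx).const_mul _
      obtain ⟨M, hM⟩ := (hsub ha).2.2 trivial
      obtain ⟨R, hR, hRU⟩ := nhds_basis_closedBall.mem_iff.1 (hU.mem_nhds ha)
      have hρ : Tendsto (fun y => ‖y - a‖ / R) (𝓝 a) (𝓝 0) := by
        have : Continuous fun y => ‖y - a‖ / R := by fun_prop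
        simpa using this.tendsto a
      -- Near `a` one has `f 0 y < f 0 a + 1`, and Harnack with constant below `2` bounds `f n y - f
      -- 0 y` by twice its value at `a`.
      refine ⟨f 0 a + 1 + 2 * (M - f 0 a), ?_⟩
      filter_upwards [((tendsto_harnackUpper (E := E)).comp hρ).eventually
        (gt_mem_nhds one_lt_two), ball_mem_nhds a hR,
        ((hf 0).continuousOn.continuousAt (hU.mem_nhds ha)).eventually
          (gt_mem_nhds (lt_add_one (f 0 a)))] with y h1 h2 h3 n
      have h4 := (InnerProductSpace.HarmonicOnNhd.harnack (u := f n - f 0) hR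
        (((hf n).sub (hf 0)).mono (ball_subset_closedBall.trans hRU))
        (((hf n).sub (hf 0)).continuousOn.mono hRU)
        (fun z hz => sub_nonneg.2 (h0 n z (hRU (sphere_subset_closedBall hz)))) h2).2
      simp only [Pi.sub_apply, Function.comp_apply] at h4 h1
      nlinarith [hM n, h0 n a ha]
    · left
      intro x hx
      rcases tendsto_atTop_of_monotone (hm x hx) with h1 | ⟨l, hl⟩
      · exact h1
      · refine absurd ⟨x, hx, hx, iff_true_intro ((hfh x).2 ⟨l, fun n => ?_⟩)⟩ hne
        exact (hm x hx).ge_of_tendsto hl n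

end Weighted

/-! ### Nonnegative harmonic functions on a punctured space -/

section Bocher

open InnerProductSpace Module Metric

variable {E : Type*} [NormedAddCommGroup E] [InnerProductSpace ℝ E] [FiniteDimensional ℝ E]

/-- The function `‖x‖ ^ (2 - d)`, harmonic away from the origin. -/
def fundamental (x : E) : ℝ := (‖x‖ ^ 2) ^ (1 - (finrank ℝ E : ℝ) / 2)

theorem harmonicOnNhd_fundamental : HarmonicOnNhd (fundamental (E := E)) {0}ᶜ := by
  rw [harmonicOnNhd_iff isOpen_compl_singleton]
  refine ⟨(contDiff_norm_sq ℝ).contDiffOn.rpow_const_of_ne fun x hx => ?_, fun x hx => ?_⟩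
  · simpa using hx
  set γ : ℝ := 1 - (finrank ℝ E : ℝ) / 2 with hγ
  have ht : 0 < ‖x - 0‖ ^ 2 := by
    rw [sub_zero]
    have := norm_pos_iff.2 (mem_compl_singleton_iff.1 hx)
    positivity
  have h := laplacian_radial (φ := fun t => t ^ γ) ((lt_mem_nhds ht).mono fun t ht => hasDerivAt_rpow_neg ht)
    ((hasDerivAt_rpow_neg (s := γ - 1) ht).const_mul γ)
  rw [show (fundamental (E := E)) = fun y => (‖y - 0‖ ^ 2) ^ γ by ext; simp [fundamental, hγ], h]
  have h5 : (‖x - 0‖ ^ 2) ^ (γ - 1) = (‖x - 0‖ ^ 2) ^ (γ - 1 - 1) * ‖x - 0‖ ^ 2 := by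
    rw [← Real.rpow_add_one ht.ne']; congr 1; ring
  rw [h5, hγ]
  ring

theorem fundamental_pos {x : E} (hx : x ≠ 0) : 0 < fundamental x := by
  have := norm_pos_iff.2 hx
  exact Real.rpow_pos_of_pos (by positivity) _

theorem exists_lt_fundamental (hd : 3 ≤ finrank ℝ E) (M : ℝ) {r₀ : ℝ} (hr₀ : 0 < r₀) :
    ∃ r, 0 < r ∧ r < r₀ ∧ ∀ x : E, ‖x‖ = r → M ≤ fundamental x := by
  have hd' : (3 : ℝ) ≤ (finrank ℝ E : ℝ) := by exact_mod_cast hd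
  have h1 : Tendsto (fun r : ℝ => (r ^ 2) ^ (1 - (finrank ℝ E : ℝ) / 2)) (𝓝[>] 0) atTop := by
    refine (tendsto_rpow_neg_nhdsGT_zero (by linarith)).comp (tendsto_nhdsWithin_iff.2 ⟨?_, ?_⟩)
    · have : Continuous fun r : ℝ => r ^ 2 := by fun_prop
      simpa using (this.tendsto 0).mono_left (nhdsWithin_le_nhds (s := Ioi 0))
    · filter_upwards [self_mem_nhdsWithin] with r hr using pow_pos (mem_Ioi.1 hr) 2
  obtain ⟨r, h2, h3, h4⟩ := ((h1.eventually (eventually_ge_atTop M)).and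
    (Ioo_mem_nhdsGT hr₀)).exists
  exact ⟨r, h3, h4, fun x hx => by rw [fundamental, hx]; exact h2⟩

theorem exists_fundamental_lt (hd : 3 ≤ finrank ℝ E) {ε : ℝ} (hε : 0 < ε) (r₀ : ℝ) :
    ∃ r, r₀ < r ∧ ∀ x : E, ‖x‖ = r → fundamental x < ε := by
  have hd' : (3 : ℝ) ≤ (finrank ℝ E : ℝ) := by exact_mod_cast hd
  have h1 : Tendsto (fun r : ℝ => (r ^ 2) ^ (1 - (finrank ℝ E : ℝ) / 2)) atTop (𝓝 0) := by
    rw [show 1 - (finrank ℝ E : ℝ) / 2 = -((finrank ℝ E : ℝ) / 2 - 1) by ring]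
    exact (tendsto_rpow_neg_atTop (by linarith)).comp (tendsto_pow_atTop two_ne_zero)
  obtain ⟨r, h2, h3⟩ := ((h1.eventually (gt_mem_nhds hε)).and (eventually_gt_atTop r₀)).exists
  exact ⟨r, h3, fun x hx => by rw [fundamental, hx]; exact h2⟩

/-! ### Comparison and Harnack inequalities on the punctured space -/

variable [Nontrivial E]

/-- The minimum principle on an annulus. -/
theorem nonneg_of_annulus {v : E → ℝ} (hv : HarmonicOnNhd v {0}ᶜ) {r s : ℝ} (hr : 0 < r)
    (h1 : ∀ x, ‖x‖ = r → 0 ≤ v x) (h2 : ∀ x, ‖x‖ = s → 0 ≤ v x) {x : E} (hrx : r < ‖x‖)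
    (hxs : ‖x‖ < s) : 0 ≤ v x := by
  have ho : IsOpen {x : E | r < ‖x‖ ∧ ‖x‖ < s} :=
    (isOpen_lt continuous_const continuous_norm).inter (isOpen_lt continuous_norm continuous_const)
  have hsub : {x : E | r < ‖x‖ ∧ ‖x‖ < s} ⊆ {0}ᶜ := fun x hx h0 => by
    rw [mem_singleton_iff.1 h0] at hx
    simpa using hr.trans hx.1
  have hcl : closure {x : E | r < ‖x‖ ∧ ‖x‖ < s} ⊆ {x | r ≤ ‖x‖ ∧ ‖x‖ ≤ s} :=
    closure_minimal (fun x hx => ⟨hx.1.le, hx.2.le⟩) ((isClosed_le continuous_const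
      continuous_norm).inter (isClosed_le continuous_norm continuous_const))
  have hv' := (harmonicOnNhd_iff ho).1 (hv.mono hsub)
  refine nonneg_of_laplacian_nonpos ho ((isBounded_ball (x := (0 : E)) (r := s)).subset fun x hx => by
    simpa using hx.2) hv'.1 (fun x hx => (hv'.2 x hx).le) (fun y hy ε hε => ?_) x ⟨hrx, hxs⟩
  have hy1 := hcl (frontier_subset_closure hy)
  have hy2 : y ∉ {x : E | r < ‖x‖ ∧ ‖x‖ < s} := by
    rw [ho.frontier_eq] at hy
    exact hy.2
  have hvy : 0 ≤ v y := by
    rcases hy1.1.eq_or_lt with h | h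
    · exact h1 y h.symm
    · rcases hy1.2.eq_or_lt with h' | h'
      · exact h2 y h'
      · exact absurd ⟨h, h'⟩ hy2
  have hy0 : y ∈ ({0}ᶜ : Set E) := norm_pos_iff.1 (hr.trans_le hy1.1)
  exact nhdsWithin_le_nhds ((hv.continuousOn.continuousAt
    (isOpen_compl_singleton.mem_nhds hy0)).eventually (lt_mem_nhds (by linarith)))

theorem harmonicOnNhd_combination {v : E → ℝ} (hv : HarmonicOnNhd v {0}ᶜ) (c a b : ℝ) :
    HarmonicOnNhd (fun x => c * v x + a + b * fundamental x) {0}ᶜ :=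
  ((hv.const_smul (c := c)).add (harmonicOnNhd_const a)).add
    (harmonicOnNhd_fundamental.const_smul (c := b))

/-- A small multiple of the fundamental solution, costing `ε` at `x`, exceeds `δ` on a tiny inner
sphere. The minimum principle on the annulus then applies without information on `v` near `0` beyond
its sign. -/
theorem le_of_forall_le_sphere_of_lt (hd : 3 ≤ finrank ℝ E) {v : E → ℝ}
    (hv : HarmonicOnNhd v {0}ᶜ) (h0 : ∀ x ≠ 0, 0 ≤ v x) {δ r : ℝ} (h : ∀ x, ‖x‖ = r → δ ≤ v x)
    {x : E} (hx0 : x ≠ 0) (hxr : ‖x‖ < r) : δ ≤ v x := by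
  refine le_of_forall_pos_le_add fun ε hε => ?_
  have ht := fundamental_pos hx0
  obtain ⟨r₁, hr₁, hr₁x, hr₁t⟩ := exists_lt_fundamental (E := E) hd (δ / (ε / fundamental x))
    (norm_pos_iff.2 hx0)
  have h1 := nonneg_of_annulus (harmonicOnNhd_combination hv 1 (-δ) (ε / fundamental x)) hr₁
    (fun z hz => ?_) (fun z hz => ?_) hr₁x hxr
  · rw [div_mul_cancel₀ _ ht.ne'] at h1
    linarith
  · have hz0 : z ≠ 0 := norm_pos_iff.1 (hz ▸ hr₁)
    have := (div_le_iff₀' (by positivity)).1 (hr₁t z hz)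
    linarith [h0 z hz0]
  · have hz0 : z ≠ 0 := norm_pos_iff.1 (hz ▸ (norm_nonneg x).trans_lt hxr)
    have := fundamental_pos hz0
    have : 0 ≤ ε / fundamental x * fundamental z := by positivity
    linarith [h z hz]

/-- The counterpart at infinity: the added constant `ε` dominates `δ * fundamental` on a large outer
sphere. -/
theorem mul_fundamental_le_of_forall_le_sphere_of_lt (hd : 3 ≤ finrank ℝ E) {v : E → ℝ}
    (hv : HarmonicOnNhd v {0}ᶜ) (h0 : ∀ x ≠ 0, 0 ≤ v x) {δ r : ℝ} (hδ : 0 < δ) (hr : 0 < r)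
    (h : ∀ x, ‖x‖ = r → δ * fundamental x ≤ v x) {x : E} (hxr : r < ‖x‖) :
    δ * fundamental x ≤ v x := by
  refine le_of_forall_pos_le_add fun ε hε => ?_
  obtain ⟨s, hs, hst⟩ := exists_fundamental_lt (E := E) hd (div_pos hε hδ) ‖x‖
  have h1 := nonneg_of_annulus (harmonicOnNhd_combination hv 1 ε (-δ)) hr
    (fun z hz => ?_) (fun z hz => ?_) hxr hs
  · linarith
  · linarith [h z hz]
  · have hz0 : z ≠ 0 := norm_pos_iff.1 (by rw [hz]; exact (norm_nonneg x).trans_lt hs)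
    have := (lt_div_iff₀' hδ).1 (hst z hz)
    linarith [h0 z hz0]

variable [MeasurableSpace E] [BorelSpace E]

theorem eventually_harnack {a : E} (ha : a ≠ 0) : ∀ᶠ x in 𝓝 a, ∀ v : E → ℝ,
    HarmonicOnNhd v {0}ᶜ → (∀ x ≠ 0, 0 ≤ v x) → v x ≤ 2 * v a ∧ v a ≤ 2 * v x := by
  have hR : 0 < ‖a‖ / 2 := by have := norm_pos_iff.2 ha; positivity
  have hsub : closedBall a (‖a‖ / 2) ⊆ {0}ᶜ := fun x hx h0 => by
    rw [mem_singleton_iff.1 h0, mem_closedBall_iff_norm, zero_sub, norm_neg] at hx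
    linarith
  have hρ : Tendsto (fun x => ‖x - a‖ / (‖a‖ / 2)) (𝓝 a) (𝓝 0) := by
    have : Continuous fun y => ‖y - a‖ / (‖a‖ / 2) := by fun_prop
    simpa using this.tendsto a
  filter_upwards [((tendsto_harnackUpper (E := E)).comp hρ).eventually (gt_mem_nhds one_lt_two),
    ((tendsto_harnackLower (E := E)).comp hρ).eventually (lt_mem_nhds one_half_lt_one),
    ball_mem_nhds a hR] with x h1 h2 hx v hv h0
  have h := InnerProductSpace.HarmonicOnNhd.harnack hR (hv.mono (ball_subset_closedBall.trans hsub))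
    (hv.continuousOn.mono hsub) (fun z hz => h0 z (hsub (sphere_subset_closedBall hz))) hx
  simp only [Function.comp_apply] at h1 h2
  have := h0 a ha
  constructor <;> nlinarith [h.1, h.2]

/-- The local Harnack inequality chains along the punctured space, which is connected in dimension
at least `2`. The constant is independent of `v`. -/
theorem exists_harnack_of_ne_zero (hd : 2 ≤ finrank ℝ E) {e x : E} (he : e ≠ 0) (hx : x ≠ 0) :
    ∃ C > 0, ∀ v : E → ℝ, HarmonicOnNhd v {0}ᶜ → (∀ x ≠ 0, 0 ≤ v x) →
      v x ≤ C * v e ∧ v e ≤ C * v x := by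
  set P : E → Prop := fun x => ∃ C > 0, ∀ v : E → ℝ, HarmonicOnNhd v {0}ᶜ → (∀ x ≠ 0, 0 ≤ v x) →
      v x ≤ C * v e ∧ v e ≤ C * v x with hP
  have hstep : ∀ a b : E, (∀ v : E → ℝ, HarmonicOnNhd v {0}ᶜ → (∀ x ≠ 0, 0 ≤ v x) →
      v b ≤ 2 * v a ∧ v a ≤ 2 * v b) → P a → P b := by
    rintro a b hab ⟨C, hC, h⟩
    refine ⟨2 * C, by positivity, fun v hv h0 => ?_⟩
    have h1 := hab v hv h0
    have h2 := h v hv h0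
    constructor <;> nlinarith [h1.1, h1.2, h2.1, h2.2]
  have hopen : ∀ b : Prop, IsOpen {x ∈ ({0}ᶜ : Set E) | P x ↔ b} := fun b => by
    refine isOpen_iff_mem_nhds.2 fun a ha => ?_
    filter_upwards [eventually_harnack (mem_compl_singleton_iff.1 ha.1),
      isOpen_compl_singleton.mem_nhds ha.1] with x h1 h2
    exact ⟨h2, Iff.trans ⟨hstep x a fun v hv h0 => (h1 v hv h0).symm, hstep a x h1⟩ ha.2⟩
  have hconn : IsPreconnected ({0}ᶜ : Set E) :=
    (isConnected_compl_singleton_of_one_lt_rank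
      (by exact_mod_cast Module.lt_rank_of_lt_finrank hd) 0).isPreconnected
  have hPe : P e := ⟨1, one_pos, fun v _ _ => by simp⟩
  exact (hconn.subset_left_of_subset_union (hopen True) (hopen False)
    (disjoint_left.2 fun x h1 h2 => h2.2.1 (h1.2.2 trivial)) (fun x hx => by
      by_cases hb : P x
      · exact Or.inl ⟨hx, iff_true_intro hb⟩
      · exact Or.inr ⟨hx, iff_false_intro hb⟩) ⟨e, he, he, iff_true_intro hPe⟩ hx).2.2 trivial

/-- The Harnack inequality on spheres centred at the origin, with a constant independent of the
radius. -/
theorem exists_harnack_sphere (hd : 2 ≤ finrank ℝ E) :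
    ∃ C > 0, ∀ v : E → ℝ, HarmonicOnNhd v {0}ᶜ → (∀ x ≠ 0, 0 ≤ v x) →
      ∀ x y : E, x ≠ 0 → ‖x‖ = ‖y‖ → v x ≤ C * v y := by
  obtain ⟨e, he⟩ := exists_ne (0 : E)
  obtain ⟨C, hC, h⟩ : ∃ C > 0, ∀ x ∈ sphere (0 : E) 1, ∀ v : E → ℝ, HarmonicOnNhd v {0}ᶜ →
      (∀ x ≠ 0, 0 ≤ v x) → v x ≤ C * v e ∧ v e ≤ C * v x := by
    refine (isCompact_sphere (0 : E) 1).induction_on (p := fun S => ∃ C > 0, ∀ x ∈ S, ∀ v : E → ℝ,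
      HarmonicOnNhd v {0}ᶜ → (∀ x ≠ 0, 0 ≤ v x) → v x ≤ C * v e ∧ v e ≤ C * v x)
      ⟨1, one_pos, by simp⟩ ?_ ?_ ?_
    · rintro S T hST ⟨C, hC, h⟩
      exact ⟨C, hC, fun x hx => h x (hST hx)⟩
    · rintro S T ⟨C, hC, h⟩ ⟨D, hD, h'⟩
      refine ⟨C + D, by positivity, ?_⟩
      rintro x hx v hv h0
      have he0 := h0 e he
      rcases hx with hx | hx
      · have h1 := h x hx v hv h0
        have hx0 : 0 ≤ v x := nonneg_of_mul_nonneg_right (he0.trans h1.2) hC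
        exact ⟨by nlinarith [h1.1], by nlinarith [h1.2]⟩
      · have h1 := h' x hx v hv h0
        have hx0 : 0 ≤ v x := nonneg_of_mul_nonneg_right (he0.trans h1.2) hD
        exact ⟨by nlinarith [h1.1], by nlinarith [h1.2]⟩
    · intro x hx
      have hx0 : x ≠ 0 := ne_zero_of_mem_unit_sphere ⟨x, hx⟩
      obtain ⟨C, hC, h⟩ := exists_harnack_of_ne_zero hd he hx0
      refine ⟨_, nhdsWithin_le_nhds (eventually_harnack hx0), 2 * C, by positivity, ?_⟩
      intro y hy v hv h0
      have h1 := hy v hv h0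
      have h2 := h v hv h0
      constructor <;> nlinarith [h1.1, h1.2, h2.1, h2.2]
  refine ⟨C * C, by positivity, fun v hv h0 x y hx hxy => ?_⟩
  have hr : 0 < ‖x‖ := norm_pos_iff.2 hx
  -- The class of nonnegative harmonic functions on the punctured space is invariant under
  -- dilations, so the constant of the unit sphere serves every radius.
  have hv' : HarmonicOnNhd (fun z => v (0 + ‖x‖ • z)) {0}ᶜ := fun z hz =>
    HarmonicAt.comp_affine (hv _ (by
      rw [zero_add]
      exact smul_ne_zero hr.ne' hz))
  have h0' : ∀ z : E, z ≠ 0 → 0 ≤ v (0 + ‖x‖ • z) := fun z hz => h0 _ (by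
    rw [zero_add]
    exact smul_ne_zero hr.ne' hz)
  have hs : ∀ z : E, ‖z‖ = ‖x‖ → ‖x‖⁻¹ • z ∈ sphere (0 : E) 1 := fun z hz => by
    rw [mem_sphere_zero_iff_norm, norm_smul, norm_inv, norm_norm, hz, inv_mul_cancel₀ hr.ne']
  have h1 := (h _ (hs x rfl) _ hv' h0').1
  have h2 := (h _ (hs y hxy.symm) _ hv' h0').2
  simp only [smul_inv_smul₀ hr.ne', zero_add] at h1 h2
  nlinarith

/-- A lower bound `ε` on a large sphere would propagate inward to the point where `v < ε`, so each
large sphere contains a point with `v < ε`, and Harnack gives `v ≤ C ε` on all of it. In the same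
way `v ≤ C ε * fundamental` near the origin. The annulus principle combines the two into `v ≤ C ε (1
+ fundamental)`. -/
theorem eq_zero_of_harmonic_of_small (hd : 3 ≤ finrank ℝ E) {v : E → ℝ}
    (hv : HarmonicOnNhd v {0}ᶜ) (h0 : ∀ x ≠ 0, 0 ≤ v x)
    (h1 : ∀ ε > 0, ∃ x ≠ 0, v x < ε) (h2 : ∀ ε > 0, ∃ x ≠ 0, v x < ε * fundamental x)
    {x : E} (hx : x ≠ 0) : v x = 0 := by
  refine le_antisymm ?_ (h0 x hx)
  obtain ⟨C, hC, hH⟩ := exists_harnack_sphere (E := E) (by omega)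
  have ht := fundamental_pos hx
  have key : ∀ ε > 0, v x ≤ C * ε * (1 + fundamental x) := by
    intro ε hε
    obtain ⟨x₁, hx₁, hv₁⟩ := h1 ε hε
    obtain ⟨x₂, hx₂, hv₂⟩ := h2 ε hε
    have hbig : ∀ z : E, ‖x₁‖ < ‖z‖ → v z ≤ C * ε := by
      intro z hz
      have hz0 : z ≠ 0 := norm_pos_iff.1 ((norm_nonneg _).trans_lt hz)
      obtain ⟨y, hy, hyε⟩ : ∃ y : E, ‖y‖ = ‖z‖ ∧ v y < ε := by
        by_contra! hcon
        exact absurd (le_of_forall_le_sphere_of_lt hd hv h0 hcon hx₁ hz) (not_le.2 hv₁)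
      exact (hH v hv h0 z y hz0 hy.symm).trans (mul_le_mul_of_nonneg_left hyε.le hC.le)
    have hsmall : ∀ z : E, z ≠ 0 → ‖z‖ < ‖x₂‖ → v z ≤ C * ε * fundamental z := by
      intro z hz0 hz
      obtain ⟨y, hy, hyε⟩ : ∃ y : E, ‖y‖ = ‖z‖ ∧ v y < ε * fundamental y := by
        by_contra! hcon
        exact absurd (mul_fundamental_le_of_forall_le_sphere_of_lt hd hv h0 hε
          (norm_pos_iff.2 hz0) hcon hz) (not_le.2 hv₂)
      have hyz : fundamental y = fundamental z := by rw [fundamental, fundamental, hy]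
      rw [hyz] at hyε
      rw [mul_assoc]
      exact (hH v hv h0 z y hz0 hy.symm).trans (mul_le_mul_of_nonneg_left hyε.le hC.le)
    set r := min ‖x‖ ‖x₂‖ / 2 with hr
    set s := max ‖x‖ ‖x₁‖ + 1 with hs
    have hm : 0 < min ‖x‖ ‖x₂‖ := lt_min (norm_pos_iff.2 hx) (norm_pos_iff.2 hx₂)
    have h3 := nonneg_of_annulus (harmonicOnNhd_combination hv (-1) (C * ε) (C * ε))
      (r := r) (s := s) (x := x) (by positivity) (fun z hz => ?_) (fun z hz => ?_)
      (by linarith [min_le_left ‖x‖ ‖x₂‖]) (by linarith [le_max_left ‖x‖ ‖x₁‖])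
    · linarith
    · have hz0 : z ≠ 0 := norm_pos_iff.1 (by rw [hz]; positivity)
      have h4 := hsmall z hz0 (by linarith [min_le_right ‖x‖ ‖x₂‖])
      have : 0 ≤ C * ε := by positivity
      linarith
    · have hz0 : z ≠ 0 := norm_pos_iff.1 (by rw [hz]; positivity)
      have h4 := hbig z (by linarith [le_max_right ‖x‖ ‖x₁‖])
      have := fundamental_pos hz0
      have : 0 ≤ C * ε * fundamental z := by positivity
      linarith
  refine le_of_forall_pos_le_add fun ε hε => ?_
  have h5 : 0 < C * (1 + fundamental x) := by positivity
  have h6 := key (ε / (C * (1 + fundamental x))) (by positivity)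
  have h7 : C * (ε / (C * (1 + fundamental x))) * (1 + fundamental x) = ε := by
    field_simp
  linarith

/-- Bôcher's theorem on the punctured space. -/
theorem exists_eq_add_mul_fundamental (hd : 3 ≤ finrank ℝ E) {u : E → ℝ}
    (hu : HarmonicOnNhd u {0}ᶜ) (h0 : ∀ x ≠ 0, 0 ≤ u x) :
    ∃ a b : ℝ, 0 ≤ a ∧ 0 ≤ b ∧ ∀ x ≠ 0, u x = a + b * fundamental x := by
  obtain ⟨e, he⟩ := exists_ne (0 : E)
  have hinf : ∀ g : E → ℝ, (∀ x ≠ 0, 0 ≤ g x) → ∃ c, 0 ≤ c ∧ (∀ x ≠ 0, c ≤ g x) ∧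
      ∀ ε > 0, ∃ x ≠ 0, g x < c + ε := by
    intro g hg
    have hne : (g '' {0}ᶜ).Nonempty := ⟨g e, e, he, rfl⟩
    have hlb : 0 ∈ lowerBounds (g '' {0}ᶜ) := by
      rintro _ ⟨x, hx, rfl⟩
      exact hg x hx
    refine ⟨sInf (g '' {0}ᶜ), le_csInf hne hlb, fun x hx => csInf_le ⟨0, hlb⟩ ⟨x, hx, rfl⟩,
      fun ε hε => ?_⟩
    obtain ⟨_, ⟨x, hx, rfl⟩, hlt⟩ := exists_lt_of_csInf_lt hne (lt_add_of_pos_right _ hε)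
    exact ⟨x, hx, hlt⟩
  -- First the largest multiple `b` of the fundamental solution below `u` is removed, then the
  -- largest constant `a`. The remainder is nonnegative and small in both senses of
  -- `eq_zero_of_harmonic_of_small`.
  obtain ⟨b, hb0, hb, hb'⟩ := hinf (fun x => u x / fundamental x) fun x hx =>
    div_nonneg (h0 x hx) (fundamental_pos hx).le
  obtain ⟨a, ha0, ha, ha'⟩ := hinf (fun x => u x - b * fundamental x) fun x hx =>
    sub_nonneg.2 ((le_div_iff₀ (fundamental_pos hx)).1 (hb x hx))
  refine ⟨a, b, ha0, hb0, fun x hx => ?_⟩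
  have h := eq_zero_of_harmonic_of_small hd (harmonicOnNhd_combination hu 1 (-a) (-b))
    (fun z hz => by linarith [ha z hz]) (fun ε hε => ?_) (fun ε hε => ?_) hx
  · linarith
  · obtain ⟨z, hz, hlt⟩ := ha' ε hε
    exact ⟨z, hz, by linarith⟩
  · obtain ⟨z, hz, hlt⟩ := hb' ε hε
    rw [div_lt_iff₀ (fundamental_pos hz)] at hlt
    exact ⟨z, hz, by linarith⟩

end Bocher

/-! ### Potentials with one-point support -/

section Green

open InnerProductSpace Module Metric

variable {E : Type*} [NormedAddCommGroup E] [InnerProductSpace ℝ E] [FiniteDimensional ℝ E]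
  [Nontrivial E] [MeasurableSpace E] [BorelSpace E] {K : Set E → (E → ℝ) → Prop} {w : E → ℝ}

theorem exists_eq_add_mul_fundamental_sub (hd : 3 ≤ finrank ℝ E) {y : E} {u : E → ℝ}
    (hu : HarmonicOnNhd u {y}ᶜ) (h0 : ∀ x ≠ y, 0 ≤ u x) :
    ∃ a b : ℝ, 0 ≤ a ∧ 0 ≤ b ∧ ∀ x ≠ y, u x = a + b * fundamental (x - y) := by
  have hv : HarmonicOnNhd (fun x => u (y + (1 : ℝ) • x)) {0}ᶜ := fun x hx =>
    InnerProductSpace.HarmonicAt.comp_affine (hu _ (by simpa using hx))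
  obtain ⟨a, b, ha, hb, h⟩ := exists_eq_add_mul_fundamental hd hv fun x hx => h0 _ (by simpa using hx)
  refine ⟨a, b, ha, hb, fun x hx => ?_⟩
  simpa using h (x - y) (sub_ne_zero.2 hx)

/-- A hyperharmonic function that equals `c / w` on a sphere is at least `c / w` at the centre. -/
theorem IsWeightedHarmonic.le_of_eq_on_sphere (hK : IsWeightedHarmonic K w) {p : E → EReal}
    (hp : IsHyperharmonic K univ p) {y : E} {r : ℝ} (hr : 0 < r) {c : ℝ}
    (hc : ∀ x, ‖x - y‖ = r → p x = ((c / w x : ℝ) : EReal)) : ((c / w y : ℝ) : EReal) ≤ p y := by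
  have hω := hK.regular_ball y hr
  have hfr : frontier (ball y r) = sphere y r := frontier_ball _ hr.ne'
  obtain ⟨μ, hμ⟩ := hω.exists_isHarmonicMeasure (hK.sheaf.add _ isOpen_ball)
    (hK.sheaf.smul _ isOpen_ball) (mem_ball_self hr)
  have hcont : Continuous fun x => c / w x :=
    continuous_const.div hK.continuous fun x => (hK.pos x).ne'
  have h1 := hμ.repr (fun x => c / w x) (fun x => c / w x) hcont.continuousOn
    ⟨(hK.div_iff isOpen_ball).2 (harmonicOnNhd_const c), fun z _ =>
      (hcont.tendsto z).mono_left nhdsWithin_le_nhds⟩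
  have := hμ.finite
  have h2 := hp.le _ hω (subset_univ _) y (mem_ball_self hr) μ hμ
  rwa [extIntegral_coe isClosed_frontier.measurableSet (f := fun x => c / w x)
    (hcont.continuousOn.integrableOn_compact hω.isCompact_closure.frontier_of_closure)
    (fun x hx => hc x (by rw [hfr] at hx; simpa using hx)), ← h1] at h2

/-- A potential with harmonic support `{y}` is a multiple of the fundamental solution. -/
theorem IsWeightedHarmonic.exists_eq_fundamental (hK : IsWeightedHarmonic K w)
    (hd : 3 ≤ finrank ℝ E) {p : E → EReal} (hp : IsHarmonicPotential K p) {y : E}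
    (hy : harmonicSupport K p = {y}) :
    ∃ b : ℝ, 0 < b ∧ p y = ⊤ ∧
      ∀ x ≠ y, p x = ((b * fundamental (x - y) / w x : ℝ) : EReal) := by
  have hloc : ∀ x ≠ y, ∃ U, IsOpen U ∧ x ∈ U ∧ ∃ h : E → ℝ, K U h ∧ ∀ z ∈ U, p z = (h z : EReal) :=
    fun x hx => by
      by_contra hcon
      exact hx (mem_singleton_iff.1 (hy ▸ (show x ∈ harmonicSupport K p from hcon)))
  have hu : HarmonicOnNhd (fun x => w x * (p x).toReal) {y}ᶜ := fun x hx => by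
    obtain ⟨U, hU, hxU, h, hh, hph⟩ := hloc x hx
    exact ((hK.iff hU).1 hh).congr hU (fun z hz => by simp only [hph z hz, EReal.toReal_coe]) x hxU
  obtain ⟨a, b, ha, hb, hab⟩ := exists_eq_add_mul_fundamental_sub hd hu fun x _ =>
    mul_nonneg (hK.pos x).le (EReal.toReal_nonneg (hp.nonneg x))
  have hpx : ∀ x ≠ y, p x = (((a + b * fundamental (x - y)) / w x : ℝ) : EReal) := fun x hx => by
    obtain ⟨U, hU, hxU, h, hh, hph⟩ := hloc x hx
    rw [← hab x hx, hph x hxU, EReal.toReal_coe, mul_div_cancel_left₀ _ (hK.pos x).ne']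
  have hsph : ∀ r : ℝ, 0 < r → ∀ M : ℝ, (∀ x : E, ‖x‖ = r → fundamental x = M) →
      (((a + b * M) / w y : ℝ) : EReal) ≤ p y := fun r hr M hM =>
    hK.le_of_eq_on_sphere hp.hyperharmonic hr fun x hx => by
      rw [hpx x (sub_ne_zero.1 (norm_pos_iff.1 (hx ▸ hr))), hM _ hx]
  have hfund : ∀ x x' : E, ‖x‖ = ‖x'‖ → fundamental x = fundamental x' := fun x x' h => by
    rw [fundamental, fundamental, h]
  obtain ⟨e, he⟩ := exists_ne (0 : E)
  -- The constant part of Bôcher's decomposition would make `a / w` a nonnegative harmonic minorant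
  -- of the potential. At `y` itself the bound comes from a sphere around `y`.
  have ha0 : a = 0 := by
    have h1 := hp.minorant (fun x => a / w x) ((hK.div_iff isOpen_univ).2 (harmonicOnNhd_const a))
      (fun x => div_nonneg ha (hK.pos x).le) (fun x => ?_) y
    · exact (div_eq_zero_iff.1 h1).resolve_right (hK.pos y).ne'
    · have hle : ∀ t : ℝ, 0 ≤ t → a / w x ≤ (a + b * t) / w x := fun t ht =>
        div_le_div_of_nonneg_right (by nlinarith) (hK.pos x).le
      rcases eq_or_ne x y with rfl | hx
      · refine le_trans ?_ (hsph ‖e‖ (norm_pos_iff.2 he) (fundamental e) fun x hx => hfund x e hx)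
        exact EReal.coe_le_coe_iff.2 (hle _ (fundamental_pos he).le)
      · rw [hpx x hx]
        exact EReal.coe_le_coe_iff.2 (hle _ (fundamental_pos (sub_ne_zero.2 hx)).le)
  subst ha0
  simp only [zero_add] at hpx hsph
  -- For `b = 0` the potential vanishes off `y`, and by lower semicontinuity at `y` too; it would be
  -- harmonic everywhere, with empty support.
  have hb0 : 0 < b := by
    refine hb.lt_of_ne fun hb0 => ?_
    subst hb0
    simp only [zero_mul, zero_div, EReal.coe_zero] at hpx
    have hpy : p y = 0 := by
      refine le_antisymm (not_lt.1 fun hlt => ?_) (hp.nonneg y)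
      have h1 := hp.hyperharmonic.lsc y (mem_univ y) 0 hlt
      rw [nhdsWithin_univ] at h1
      have h2 : ∀ᶠ x in 𝓝[≠] y, (0 : EReal) < p x := nhdsWithin_le_nhds h1
      have : (𝓝[≠] y).NeBot := Module.punctured_nhds_neBot ℝ E y
      obtain ⟨x, h3, h4⟩ := (h2.and self_mem_nhdsWithin).exists
      rw [hpx x h4] at h3
      exact lt_irrefl _ h3
    have hmem : y ∈ harmonicSupport K p := hy ▸ mem_singleton y
    refine hmem ⟨univ, isOpen_univ, mem_univ y, 0, hK.sheaf.zero _ isOpen_univ, fun x _ => ?_⟩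
    rcases eq_or_ne x y with rfl | hx
    · simpa using hpy
    · simpa using hpx x hx
  -- Small spheres around `y` carry arbitrarily large values of the fundamental solution, and each
  -- bounds `p y` from below.
  refine ⟨b, hb0, (EReal.eq_top_iff_forall_lt _).2 fun M => ?_, hpx⟩
  obtain ⟨r, hr, -, hrM⟩ := exists_lt_fundamental (E := E) hd ((M + 1) * w y / b) one_pos
  obtain ⟨z, hz⟩ := exists_norm_eq E hr.le
  refine lt_of_lt_of_le ?_ (hsph r hr (fundamental z) fun x hx => hfund x z (hx.trans hz.symm))
  rw [EReal.coe_lt_coe_iff, lt_div_iff₀ (hK.pos y)]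
  have h1 := (div_le_iff₀' hb0).1 (hrM z hz)
  have := hK.pos y
  linarith

theorem IsWeightedHarmonic.isGreenHarmonicSpace (hK : IsWeightedHarmonic K w)
    (hd : 3 ≤ finrank ℝ E) : IsGreenHarmonicSpace K where
  brelot := hK.isBrelotHarmonicSpace
  proportional y p p' hp hp' hy hy' := by
    obtain ⟨b, hb, htop, h⟩ := hK.exists_eq_fundamental hd hp hy
    obtain ⟨b', hb', htop', h'⟩ := hK.exists_eq_fundamental hd hp' hy'
    refine ⟨b / b', div_pos hb hb', fun x => ?_⟩
    rcases eq_or_ne x y with rfl | hx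
    · rw [htop, htop', EReal.coe_mul_top_of_pos (div_pos hb hb')]
    · rw [h x hx, h' x hx, ← EReal.coe_mul, EReal.coe_eq_coe_iff]
      field_simp

/-! ### The renormalized biharmonic space -/

variable {p q : E → ℝ}

theorem isWeightedHarmonic_firstSheaf (hd : 2 ≤ finrank ℝ E) (hp : Continuous p)
    (hq : Continuous q) (hp0 : ∀ x, 0 < p x) (hq0 : ∀ x, 0 < q x) :
    IsWeightedHarmonic (firstSheaf (renormalized biharmonicSheaf p q)) p :=
  ⟨hp, hp0, fun hU _ => firstSheaf_renormalized hd hp hq hp0 hq0 hU⟩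

theorem isWeightedHarmonic_secondSheaf (hd : 2 ≤ finrank ℝ E) (hp : Continuous p)
    (hq : Continuous q) (hp0 : ∀ x, 0 < p x) (hq0 : ∀ x, 0 < q x) :
    IsWeightedHarmonic (secondSheaf (renormalized biharmonicSheaf p q)) q :=
  ⟨hq, hq0, fun hU _ => secondSheaf_renormalized hd hp hq hp0 hq0 hU⟩

theorem biharmonicSheaf.congr {U : Set E} (hU : IsOpen U) {u v u' v' : E → ℝ} (hu : EqOn u u' U)
    (hv : EqOn v v' U) (h : biharmonicSheaf U u v) : biharmonicSheaf U u' v' := by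
  refine ⟨h.1.congr hu.symm, h.2.1.congr hv.symm, fun x hx => ?_⟩
  have hn := hU.mem_nhds hx
  rw [laplacian_congr_nhds (hu.symm.eventuallyEq_of_mem hn) |>.self_of_nhds,
    laplacian_congr_nhds (hv.symm.eventuallyEq_of_mem hn) |>.self_of_nhds, ← hv hx]
  exact h.2.2 x hx

theorem biharmonicSheaf.eq_zero {W : Set E} (hW : IsOpen W) {u v : E → ℝ}
    (h : biharmonicSheaf W u v) (hu : ∀ x ∈ W, u x = 0) : ∀ x ∈ W, v x = 0 := by
  intro x hx
  have h1 : u =ᶠ[𝓝 x] fun _ => 0 := by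
    filter_upwards [hW.mem_nhds hx] with z hz using hu z hz
  have h2 := (h.2.2 x hx).1
  rw [(laplacian_congr_nhds h1).self_of_nhds, laplacian_const] at h2
  simpa using h2.symm

theorem isBiharmonicSpace_renormalized (hd : 2 ≤ finrank ℝ E) (hp : Continuous p)
    (hq : Continuous q) (hp0 : ∀ x, 0 < p x) (hq0 : ∀ x, 0 < q x) :
    IsBiharmonicSpace (renormalized (biharmonicSheaf (E := E)) p q) where
  t2 := inferInstance
  locallyCompact := inferInstance
  secondCountable := inferInstance
  congr U hU u v u' v' hu hv h := ⟨h.1.congr hu.symm, h.2.1.congr hv.symm,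
    h.2.2.congr hU (fun x hx => by simp only [hu hx]) fun x hx => by simp only [hv hx]⟩
  continuousOn U _ u v h := ⟨h.1, h.2.1⟩
  zero U hU := ⟨continuousOn_const, continuousOn_const,
    biharmonicSheaf.congr hU (fun x _ => (mul_zero _).symm) (fun x _ => (mul_zero _).symm)
      (biharmonicSheaf_of_harmonic hU (harmonicOnNhd_const (0 : ℝ)))⟩
  add U hU u v u' v' h h' := ⟨h.1.add h'.1, h.2.1.add h'.2.1,
    (h.2.2.add hU h'.2.2).congr hU (fun x _ => (mul_add _ _ _).symm)
      fun x _ => (mul_add _ _ _).symm⟩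
  smul U hU c u v h := ⟨h.1.const_smul c, h.2.1.const_smul c,
    (h.2.2.smul hU c).congr hU (fun x _ => mul_left_comm _ _ _) fun x _ => mul_left_comm _ _ _⟩
  compatible U _ u v h W hW hWU h0 x hx := by
    have h1 : biharmonicSheaf W (fun x => p x * u x) fun x => q x * v x :=
      ⟨h.2.2.1.mono hWU, h.2.2.2.1.mono hWU, fun x hx => h.2.2.2.2 x (hWU hx)⟩
    have h2 := h1.eq_zero hW (fun x hx => by rw [h0 x hx, mul_zero]) x hx
    exact (mul_eq_zero.1 h2).resolve_left (hq0 x).ne'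
  restrict U V _ _ hUV u v h := ⟨h.1.mono hUV, h.2.1.mono hUV, h.2.2.1.mono hUV,
    h.2.2.2.1.mono hUV, fun x hx => h.2.2.2.2 x (hUV hx)⟩
  glue S hS u v h := by
    have hn : ∀ {U x}, U ∈ S → x ∈ U → U ∈ 𝓝 x := fun hU hx => (hS _ hU).mem_nhds hx
    refine ⟨fun x ⟨U, hU, hx⟩ => ?_, fun x ⟨U, hU, hx⟩ => ?_, fun x ⟨U, hU, hx⟩ => ?_,
      fun x ⟨U, hU, hx⟩ => ?_, fun x ⟨U, hU, hx⟩ => (h U hU).2.2.2.2 x hx⟩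
    · exact ((h U hU).1.continuousAt (hn hU hx)).continuousWithinAt
    · exact ((h U hU).2.1.continuousAt (hn hU hx)).continuousWithinAt
    · exact ((h U hU).2.2.1.contDiffAt (hn hU hx)).contDiffWithinAt
    · exact ((h U hU).2.2.2.1.contDiffAt (hn hU hx)).contDiffWithinAt
  base_regular x U hU hx := by
    obtain ⟨R, hR, hRU⟩ := nhds_basis_ball.mem_iff.1 (hU.mem_nhds hx)
    exact ⟨ball x R, (isBiharmonicRegular_ball hd x hR).renormalized
      (fun _ _ _ _ h => h.continuousOn) hp hq hp0 hq0, mem_ball_self hR, hRU⟩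
  bauer_first := (isWeightedHarmonic_firstSheaf hd hp hq hp0 hq0).isBauerHarmonicSpace
  bauer_second := (isWeightedHarmonic_secondSheaf hd hp hq hp0 hq0).isBauerHarmonicSpace

theorem isGreenBiharmonicSpace_renormalized (hd : 3 ≤ finrank ℝ E) (hp : Continuous p)
    (hq : Continuous q) (hp0 : ∀ x, 0 < p x) (hq0 : ∀ x, 0 < q x) :
    IsGreenBiharmonicSpace (renormalized (biharmonicSheaf (E := E)) p q) where
  biharmonic := isBiharmonicSpace_renormalized (by omega) hp hq hp0 hq0
  green_first :=
    (isWeightedHarmonic_firstSheaf (by omega) hp hq hp0 hq0).isGreenHarmonicSpace hd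
  green_second :=
    (isWeightedHarmonic_secondSheaf (by omega) hp hq hp0 hq0).isGreenHarmonicSpace hd

theorem renormalized_one_one :
    renormalized (biharmonicSheaf (E := E)) (fun _ => 1) (fun _ => 1) = biharmonicSheaf := by
  funext U u v
  simp only [renormalized, one_mul]
  exact propext ⟨fun h => h.2.2, fun h => ⟨h.continuousOn.1, h.continuousOn.2, h⟩⟩

theorem isBiharmonicSpace_biharmonicSheaf (hd : 2 ≤ finrank ℝ E) :
    IsBiharmonicSpace (biharmonicSheaf (E := E)) := by
  rw [← renormalized_one_one]
  exact isBiharmonicSpace_renormalized hd continuous_const continuous_const (fun _ => one_pos)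
    fun _ => one_pos

/-! ### Liouville property of nonnegative biharmonic pairs -/

/-- Liouville makes `k` constant. The Laplacian of `‖x‖²` is `2 d`, so with `c = k 0 / (2 d)` the
function `h + c ‖x‖²` is nonnegative and harmonic, and Liouville applies again. -/
theorem biharmonicSheaf.eq_const_of_nonneg {h k : E → ℝ} (H : biharmonicSheaf univ h k)
    (h0 : ∀ x, 0 ≤ h x ∧ 0 ≤ k x) : (∀ x, k x = 0) ∧ ∀ x, h x = h 0 := by
  have hk := (H.harmonic isOpen_univ).eq_of_nonneg fun x => (h0 x).2
  have hd : (0 : ℝ) < (finrank ℝ E : ℝ) := by exact_mod_cast finrank_pos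
  set c := k 0 / (2 * (finrank ℝ E : ℝ)) with hc
  have hc0 : 0 ≤ c := div_nonneg (h0 0).2 (by positivity)
  have hh : ∀ x, ContDiffAt ℝ 2 h x := fun x => H.1.contDiffAt univ_mem
  have hq : ∀ x : E, ContDiffAt ℝ 2 (fun x : E => ‖x - 0‖ ^ 2) x := fun x => by
    simpa using (contDiff_norm_sq ℝ).contDiffAt
  have hq' : ∀ x : E, ContDiffAt ℝ 2 (c • fun x : E => ‖x - 0‖ ^ 2) x := fun x =>
    (hq x).const_smul c
  have hg : HarmonicOnNhd (h + c • fun x : E => ‖x - 0‖ ^ 2) univ := by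
    refine (harmonicOnNhd_iff isOpen_univ).2 ⟨fun x _ => ((hh x).add (hq' x)).contDiffWithinAt,
      fun x hx => ?_⟩
    rw [(hh x).laplacian_add (hq' x), laplacian_smul c (hq x), laplacian_norm_sub_sq,
      (H.2.2 x hx).1, hk x, smul_eq_mul, hc]
    field_simp
    ring
  have hconst := hg.eq_of_nonneg fun x => by
    have := (h0 x).1
    simp only [Pi.add_apply, Pi.smul_apply, smul_eq_mul]
    positivity
  simp only [Pi.add_apply, Pi.smul_apply, smul_eq_mul, sub_zero, norm_zero] at hconst
  have hc1 : c = 0 := by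
    refine hc0.antisymm' (not_lt.1 fun hpos => ?_)
    -- The radius is chosen with `c ‖z‖² = h 0 + 1`, which would give `h z = -1`.
    obtain ⟨z, hz⟩ := exists_norm_eq E (Real.sqrt_nonneg ((h 0 + 1) / c))
    have h1 := hconst z
    have h2 := (h0 0).1
    rw [hz, Real.sq_sqrt (by positivity), mul_div_cancel₀ _ hpos.ne'] at h1
    linarith [(h0 z).1]
  have hk0 : k 0 = 0 := by
    rcases div_eq_zero_iff.1 (hc.symm.trans hc1) with h | h
    · exact h
    · linarith
  refine ⟨fun x => (hk x).trans hk0, fun x => ?_⟩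
  have := hconst x
  simpa [hc1] using this

theorem not_hasPositivePair_biharmonicSheaf : ¬ HasPositivePair (biharmonicSheaf (E := E)) := by
  rintro ⟨h, k, H, h0⟩
  have := (H.eq_const_of_nonneg fun x => ⟨(h0 x).1.le, (h0 x).2.le⟩).1 0
  exact (h0 0).2.ne' this

theorem not_hasPositivePair_renormalized (hp0 : ∀ x, 0 < p x) (hq0 : ∀ x, 0 < q x) :
    ¬ HasPositivePair (renormalized (biharmonicSheaf (E := E)) p q) := by
  rintro ⟨h, k, H, h0⟩
  exact not_hasPositivePair_biharmonicSheaf ⟨_, _, H.2.2, fun x =>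
    ⟨mul_pos (hp0 x) (h0 x).1, mul_pos (hq0 x) (h0 x).2⟩⟩

theorem isHyperharmonicPair_one_one (hp : Continuous p) (hq : Continuous q) (hp0 : ∀ x, 0 < p x)
    (hq0 : ∀ x, 0 < q x) (h : IsHyperharmonicPair (biharmonicSheaf (E := E)) univ
      (fun x => (p x : EReal)) fun x => (q x : EReal)) :
    IsHyperharmonicPair (renormalized (biharmonicSheaf (E := E)) p q) univ (fun _ => 1)
      fun _ => 1 := by
  rw [isHyperharmonicPair_renormalized_iff (fun _ _ _ h => h.continuousOn) hp hq hp0 hq0]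
  simpa only [mul_one] using h

/-- The pair `(1, 1)` is the required potential: a minorant `(u, v)` of it gives the minorant `(p u,
q v)` of `(p, q)`. -/
theorem isStrong_renormalized (h : IsPositiveContinuousPotential (biharmonicSheaf (E := E)) p q) :
    IsStrong (renormalized (biharmonicSheaf (E := E)) p q) := by
  obtain ⟨hp, hq, h0, hpot⟩ := h
  refine ⟨fun _ => 1, fun _ => 1, ⟨isHyperharmonicPair_one_one hp hq (fun x => (h0 x).1)
    (fun x => (h0 x).2) hpot.hyperharmonic, ?_, fun _ => ⟨zero_le_one, zero_le_one⟩, ?_⟩,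
    fun _ => ⟨zero_lt_one, zero_lt_one⟩⟩
  · have : {x : E | (1 : EReal) ≠ ⊤} = univ := eq_univ_of_forall fun _ => EReal.coe_ne_top 1
    rw [this]
    exact dense_univ
  · intro u v H huv hle x
    have h1 : ∀ x, u x ≤ 1 ∧ v x ≤ 1 := fun x => by exact_mod_cast hle x
    have h2 := hpot.minorant _ _ H.2.2
      (fun x => ⟨mul_nonneg (h0 x).1.le (huv x).1, mul_nonneg (h0 x).2.le (huv x).2⟩)
      (fun x => ⟨EReal.coe_le_coe_iff.2 (mul_le_of_le_one_right (h0 x).1.le (h1 x).1),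
        EReal.coe_le_coe_iff.2 (mul_le_of_le_one_right (h0 x).2.le (h1 x).2)⟩) x
    exact ⟨(mul_eq_zero.1 h2.1).resolve_left (h0 x).1.ne',
      (mul_eq_zero.1 h2.2).resolve_left (h0 x).2.ne'⟩

/-! ### A finite continuous potential -/

/-- Smooth pairs with `Δ p ≤ -q` and `Δ q ≤ 0` are hyperharmonic. -/
theorem isHyperharmonicPair_of_laplacian_le (hp : ContDiff ℝ 2 p) (hq : ContDiff ℝ 2 q)
    (hΔp : ∀ x, (Δ p) x ≤ -q x) (hΔq : ∀ x, (Δ q) x ≤ 0) :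
    IsHyperharmonicPair (biharmonicSheaf (E := E)) univ (fun x => (p x : EReal))
      fun x => (q x : EReal) where
  lsc := ⟨.coe hp.continuous.continuousOn, .coe hq.continuous.continuousOn⟩
  ne_bot _ _ := ⟨EReal.coe_ne_bot _, EReal.coe_ne_bot _⟩
  le ω hω _ x hx μ ν τ hm := by
    have hS := hω.isCompact_closure.frontier_of_closure
    have hb : Bornology.IsBounded ω := hω.isCompact_closure.isBounded.subset subset_closure
    have hpc := hp.continuous.continuousOn (s := frontier ω)
    have hqc := hq.continuous.continuousOn (s := frontier ω)
    obtain ⟨u, v, huv⟩ := hω.exists_solution p q hpc hqc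
    have h1 := hm.repr _ _ _ _ hpc hqc huv
    have hv : ∀ x ∈ ω, v x ≤ q x := le_of_laplacian_le hω.isOpen hb huv.1.2.1 hq.contDiffOn
      (fun x hx => by rw [(huv.1.2.2 x hx).2]; exact hΔq x) (fun y hy => (huv.2 y hy).2)
      (fun y _ => (hq.continuous.tendsto y).mono_left nhdsWithin_le_nhds) fun _ _ => le_rfl
    have hu : ∀ x ∈ ω, u x ≤ p x := le_of_laplacian_le hω.isOpen hb huv.1.1 hp.contDiffOn
      (fun x hx => by rw [(huv.1.2.2 x hx).1]; linarith [hΔp x, hv x hx])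
      (fun y hy => (huv.2 y hy).1)
      (fun y _ => (hp.continuous.tendsto y).mono_left nhdsWithin_le_nhds) fun _ _ => le_rfl
    obtain ⟨hf1, hf2, hf3⟩ := hm.finite
    have hSm := isClosed_frontier (s := ω).measurableSet
    rw [extIntegral_coe hSm (hpc.integrableOn_compact hS) fun _ _ => rfl,
      extIntegral_coe (μ := ν) hSm (hqc.integrableOn_compact hS) fun _ _ => rfl,
      extIntegral_coe (μ := τ) hSm (hqc.integrableOn_compact hS) fun _ _ => rfl,
      ← EReal.coe_add, ← h1.1, ← h1.2, EReal.coe_le_coe_iff, EReal.coe_le_coe_iff]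
    exact ⟨hu x hx, hv x hx⟩

/-- The function `(1 + ‖x‖²) ^ s`. -/
def japaneseBracket (s : ℝ) (x : E) : ℝ := (1 + ‖x‖ ^ 2) ^ s

theorem japaneseBracket_pos (s : ℝ) (x : E) : 0 < japaneseBracket s x :=
  Real.rpow_pos_of_pos (by positivity) _

theorem contDiff_japaneseBracket (s : ℝ) : ContDiff ℝ 2 (japaneseBracket (E := E) s) :=
  (contDiff_const.add (contDiff_norm_sq ℝ)).rpow_const_of_ne fun x => by positivity

theorem laplacian_japaneseBracket (s : ℝ) (x : E) :
    (Δ (japaneseBracket (E := E) s)) x = 2 * s * japaneseBracket (s - 2) x *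
      (finrank ℝ E + (finrank ℝ E + 2 * s - 2) * ‖x‖ ^ 2) := by
  have hd : ∀ (r : ℝ) {t : ℝ}, 0 < 1 + t →
      HasDerivAt (fun t : ℝ => (1 + t) ^ r) (r * (1 + t) ^ (r - 1)) t := fun r t ht => by
    simpa using ((hasDerivAt_id t).const_add 1).rpow_const (p := r) (Or.inl ht.ne')
  have hx : 0 < 1 + ‖x - 0‖ ^ 2 := by positivity
  have h := laplacian_radial (φ := fun t => (1 + t) ^ s)
    (((by fun_prop : Continuous fun t : ℝ => 1 + t).continuousAt.eventually
      (lt_mem_nhds hx)).mono fun t ht => hd s ht) ((hd (s - 1) hx).const_mul s)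
  simp only [sub_zero] at h hx
  rw [show (japaneseBracket (E := E) s) = fun y => (1 + ‖y‖ ^ 2) ^ s from rfl, h, japaneseBracket]
  have h5 : (1 + ‖x‖ ^ 2) ^ (s - 1) = (1 + ‖x‖ ^ 2) ^ (s - 2) * (1 + ‖x‖ ^ 2) := by
    rw [← Real.rpow_add_one hx.ne']; congr 1; ring
  rw [show s - 1 - 1 = s - 2 by ring, h5]
  ring

theorem exists_japaneseBracket_lt {s : ℝ} (hs : s < 0) {ε : ℝ} (hε : 0 < ε) :
    ∃ x : E, japaneseBracket s x < ε := by
  have h1 : Tendsto (fun r : ℝ => (1 + r ^ 2) ^ s) atTop (𝓝 0) := by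
    have h2 := tendsto_rpow_neg_atTop (neg_pos.2 hs)
    rw [neg_neg] at h2
    exact h2.comp (tendsto_atTop_add_const_left _ _ (tendsto_pow_atTop two_ne_zero))
  obtain ⟨r, h2, h3⟩ := ((h1.eventually (gt_mem_nhds hε)).and (eventually_ge_atTop 0)).exists
  obtain ⟨x, hx⟩ := exists_norm_eq E h3
  exact ⟨x, by rw [japaneseBracket, hx]; exact h2⟩

/-- For exponent `-1/2` the Laplacian is `-(1 + ‖x‖²)^(-5/2) (d + (d - 3) ‖x‖²)`, at most `-(1 +
‖x‖²)^(-3/2)`; this would only need `d ≥ 4`. For exponent `-3/2` the coefficient of `‖x‖²` is `d -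
5`, which is where dimension five enters. -/
theorem exists_isPositiveContinuousPotential (hd : 5 ≤ finrank ℝ E) :
    ∃ p q : E → ℝ, IsPositiveContinuousPotential (biharmonicSheaf (E := E)) p q := by
  have hd' : (5 : ℝ) ≤ (finrank ℝ E : ℝ) := by exact_mod_cast hd
  refine ⟨japaneseBracket (-1 / 2), japaneseBracket (-3 / 2),
    (contDiff_japaneseBracket _).continuous, (contDiff_japaneseBracket _).continuous,
    fun x => ⟨japaneseBracket_pos _ x, japaneseBracket_pos _ x⟩,
    isHyperharmonicPair_of_laplacian_le (contDiff_japaneseBracket _) (contDiff_japaneseBracket _)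
      (fun x => ?_) (fun x => ?_), ?_, fun x => ⟨?_, ?_⟩, fun h k H h0 hle => ?_⟩
  · have h1 : japaneseBracket (-3 / 2) x = japaneseBracket (-1 / 2 - 2) x * (1 + ‖x‖ ^ 2) := by
      rw [japaneseBracket, japaneseBracket, ← Real.rpow_add_one (by positivity)]
      congr 1
      norm_num
    rw [laplacian_japaneseBracket, h1]
    have h2 := japaneseBracket_pos (-1 / 2 - 2) x
    have h3 : 1 + ‖x‖ ^ 2 ≤
        finrank ℝ E + ((finrank ℝ E : ℝ) + 2 * (-1 / 2) - 2) * ‖x‖ ^ 2 := by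
      nlinarith [sq_nonneg ‖x‖]
    have h4 := mul_le_mul_of_nonneg_left h3 h2.le
    linarith
  · rw [laplacian_japaneseBracket]
    have h2 := japaneseBracket_pos (-3 / 2 - 2) x
    have h3 : 0 ≤ finrank ℝ E + ((finrank ℝ E : ℝ) + 2 * (-3 / 2) - 2) * ‖x‖ ^ 2 := by
      have : 0 ≤ (finrank ℝ E : ℝ) + 2 * (-3 / 2) - 2 := by linarith
      positivity
    have h4 := mul_nonneg h2.le h3
    linarith
  · have : {x : E | ((japaneseBracket (-1 / 2) x : ℝ) : EReal) ≠ ⊤} = univ :=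
      eq_univ_of_forall fun x => EReal.coe_ne_top _
    rw [this]
    exact dense_univ
  · exact_mod_cast (japaneseBracket_pos _ x).le
  · exact_mod_cast (japaneseBracket_pos _ x).le
  · obtain ⟨h1, h2⟩ := H.eq_const_of_nonneg h0
    -- By the Liouville step `h` is constant, and it lies below a function taking arbitrarily small
    -- values.
    have h3 : h 0 ≤ 0 := by
      refine le_of_forall_pos_le_add fun ε hε => ?_
      obtain ⟨x, hx⟩ := exists_japaneseBracket_lt (E := E) (s := -1 / 2) (by norm_num) hε
      have h4 := EReal.coe_le_coe_iff.1 (hle x).1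
      rw [h2 x] at h4
      linarith
    exact fun x => ⟨(h2 x).trans (le_antisymm h3 (h0 0).1), h1 x⟩

end Green

end

/-! ### The counterexample in Euclidean space -/

theorem mainTheorem9 (N : ℕ) (hN : 5 ≤ N) :
    IsBiharmonicSpace (classicalBiharmonic N) ∧
    ¬ HasPositivePair (classicalBiharmonic N) ∧
    (∃ p q : EuclideanSpace ℝ (Fin N) → ℝ,
      IsPositiveContinuousPotential (classicalBiharmonic N) p q) ∧
    (∀ p q : EuclideanSpace ℝ (Fin N) → ℝ,
      IsPositiveContinuousPotential (classicalBiharmonic N) p q →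
        IsGreenBiharmonicSpace (renormalized (classicalBiharmonic N) p q) ∧
        IsStrong (renormalized (classicalBiharmonic N) p q) ∧
        IsHyperharmonicPair (renormalized (classicalBiharmonic N) p q) univ
          (fun _ => 1) (fun _ => 1) ∧
        ¬ HasPositivePair (renormalized (classicalBiharmonic N) p q)) ∧
    ¬ PositivePairClaim := by
  have hd : Module.finrank ℝ (EuclideanSpace ℝ (Fin N)) = N := by simp
  have : Nontrivial (EuclideanSpace ℝ (Fin N)) :=
    Module.nontrivial_of_finrank_pos (R := ℝ) (by omega)
  -- `classicalBiharmonic N` is definitionally `biharmonicSheaf` on `EuclideanSpace ℝ (Fin N)`.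
  change IsBiharmonicSpace biharmonicSheaf ∧ ¬ HasPositivePair biharmonicSheaf ∧
    (∃ p q, IsPositiveContinuousPotential biharmonicSheaf p q) ∧
    (∀ p q, IsPositiveContinuousPotential biharmonicSheaf p q →
      IsGreenBiharmonicSpace (renormalized biharmonicSheaf p q) ∧
      IsStrong (renormalized biharmonicSheaf p q) ∧
      IsHyperharmonicPair (renormalized biharmonicSheaf p q) univ (fun _ => 1) (fun _ => 1) ∧
      ¬ HasPositivePair (renormalized biharmonicSheaf p q)) ∧ ¬ PositivePairClaim
  have hren : ∀ p q : EuclideanSpace ℝ (Fin N) → ℝ,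
      IsPositiveContinuousPotential biharmonicSheaf p q →
      IsGreenBiharmonicSpace (renormalized biharmonicSheaf p q) ∧
      IsStrong (renormalized biharmonicSheaf p q) ∧
      IsHyperharmonicPair (renormalized biharmonicSheaf p q) univ (fun _ => 1) (fun _ => 1) ∧
      ¬ HasPositivePair (renormalized biharmonicSheaf p q) := fun p q h =>
    ⟨isGreenBiharmonicSpace_renormalized (by omega) h.1 h.2.1 (fun x => (h.2.2.1 x).1)
      fun x => (h.2.2.1 x).2, isStrong_renormalized h,
      isHyperharmonicPair_one_one h.1 h.2.1 (fun x => (h.2.2.1 x).1) (fun x => (h.2.2.1 x).2)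
        h.2.2.2.hyperharmonic,
      not_hasPositivePair_renormalized (fun x => (h.2.2.1 x).1) fun x => (h.2.2.1 x).2⟩
  obtain ⟨p, q, hpq⟩ := exists_isPositiveContinuousPotential
    (E := EuclideanSpace ℝ (Fin N)) (by omega)
  refine ⟨isBiharmonicSpace_biharmonicSheaf (by omega), not_hasPositivePair_biharmonicSheaf,
    ⟨p, q, hpq⟩, hren, fun hclaim => ?_⟩
  obtain ⟨h1, h2, h3, h4⟩ := hren p q hpq
  exact h4 (hclaim _ _ h1 h2 h3)
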